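/- Let $p\in[2,\infty]$. For each $n\ge 2$ let $k_n\in\{1,\dots,n-1\}$, let $X^{(n)}$ be a random vector uniformly distributed (with respect to Lebesgue measure) in the unit ball $\{x\in\mathbb R^n:\|x\|_p\le 1\}$, and let $E^{(n)}$ be a random $k_n$-dimensional linear subspace of $\mathbb R^n$, independent of $X^{(n)}$ and distributed according to the Haar (rotation invariant) probability measure on the Grassmannian of $k_n$-dimensional subspaces of $\mathbb R^n$. Let $P_E$ denote the orthogonal projection onto $E$. Assume that the limit $\lambda:=\lim_{n\to\infty}k_n/n\in[0,1]$ exists. For $p<\infty$ let $f_p(x):=\big(2p^{1/p}\Gamma(1+\tfrac1p)\big)^{-1}e^{-|x|^p/p}$, $x\in\mathbb R$, and put $$\mathcal I_p(t_1,t_2):=\log\int_{\mathbb R}e^{t_1x^2+t_2|x|^p}f_p(x)\,dx\in(-\infty,+\infty],\qquad \mathcal I_p^*(x_1,x_2):=\sup_{t_1,t_2\in\mathbb R}\big[t_1x_1+t_2x_2-\mathcal I_p(t_1,t_2)\big],$$ $$\mathcal J_p(y):=\inf\big\{\mathcal I_p^*(x_1,x_2): x_1,x_2>0,\ x_1^{1/2}x_2^{-1/p}=y\big\},\qquad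 y\in\mathbb R,$$ with $\inf\emptyset=+\infty$. For $p=\infty$ put $$\mathcal I_\infty(t):=\log\int_0^1e^{tx^2}\,dx,\qquad \mathcal I_\infty^*(x):=\sup_{t\in\mathbb R}[tx-\mathcal I_\infty(t)],\qquad \mathcal J_\infty(y):=\mathcal I_\infty^*(y^2).$$ Then the sequence $\big(n^{1/p-1/2}\|P_{E^{(n)}}X^{(n)}\|_2\big)_n$ (with $1/p=0$ if $p=\infty$) satisfies a large deviation principle on $\mathbb R$ with speed $n$ and good rate function $$\mathcal I(y)=\begin{cases}\inf\limits_{x\ge y}\Big[\tfrac\lambda2\log\big(\tfrac{\lambda x^2}{y^2}\big)+\tfrac{1-\lambda}2\log\big(\tfrac{1-\lambda}{1-y^2x^{-2}}\big)+\mathcal J_p(x)\Big]&: y>0\\ \mathcal J_p(0)&: y=0,\ \lambda\in(0,1]\\ \inf\limits_{x\ge0}\mathcal J_p(x)&: y=0,\ \lambda=0\\ +\infty&: y<0,\end{cases}$$ where the term $\tfrac\lambda2\log(\lambda x^2/y^2)$ is read as $0$ if $\lambda=0$, the term $\tfrac{1-\lambda}2\log\big((1-\lambda)/(1-y^2x^{-2})\big)$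 is read as $0$ if $\lambda=1$ (also for $x=y$) and as $+\infty$ if $\lambda<1$ and $x=y$. That is: $\mathcal I:\mathbb R\to[0,\infty]$ is lower semicontinuous with compact level sets $\{\mathcal I\le\alpha\}$, $\alpha\in\mathbb R$, and, with $Y_n:=n^{1/p-1/2}\|P_{E^{(n)}}X^{(n)}\|_2$, for every Lebesgue measurable $A\subset\mathbb R$, $$-\inf_{A^\circ}\mathcal I\le\liminf_{n\to\infty}\tfrac1n\log\mathbb P(Y_n\in A)\le\limsup_{n\to\infty}\tfrac1n\log\mathbb P(Y_n\in A)\le-\inf_{\overline A}\mathcal I .$$ Moreover, for $p=2$ the rate function is explicit. If $\lambda\in(0,1)$, then $$\mathcal I(y)=\tfrac\lambda2\log\big(\tfrac\lambda{y^2}\big)+\tfrac{1-\lambda}2\log\big(\tfrac{1-\lambda}{1-y^2}\big)\ \text{ for } y\in(0,1);$$ if $\lambda=0$, then $\mathcal I(y)=-\tfrac12\log(1-y^2)$ for $y\in[0,1)$; if $\lambda=1$, then $\mathcal I(y)=-\tfrac12\log(y^2)$ for $y\in(0,1]$; and in each case $\mathcal I(y)=+\infty$ for all other $y\in\mathbb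 R$. -/

import Mathlib

open MeasureTheory ProbabilityTheory Filter Topology
open scoped ENNReal

/-! ### Large deviation principles on the real line -/

/-- The sequence `Y` of real random variables on `(Ω, P)` satisfies a (full) large deviation
principle with speed `s` and good rate function `I`. Logarithms of probabilities are taken in
`[-∞, 0]`, i.e. `ENNReal.log 0 = -∞`; `P` of a set is its outer measure, which is the measure in
the completion of `P` on the events `{Y n ∈ A}` that are not literally measurable. -/
structure SatisfiesLDP {Ω : Type*} [MeasurableSpace Ω] (P : Measure Ω) (Y : ℕ → Ω → ℝ)
    (s : ℕ → ℝ) (I : ℝ → EReal) : Prop where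
  nonneg : ∀ x, 0 ≤ I x
  lowerSemicontinuous : LowerSemicontinuous I
  isCompact_level : ∀ α : ℝ, IsCompact {x | I x ≤ (α : EReal)}
  lower_bound : ∀ A : Set ℝ, NullMeasurableSet A (volume : Measure ℝ) →
    -(⨅ x ∈ interior A, I x) ≤
      liminf (fun n ↦ (((s n)⁻¹ : ℝ) : EReal) * ENNReal.log (P {ω | Y n ω ∈ A})) atTop
  upper_bound : ∀ A : Set ℝ, NullMeasurableSet A (volume : Measure ℝ) →
    limsup (fun n ↦ (((s n)⁻¹ : ℝ) : EReal) * ENNReal.log (P {ω | Y n ω ∈ A})) atTop ≤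
      -(⨅ x ∈ closure A, I x)

/-! ### The unit ball of `ℓ_p^n` -/

/-- The closed unit ball of the `ℓ_p`-norm in `ℝⁿ` (Mathlib's `PiLp` norm:
`(∑ |x i| ^ p) ^ (1 / p)` for `p < ∞`, the maximum of the `|x i|` for `p = ∞`). -/
def lpBall (p : ℝ≥0∞) (n : ℕ) : Set (EuclideanSpace ℝ (Fin n)) :=
  {x | ‖(WithLp.toLp p (WithLp.ofLp x) : PiLp p fun _ : Fin n ↦ ℝ)‖ ≤ 1}

/-- The uniform distribution on the unit ball of `ℓ_p^n`. -/
noncomputable def lpBallUniform (p : ℝ≥0∞) (n : ℕ) : Measure (EuclideanSpace ℝ (Fin n)) :=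
  ProbabilityTheory.cond volume (lpBall p n)

/-! ### The Grassmannian and its Haar probability measure -/

/-- The Grassmannian of `k`-dimensional linear subspaces of `ℝⁿ`. -/
def RealGrassmannian (n k : ℕ) : Type :=
  {E : Submodule ℝ (EuclideanSpace ℝ (Fin n)) // Module.finrank ℝ E = k}

namespace RealGrassmannian

variable {n k : ℕ}

/-- The Euclidean unit ball of a subspace, as a nonempty compact set. -/
def unitBall (E : RealGrassmannian n k) :
    TopologicalSpace.NonemptyCompacts (EuclideanSpace ℝ (Fin n)) where
  carrier := (E.1 : Set (EuclideanSpace ℝ (Fin n))) ∩ Metric.closedBall 0 1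
  isCompact' := (isCompact_closedBall 0 1).inter_left E.1.closed_of_finiteDimensional
  nonempty' := ⟨0, E.1.zero_mem, by simp⟩

theorem mem_unitBall {E : RealGrassmannian n k} {x : EuclideanSpace ℝ (Fin n)} :
    x ∈ unitBall E ↔ x ∈ E.1 ∧ ‖x‖ ≤ 1 := by
  rw [← mem_closedBall_zero_iff]; rfl

theorem unitBall_injective : Function.Injective (unitBall (n := n) (k := k)) := by
  have key : ∀ E F : RealGrassmannian n k, unitBall E = unitBall F → E.1 ≤ F.1 := by
    intro E F h x hx
    by_cases hx0 : x = 0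
    · simp [hx0]
    have hn : ‖x‖ ≠ 0 := norm_ne_zero_iff.mpr hx0
    have h1 : ‖x‖⁻¹ • x ∈ unitBall E :=
      mem_unitBall.mpr ⟨E.1.smul_mem _ hx, by simp [norm_smul, hn]⟩
    rw [h] at h1
    have h2 := F.1.smul_mem ‖x‖ (mem_unitBall.mp h1).1
    rwa [smul_smul, mul_inv_cancel₀ hn, one_smul] at h2
  intro E F h
  exact Subtype.ext (le_antisymm (key E F h) (key F E h.symm))

/-- The metric on the Grassmannian: Hausdorff distance of the Euclidean unit balls. -/
noncomputable instance instMetricSpace : MetricSpace (RealGrassmannian n k) :=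
  MetricSpace.induced unitBall unitBall_injective inferInstance

noncomputable instance instMeasurableSpace : MeasurableSpace (RealGrassmannian n k) := borel _

instance instBorelSpace : BorelSpace (RealGrassmannian n k) := ⟨rfl⟩

end RealGrassmannian

/-- The orthogonal group `O(n)`, as the group of orthogonal linear operators on `ℝⁿ`. -/
abbrev OrthogonalOps (n : ℕ) : Type :=
  unitary (EuclideanSpace ℝ (Fin n) →L[ℝ] EuclideanSpace ℝ (Fin n))

theorem OrthogonalOps.continuousStar (n : ℕ) :
    ContinuousStar (EuclideanSpace ℝ (Fin n) →L[ℝ] EuclideanSpace ℝ (Fin n)) :=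
  ⟨(ContinuousLinearMap.adjoint (𝕜 := ℝ) (E := EuclideanSpace ℝ (Fin n))
    (F := EuclideanSpace ℝ (Fin n))).continuous⟩

instance OrthogonalOps.instIsTopologicalGroup (n : ℕ) : IsTopologicalGroup (OrthogonalOps n) :=
  have := OrthogonalOps.continuousStar n
  inferInstance

instance OrthogonalOps.instCompactSpace (n : ℕ) : CompactSpace (OrthogonalOps n) := by
  have := OrthogonalOps.continuousStar n
  refine isCompact_iff_compactSpace.mp (Metric.isCompact_of_isClosed_isBounded
    (isClosed_unitary (R := EuclideanSpace ℝ (Fin n) →L[ℝ] EuclideanSpace ℝ (Fin n))) ?_)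
  refine isBounded_iff_forall_norm_le.mpr ⟨1, fun T hT ↦ ?_⟩
  refine T.opNorm_le_bound zero_le_one fun x ↦ ?_
  rw [one_mul]
  exact (ContinuousLinearMap.norm_map_of_mem_unitary hT x).le

/-- The Haar probability measure on `O(n)`. -/
noncomputable def orthogonalHaar (n : ℕ) : Measure (OrthogonalOps n) :=
  Measure.haarMeasure ⊤

instance (n : ℕ) : IsProbabilityMeasure (orthogonalHaar n) :=
  ⟨Measure.haarMeasure_self (K₀ := (⊤ : TopologicalSpace.PositiveCompacts (OrthogonalOps n)))⟩

/-- The coordinate subspace spanned by the first `k` standard basis vectors of `ℝⁿ`. -/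
noncomputable def coordSubspace (n k : ℕ) : Submodule ℝ (EuclideanSpace ℝ (Fin n)) :=
  Submodule.span ℝ {x | ∃ i : Fin n, (i : ℕ) < k ∧ x = EuclideanSpace.single i 1}

theorem finrank_coordSubspace {n k : ℕ} (hk : k ≤ n) :
    Module.finrank ℝ (coordSubspace n k) = k := by
  have h : {x : EuclideanSpace ℝ (Fin n) | ∃ i : Fin n, (i : ℕ) < k ∧
      x = EuclideanSpace.single i 1} =
      Set.range (fun j : Fin k ↦ EuclideanSpace.basisFun (Fin n) ℝ (Fin.castLE hk j)) := by
    ext x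
    constructor
    · rintro ⟨i, hi, rfl⟩
      exact ⟨⟨i, hi⟩, by simp⟩
    · rintro ⟨j, rfl⟩
      exact ⟨Fin.castLE hk j, by simp, by simp⟩
  have hli : LinearIndependent ℝ
      (fun j : Fin k ↦ EuclideanSpace.basisFun (Fin n) ℝ (Fin.castLE hk j)) :=
    (EuclideanSpace.basisFun (Fin n) ℝ).orthonormal.linearIndependent.comp _
      (Fin.castLE_injective hk)
  rw [coordSubspace, h, finrank_span_eq_card hli, Fintype.card_fin]

/-- The orbit map `T ↦ T E₀`, where `E₀` is spanned by the first `k` basis vectors. -/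
noncomputable def grassmannOrbit {n k : ℕ} (hk : k ≤ n) (T : OrthogonalOps n) :
    RealGrassmannian n k :=
  ⟨(coordSubspace n k).map
      (T : EuclideanSpace ℝ (Fin n) →L[ℝ] EuclideanSpace ℝ (Fin n)).toLinearMap, by
    have hT : Function.Injective
        (T : EuclideanSpace ℝ (Fin n) →L[ℝ] EuclideanSpace ℝ (Fin n)).toLinearMap :=
      AddMonoidHomClass.isometry_of_norm _
        (ContinuousLinearMap.norm_map_of_mem_unitary T.2) |>.injective
    exact (Submodule.equivMapOfInjective _ hT _).finrank_eq.symm.trans (finrank_coordSubspace hk)⟩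

theorem continuous_grassmannOrbit {n k : ℕ} (hk : k ≤ n) :
    Continuous (grassmannOrbit (n := n) hk) := by
  have key : ∀ T S : OrthogonalOps n, ∀ x ∈ (grassmannOrbit hk T).unitBall,
      ∃ y ∈ (grassmannOrbit hk S).unitBall, dist x y ≤ dist T S := by
    intro T S x hx
    obtain ⟨⟨y, hy, rfl⟩, hx1⟩ := RealGrassmannian.mem_unitBall.mp hx
    have hy1 : ‖y‖ ≤ 1 := (ContinuousLinearMap.norm_map_of_mem_unitary T.2 y).symm.le.trans hx1
    refine ⟨S.1 y, RealGrassmannian.mem_unitBall.mpr ⟨⟨y, hy, rfl⟩,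
      (ContinuousLinearMap.norm_map_of_mem_unitary S.2 y).le.trans hy1⟩, ?_⟩
    rw [Subtype.dist_eq, dist_eq_norm, dist_eq_norm]
    exact ((T.1 - S.1).le_opNorm y).trans (mul_le_of_le_one_right (norm_nonneg _) hy1)
  refine LipschitzWith.continuous (K := 1) (LipschitzWith.of_dist_le_mul fun T S ↦ ?_)
  rw [NNReal.coe_one, one_mul]
  refine Metric.hausdorffDist_le_of_mem_dist dist_nonneg (key T S) fun x hx ↦ ?_
  rw [dist_comm T S]
  exact key S T x hx

/-- The Haar probability measure `ν_{n,k}` on the Grassmannian of `k`-dimensional subspaces of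
`ℝⁿ`: the image of the Haar probability measure of `O(n)` under `T ↦ T E₀`. -/
noncomputable def grassmannHaar {n k : ℕ} (hk : k ≤ n) : Measure (RealGrassmannian n k) :=
  (orthogonalHaar n).map (grassmannOrbit hk)

instance {n k : ℕ} (hk : k ≤ n) : IsProbabilityMeasure (grassmannHaar hk) :=
  Measure.isProbabilityMeasure_map (continuous_grassmannOrbit hk).measurable.aemeasurable

/-! ### The rate function -/

/-- The density of a `p`-generalized Gaussian random variable. -/
noncomputable def pGaussianDensity (p x : ℝ) : ℝ :=
  (2 * p ^ (1 / p) * Real.Gamma (1 + 1 / p))⁻¹ * Real.exp (-|x| ^ p / p)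

/-- The joint cumulant generating function `log E exp (t₁ Z² + t₂ |Z|^p)` of `(Z², |Z|^p)` for a
`p`-generalized Gaussian `Z`; it is `+∞` where the integral diverges. -/
noncomputable def pCumulant (p t₁ t₂ : ℝ) : EReal :=
  ENNReal.log (∫⁻ x : ℝ,
    ENNReal.ofReal (Real.exp (t₁ * x ^ 2 + t₂ * |x| ^ p) * pGaussianDensity p x))

/-- The Legendre-Fenchel transform of `pCumulant p`. -/
noncomputable def pCumulantDual (p x₁ x₂ : ℝ) : EReal :=
  ⨆ (t₁ : ℝ) (t₂ : ℝ), ((t₁ * x₁ + t₂ * x₂ : ℝ) : EReal) - pCumulant p t₁ t₂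

/-- The cumulant generating function `log ∫_0^1 exp (t x²) dx` of `Z²` for `Z` uniform on
`[-1, 1]`. -/
noncomputable def cubeCumulant (t : ℝ) : ℝ :=
  Real.log (∫ x in (0 : ℝ)..1, Real.exp (t * x ^ 2))

/-- The Legendre-Fenchel transform of `cubeCumulant`. -/
noncomputable def cubeCumulantDual (x : ℝ) : EReal :=
  ⨆ t : ℝ, ((t * x - cubeCumulant t : ℝ) : EReal)

open Classical in
/-- The function `J_p`, for `p ∈ [2, ∞]`. -/
noncomputable def rateJ (p : ℝ≥0∞) (y : ℝ) : EReal :=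
  if p = ∞ then cubeCumulantDual (y ^ 2)
  else ⨅ (x₁ : ℝ) (x₂ : ℝ) (_ : 0 < x₁) (_ : 0 < x₂)
    (_ : x₁ ^ (1 / 2 : ℝ) * x₂ ^ (-(1 / p.toReal)) = y), pCumulantDual p.toReal x₁ x₂

open Classical in
/-- For `0 < y ≤ x` the quantity
`(λ/2) log (λ x² / y²) + ((1-λ)/2) log ((1-λ) / (1 - y² / x²))`,
where the first summand is `0` if `λ = 0`, the second one is `0` if `λ = 1`, and the second one is
`+∞` if `λ < 1` and `x = y`. -/
noncomputable def projectionCost (lam x y : ℝ) : EReal :=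
  (if lam = 0 then 0 else ((lam / 2 * Real.log (lam * x ^ 2 / y ^ 2) : ℝ) : EReal)) +
  (if lam = 1 then 0 else if x = y then ⊤ else
    (((1 - lam) / 2 * Real.log ((1 - lam) / (1 - y ^ 2 / x ^ 2)) : ℝ) : EReal))

open Classical in
/-- The rate function of the Euclidean norms of the projections. -/
noncomputable def projectionRate (p : ℝ≥0∞) (lam y : ℝ) : EReal :=
  if 0 < y then ⨅ (x : ℝ) (_ : y ≤ x), (projectionCost lam x y + rateJ p x)
  else if y = 0 then
    (if lam = 0 then ⨅ (x : ℝ) (_ : 0 ≤ x), rateJ p x else rateJ p 0)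
  else ⊤

open Classical in
/-- The explicit rate function for `p = 2`. -/
noncomputable def euclideanRate (lam y : ℝ) : EReal :=
  if lam = 0 then
    if 0 ≤ y ∧ y < 1 then ((-(1 / 2) * Real.log (1 - y ^ 2) : ℝ) : EReal) else ⊤
  else if lam = 1 then
    if 0 < y ∧ y ≤ 1 then ((-(1 / 2) * Real.log (y ^ 2) : ℝ) : EReal) else ⊤
  else
    if 0 < y ∧ y < 1 then ((lam / 2 * Real.log (lam / y ^ 2) +
      (1 - lam) / 2 * Real.log ((1 - lam) / (1 - y ^ 2)) : ℝ) : EReal) else ⊤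

/-! Rotation invariance separates the two sources of randomness. Given X, the norm of its projection
is distributed as ‖X‖ R, where R is the share of the norm that the first k coordinates carry in an
independent uniform point of the Euclidean ball (`prod_grassmannHaar_norm_starProjection`). The
variables are thus products of two independent factors, and the infimum over x in the rate function
runs over the factorizations y = x · (y/x).

The factor R: up to factors exp(±εn), the points of the ball with R close to r have the volume of a
product of a k-dimensional and an (n-k)-dimensional ball of radii √n r and √n √(1-r²). Stirling's
formula turns this into `betaRate`.

The radial factor: after scaling by n^{1/p} the ball becomes {∑ |y i|^p ≤ n} (a cube if p = ∞), and
the normalized norm becomes the root mean square of the coordinates. This is Cramér's theorem for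
volumes. The lower bound (`le_lpBallUniform`) tilts Lebesgue measure by exp(t x² - s|x|^p) with the
optimal (t, s) and applies the weak law of large numbers; only s ≥ 0 occurs, because the constraint
is one-sided. The upper bound (`lpBallUniform_le`) is Chernoff's. Since the dual defining J_p admits
s of both signs, it is applied only in a shell where the p-norm is almost 1. Shells of radius ρ < 1
are reduced to this one by a homothety, which costs -log ρ, and `projectionRate_le` shows that they
never beat the claimed rate.

Finally `satisfiesLDP_of_local` passes from local estimates to the large deviation principle.
Nonnegativity, lower semicontinuity and compact level sets of the rate function are read off from
the probability estimates, not from the formula. For p = 2 the function J_p vanishes at 1 and is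
infinite elsewhere, so the infimum collapses to the single term x = 1. -/

/-! ### Exponential tilting -/

/-- The partition function `∫ exp (t x² - s ψ x) dν`. -/
noncomputable def partitionFn (ν : Measure ℝ) (ψ : ℝ → ℝ) (t s : ℝ) : ℝ :=
  ∫ x, Real.exp (t * x ^ 2 - s * ψ x) ∂ν

/-- Finiteness of the partition function. -/
def IsAdmissible (ν : Measure ℝ) (ψ : ℝ → ℝ) (t s : ℝ) : Prop :=
  Integrable (fun x ↦ Real.exp (t * x ^ 2 - s * ψ x)) ν

/-- `a` bounds the dual `sup [t q² - s - log ∫ exp (t x² - s ψ x) dν]`, restricted to `s ≥ 0`. -/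
def DualBound (ν : Measure ℝ) (ψ : ℝ → ℝ) (q a : ℝ) : Prop :=
  ∀ t s, 0 ≤ s → IsAdmissible ν ψ t s → t * q ^ 2 - s - Real.log (partitionFn ν ψ t s) ≤ a

/-- The properties of a base measure `ν` and a constraint function `ψ` used for the tilting. -/
structure IsTiltable (ν : Measure ℝ) (ψ : ℝ → ℝ) : Prop where
  measurable : Measurable ψ
  nonneg : ∀ x, 0 ≤ ψ x
  le_sq : ∀ x, |x| ≤ 1 → ψ x ≤ x ^ 2
  le_measure_Icc : ∀ a b, 0 ≤ a → b ≤ 1 → ENNReal.ofReal (b - a) ≤ ν (Set.Icc a b)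
  admissible : IsAdmissible ν ψ (-1) 0
  growth : ∀ ε > 0, ∃ C, ∀ x, ψ x ^ 2 ≤ C * Real.exp (ε * x ^ 2)
  open_left : ∀ t s, 0 ≤ s → IsAdmissible ν ψ t s → ∃ ε > 0, IsAdmissible ν ψ (t + ε) s
  open_right : ∀ t s, 0 < s → IsAdmissible ν ψ t s → ∃ ε > 0, ε ≤ s ∧ IsAdmissible ν ψ t (s - ε)

namespace IsTiltable

variable {ν : Measure ℝ} {ψ : ℝ → ℝ}

theorem measurable_exp (h : IsTiltable ν ψ) (t s : ℝ) :
    Measurable fun x ↦ Real.exp (t * x ^ 2 - s * ψ x) := by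
  have := h.measurable
  fun_prop

theorem measure_ne_zero (h : IsTiltable ν ψ) : ν ≠ 0 := by
  rintro rfl
  have := h.le_measure_Icc 0 1 le_rfl le_rfl
  simp at this

theorem partitionFn_pos (h : IsTiltable ν ψ) {t s : ℝ} (hts : IsAdmissible ν ψ t s) :
    0 < partitionFn ν ψ t s :=
  have : NeZero ν := ⟨h.measure_ne_zero⟩
  integral_exp_pos hts

/-- The centred partition function as an extended nonnegative number. -/
noncomputable def centred (ν : Measure ℝ) (ψ : ℝ → ℝ) (c : ℝ) (z : ℝ × ℝ) : ℝ≥0∞ :=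
  ∫⁻ x, ENNReal.ofReal (Real.exp (z.1 * (x ^ 2 - c) - z.2 * (ψ x - 1))) ∂ν

/-- Fatou's lemma. The integral may be infinite, so continuity is not available, but lower
semicontinuity is all that a minimization needs. -/
theorem lowerSemicontinuous_centred (h : IsTiltable ν ψ) (c : ℝ) :
    LowerSemicontinuous (centred ν ψ c) := by
  intro z
  refine lowerSemicontinuousAt_iff_le_liminf.2 ?_
  have hm := h.measurable
  have h1 : ∀ x, liminf (fun w : ℝ × ℝ ↦
      ENNReal.ofReal (Real.exp (w.1 * (x ^ 2 - c) - w.2 * (ψ x - 1)))) (𝓝 z) =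
      ENNReal.ofReal (Real.exp (z.1 * (x ^ 2 - c) - z.2 * (ψ x - 1))) := by
    intro x
    have : Continuous fun w : ℝ × ℝ ↦
      ENNReal.ofReal (Real.exp (w.1 * (x ^ 2 - c) - w.2 * (ψ x - 1))) :=
      ENNReal.continuous_ofReal.comp (by fun_prop)
    exact (this.tendsto z).liminf_eq
  calc centred ν ψ c z = ∫⁻ x, liminf (fun w : ℝ × ℝ ↦
      ENNReal.ofReal (Real.exp (w.1 * (x ^ 2 - c) - w.2 * (ψ x - 1)))) (𝓝 z) ∂ν := by
        simp only [h1, centred]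
    _ ≤ _ := lintegral_liminf_le fun w ↦ by fun_prop

/-- Coercivity, which forces a minimizer to exist. For t ≥ 0 the mass on an interval inside (q, 1)
already grows exponentially, because there x² > q² and ψ < 1; for t < 0 the interval [0, q/2] serves
instead. -/
theorem centred_lower (h : IsTiltable ν ψ) {q : ℝ} (hq0 : 0 < q) (hq1 : q < 1) :
    ∃ κ > 0, ∃ l > 0, ∀ t s : ℝ, 0 ≤ s →
      ENNReal.ofReal (l * Real.exp (κ * (|t| + s))) ≤ centred ν ψ (q ^ 2) (t, s) := by
  have key : ∀ a b κ t s : ℝ, 0 ≤ a → b ≤ 1 →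
      (∀ x ∈ Set.Icc a b, κ ≤ t * (x ^ 2 - q ^ 2) - s * (ψ x - 1)) →
      ENNReal.ofReal ((b - a) * Real.exp κ) ≤ centred ν ψ (q ^ 2) (t, s) := by
    intro a b κ t s ha hb hx
    calc ENNReal.ofReal ((b - a) * Real.exp κ)
        = ENNReal.ofReal (Real.exp κ) * ENNReal.ofReal (b - a) := by
          rw [mul_comm, ENNReal.ofReal_mul (Real.exp_pos _).le]
      _ ≤ ENNReal.ofReal (Real.exp κ) * ν (Set.Icc a b) := by
          gcongr; exact h.le_measure_Icc a b ha hb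
      _ = ∫⁻ x in Set.Icc a b, ENNReal.ofReal (Real.exp κ) ∂ν := by simp
      _ ≤ ∫⁻ x in Set.Icc a b,
          ENNReal.ofReal (Real.exp (t * (x ^ 2 - q ^ 2) - s * (ψ x - 1))) ∂ν := by
          refine setLIntegral_mono' measurableSet_Icc fun x hx' ↦ ?_
          exact ENNReal.ofReal_le_ofReal (Real.exp_le_exp.2 (hx x hx'))
      _ ≤ _ := setLIntegral_le_lintegral _ _
  obtain ⟨a, ha, ha1⟩ := exists_between hq1
  obtain ⟨b, hb, hb1⟩ := exists_between ha1
  have k1 : 0 < a ^ 2 - q ^ 2 := by nlinarith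
  have k2 : 0 < 1 - b ^ 2 := by nlinarith
  have k3 : 0 < 3 / 4 * q ^ 2 := by positivity
  obtain ⟨κ, hκ0, hκ⟩ : ∃ κ > 0, κ ≤ a ^ 2 - q ^ 2 ∧ κ ≤ 1 - b ^ 2 ∧ κ ≤ 3 / 4 * q ^ 2 :=
    ⟨min (a ^ 2 - q ^ 2) (min (1 - b ^ 2) (3 / 4 * q ^ 2)), by positivity, by simp⟩
  obtain ⟨h1, h2, h3⟩ := hκ
  have hl : 0 < b - a := by linarith
  refine ⟨κ, hκ0, min (b - a) (q / 2), by positivity, fun t s hs ↦ ?_⟩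
  rcases le_or_gt 0 t with ht | ht
  · refine le_trans ?_ (key a b (κ * (|t| + s)) t s (by linarith) hb1.le ?_)
    · gcongr; exact min_le_left _ _
    · intro x hx
      have hx0 : 0 ≤ x := by linarith [hx.1]
      have e1 : a ^ 2 ≤ x ^ 2 := by have := hx.1; gcongr; linarith
      have e2 : x ^ 2 ≤ b ^ 2 := by have := hx.2; gcongr
      have e3 := h.le_sq x (by rw [abs_of_nonneg hx0]; linarith [hx.2])
      rw [abs_of_nonneg ht]
      nlinarith [mul_le_mul_of_nonneg_left (show κ ≤ x ^ 2 - q ^ 2 by linarith) ht,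
        mul_le_mul_of_nonneg_left (show κ ≤ 1 - ψ x by linarith) hs]
  · refine le_trans ?_ (key 0 (q / 2) (κ * (|t| + s)) t s le_rfl (by linarith) ?_)
    · gcongr
      rw [sub_zero]; exact min_le_right _ _
    · intro x hx
      have hx0 : 0 ≤ x := hx.1
      have e2 : x ^ 2 ≤ (q / 2) ^ 2 := by have := hx.2; gcongr
      have e3 := h.le_sq x (by rw [abs_of_nonneg hx0]; linarith [hx.2])
      rw [abs_of_neg ht]
      nlinarith [mul_le_mul_of_nonneg_left (show κ ≤ q ^ 2 - x ^ 2 by linarith) (neg_pos.2 ht).le,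
        mul_le_mul_of_nonneg_left (show κ ≤ 1 - ψ x by nlinarith) hs]

theorem centred_eq {c t s : ℝ} (hts : IsAdmissible ν ψ t s) :
    centred ν ψ c (t, s) = ENNReal.ofReal (Real.exp (s - t * c) * partitionFn ν ψ t s) := by
  have e : ∀ x, Real.exp (t * (x ^ 2 - c) - s * (ψ x - 1)) =
      Real.exp (s - t * c) * Real.exp (t * x ^ 2 - s * ψ x) := by
    intro x; rw [← Real.exp_add]; congr 1; ring
  rw [centred, partitionFn, ← integral_const_mul, ofReal_integral_eq_lintegral_ofReal
    (hts.const_mul _) (.of_forall fun x ↦ by positivity)]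
  simp only [e]

theorem admissible_of_centred (h : IsTiltable ν ψ) {c t s : ℝ} (hts : centred ν ψ c (t, s) ≠ ∞) :
    IsAdmissible ν ψ t s := by
  have e : ∀ x, Real.exp (t * x ^ 2 - s * ψ x) =
      Real.exp (t * c - s) * Real.exp (t * (x ^ 2 - c) - s * (ψ x - 1)) := by
    intro x; rw [← Real.exp_add]; congr 1; ring
  have hm := h.measurable
  have : Integrable (fun x ↦ Real.exp (t * (x ^ 2 - c) - s * (ψ x - 1))) ν := by
    refine ⟨by fun_prop, ?_⟩
    rw [hasFiniteIntegral_iff_ofReal (.of_forall fun x ↦ by positivity)]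
    exact hts.lt_top
  unfold IsAdmissible
  simp only [e]
  exact this.const_mul _

/-- The direct method: by coercivity the search is confined to a compact set of parameters, where a
lower semicontinuous function attains its minimum. The minimizer maximizes the dual t q² - s - log Z
over s ≥ 0. -/
theorem exists_minimizer (h : IsTiltable ν ψ) {q : ℝ} (hq0 : 0 < q) (hq1 : q < 1) :
    ∃ t₀ s₀, 0 ≤ s₀ ∧ IsAdmissible ν ψ t₀ s₀ ∧ ∀ t s, 0 ≤ s → IsAdmissible ν ψ t s →
      Real.exp (s₀ - t₀ * q ^ 2) * partitionFn ν ψ t₀ s₀ ≤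
        Real.exp (s - t * q ^ 2) * partitionFn ν ψ t s := by
  obtain ⟨κ, hκ, l, hl, hlow⟩ := h.centred_lower hq0 hq1
  have hfin : centred ν ψ (q ^ 2) (-1, 0) ≠ ∞ := by
    rw [centred_eq h.admissible]; exact ENNReal.ofReal_ne_top
  set A := (centred ν ψ (q ^ 2) (-1, 0)).toReal with hA
  -- The radius comes from exp(κ r) ≥ κ r; the maximum with 1 puts the reference point (-1, 0) into
  -- the compact set.
  obtain ⟨R, hR1, hR⟩ : ∃ R : ℝ, 1 ≤ R ∧ ∀ r, R < r → A ≤ l * Real.exp (κ * r) := by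
    refine ⟨max 1 (A / (l * κ)), le_max_left _ _, fun r hr ↦ ?_⟩
    have h1 : A / (l * κ) < r := (le_max_right _ _).trans_lt hr
    rw [div_lt_iff₀ (by positivity)] at h1
    have h2 : κ * r ≤ Real.exp (κ * r) := by linarith [Real.add_one_le_exp (κ * r)]
    nlinarith
  set K : Set (ℝ × ℝ) := {z | 0 ≤ z.2 ∧ |z.1| + z.2 ≤ R} with hK
  have hKc : IsCompact K := by
    refine (isCompact_Icc (a := ((-R, 0) : ℝ × ℝ)) (b := (R, R))).of_isClosed_subset ?_ ?_
    · exact (isClosed_le continuous_const continuous_snd).inter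
        (isClosed_le (f := fun z : ℝ × ℝ ↦ |z.1| + z.2) (by fun_prop) continuous_const)
    · rintro ⟨t, s⟩ ⟨h1, h2⟩
      simp only at h1 h2
      have := neg_abs_le t
      have := le_abs_self t
      have := abs_nonneg t
      exact ⟨⟨by simp; linarith, by simpa using h1⟩, ⟨by simp; linarith, by simp; linarith⟩⟩
  have h10 : ((-1, 0) : ℝ × ℝ) ∈ K := by simp [hK, hR1]
  obtain ⟨⟨t₀, s₀⟩, hz, hmin⟩ := LowerSemicontinuousOn.exists_isMinOn ⟨_, h10⟩ hKc
    ((h.lowerSemicontinuous_centred (q ^ 2)).lowerSemicontinuousOn K)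
  rw [isMinOn_iff] at hmin
  have hadm : IsAdmissible ν ψ t₀ s₀ :=
    h.admissible_of_centred (ne_top_of_le_ne_top hfin (hmin _ h10))
  refine ⟨t₀, s₀, hz.1, hadm, fun t s hs hts ↦ ?_⟩
  have hpos := h.partitionFn_pos hts
  have : centred ν ψ (q ^ 2) (t₀, s₀) ≤ centred ν ψ (q ^ 2) (t, s) := by
    by_cases hin : |t| + s ≤ R
    · exact hmin _ ⟨hs, hin⟩
    · refine (hmin _ h10).trans (le_trans ?_ (hlow t s hs))
      rw [← ENNReal.ofReal_toReal hfin]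
      exact ENNReal.ofReal_le_ofReal (hR _ (not_le.1 hin))
  rw [centred_eq hadm, centred_eq hts] at this
  exact (ENNReal.ofReal_le_ofReal_iff (by positivity)).1 this

end IsTiltable

/-! ### First-order conditions at a minimizer -/

/-- The moment generating function equals 1 at 0, so 0 is a local minimum, and the derivative there
is the mean. -/
theorem integral_eq_zero_of_one_le_mgf {Ω : Type*} {mΩ : MeasurableSpace Ω} {m : Measure Ω}
    [IsProbabilityMeasure m] {X : Ω → ℝ} (h0 : (0 : ℝ) ∈ interior (integrableExpSet X m))
    (h : ∀ᶠ τ in 𝓝 0, 1 ≤ mgf X m τ) : ∫ x, X x ∂m = 0 := by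
  rw [← deriv_mgf_zero h0]
  refine IsLocalMin.deriv_eq_zero ?_
  filter_upwards [h] with τ hτ
  simpa using hτ

/-- The one-sided first-order condition, for a minimizer that may lie on the boundary s = 0. The
quotients (1 - exp(-uX))/u have nonpositive integral and tend to X as u decreases to 0; the lower
bound on X makes dominated convergence applicable. -/
theorem integral_nonpos_of_one_le_integral_exp {Ω : Type*} {mΩ : MeasurableSpace Ω}
    {m : Measure Ω} [IsProbabilityMeasure m] {X : Ω → ℝ} (hX : Integrable X m)
    (hlow : ∀ x, -1 ≤ X x) (h : ∀ τ : ℝ, 0 < τ → 1 ≤ ∫ x, Real.exp (-τ * X x) ∂m) :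
    ∫ x, X x ∂m ≤ 0 := by
  set g : ℕ → Ω → ℝ := fun n x ↦ (1 - Real.exp (-(1 / ((n : ℝ) + 1)) * X x)) * (n + 1) with hg
  have hpos : ∀ n : ℕ, (0 : ℝ) < 1 / ((n : ℝ) + 1) := fun n ↦ by positivity
  have hle1 : ∀ n : ℕ, 1 / ((n : ℝ) + 1) ≤ 1 := fun n ↦ by
    rw [div_le_one (by positivity)]; linarith [n.cast_nonneg (α := ℝ)]
  have hexp_int : ∀ n : ℕ, Integrable (fun x ↦ Real.exp (-(1 / ((n : ℝ) + 1)) * X x)) m := by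
    intro n
    refine Integrable.of_bound (C := Real.exp 1)
      ((hX.1.const_mul _).aemeasurable.exp.aestronglyMeasurable) (.of_forall fun x ↦ ?_)
    rw [Real.norm_eq_abs, abs_of_pos (Real.exp_pos _)]
    refine Real.exp_le_exp.2 ?_
    nlinarith [hlow x, hpos n, hle1 n]
  have hlim : Tendsto (fun n ↦ ∫ x, g n x ∂m) atTop (𝓝 (∫ x, X x ∂m)) := by
    refine tendsto_integral_of_dominated_convergence (fun x ↦ |X x| + Real.exp 1)
      (fun n ↦ ((integrable_const 1).sub (hexp_int n)).1.mul_const _)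
      (hX.abs.add (integrable_const _)) (fun n ↦ .of_forall fun x ↦ ?_) (.of_forall fun x ↦ ?_)
    · set u := 1 / ((n : ℝ) + 1) with hu
      have e : g n x = (1 - Real.exp (-u * X x)) / u := by simp [hg, hu]
      rw [e, Real.norm_eq_abs, abs_le]
      have hu0 := hpos n
      rw [← hu] at hu0
      constructor
      · rw [le_div_iff₀ hu0]
        -- Yields exp v - 1 ≤ v exp v at v = -uX, the lower half of the domination by |X| + e.
        have h1 := Real.one_sub_inv_le_log_of_pos (Real.exp_pos (-u * X x))
        have h2 := neg_abs_le (X x)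
        have h4 : Real.exp (-u * X x) ≤ Real.exp 1 := by
          refine Real.exp_le_exp.2 ?_
          nlinarith [hlow x, hpos n, hle1 n]
        rw [Real.log_exp, ← Real.exp_neg] at h1
        have h5 : Real.exp (-u * X x) - 1 ≤ -u * X x * Real.exp (-u * X x) := by
          have := mul_le_mul_of_nonneg_right h1 (Real.exp_pos (-u * X x)).le
          rw [sub_mul, ← Real.exp_add] at this
          simpa using this
        rcases le_or_gt 0 (X x) with hx | hx
        · have : Real.exp (-u * X x) ≤ 1 := Real.exp_le_one_iff.2 (by nlinarith)
          have h6 := Real.exp_pos 1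
          nlinarith [abs_nonneg (X x)]
        · have : -u * X x * Real.exp (-u * X x) ≤ u * Real.exp 1 := by
            refine mul_le_mul ?_ h4 (Real.exp_pos _).le hu0.le
            nlinarith [hlow x]
          nlinarith [abs_nonneg (X x)]
      · rw [div_le_iff₀ hu0]
        have := Real.add_one_le_exp (-u * X x)
        nlinarith [le_abs_self (X x), Real.exp_pos 1]
    · have h1 : HasDerivAt (fun u : ℝ ↦ Real.exp (u * X x)) (X x) 0 := by
        have := ((hasDerivAt_id (0 : ℝ)).mul_const (X x)).exp
        simpa using this
      have h2 : Tendsto (fun n : ℕ ↦ -(1 / ((n : ℝ) + 1))) atTop (𝓝[≠] 0) := by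
        refine tendsto_nhdsWithin_iff.2 ⟨?_, .of_forall fun n ↦ ?_⟩
        · simpa using (tendsto_one_div_add_atTop_nhds_zero_nat (𝕜 := ℝ)).neg
        · simpa using (hpos n).ne'
      have h3 := (hasDerivAt_iff_tendsto_slope.1 h1).comp h2
      refine h3.congr fun n ↦ ?_
      have : (n : ℝ) + 1 ≠ 0 := by positivity
      simp only [Function.comp, slope_def_field, hg]
      field_simp
      simp
  refine le_of_tendsto hlim (.of_forall fun n ↦ ?_)
  simp only [hg]
  rw [integral_mul_const, integral_sub (integrable_const _) (hexp_int n)]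
  have := h _ (hpos n)
  have h2 : (0 : ℝ) ≤ n + 1 := by positivity
  simp only [integral_const, probReal_univ, smul_eq_mul, mul_one]
  exact mul_nonpos_of_nonpos_of_nonneg (by linarith) h2

namespace IsTiltable

variable {ν : Measure ℝ} {ψ : ℝ → ℝ}

/-- The tilted measure with density proportional to `exp (t x² - s ψ x)`. -/
noncomputable def tilt (ν : Measure ℝ) (ψ : ℝ → ℝ) (t s : ℝ) : Measure ℝ :=
  ν.tilted fun x ↦ t * x ^ 2 - s * ψ x

theorem isProbabilityMeasure_tilt (h : IsTiltable ν ψ) {t s : ℝ} (hts : IsAdmissible ν ψ t s) :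
    IsProbabilityMeasure (tilt ν ψ t s) :=
  have : NeZero ν := ⟨h.measure_ne_zero⟩
  isProbabilityMeasure_tilted hts

/-- Exponential moments of a tilted measure are ratios of partition functions. This converts
minimality of the parameters into a lower bound 1 for such moments. -/
theorem integral_exp_tilt (t s τ σ d : ℝ) :
    ∫ x, Real.exp (τ * x ^ 2 - σ * ψ x + d) ∂(tilt ν ψ t s) =
      Real.exp d * partitionFn ν ψ (t + τ) (s + σ) / partitionFn ν ψ t s := by
  rw [tilt, integral_exp_tilted]
  congr 1
  rw [partitionFn, ← integral_const_mul]
  refine integral_congr_ae (.of_forall fun x ↦ ?_)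
  simp only [Pi.add_apply]
  rw [← Real.exp_add]
  congr 1; ring

theorem integrable_exp_tilt {t s τ σ : ℝ} (d : ℝ) 
    (h2 : IsAdmissible ν ψ (t + τ) (s + σ)) :
    Integrable (fun x ↦ Real.exp (τ * x ^ 2 - σ * ψ x + d)) (tilt ν ψ t s) := by
  -- Without admissibility the tilted measure is the zero measure by convention, and integrability
  -- is trivial.
  by_cases h1 : IsAdmissible ν ψ t s
  swap
  · have : tilt ν ψ t s = 0 := tilted_of_not_integrable h1
    simp [this]
  rw [tilt, integrable_tilted_iff h1]
  refine (h2.const_mul (Real.exp d)).congr (.of_forall fun x ↦ ?_)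
  simp only [smul_eq_mul]
  rw [← Real.exp_add, ← Real.exp_add]
  congr 1; ring

theorem admissible_mono (h : IsTiltable ν ψ) {t s t' s' : ℝ} (h1 : IsAdmissible ν ψ t s)
    (ht : t' ≤ t) (hs : s ≤ s') : IsAdmissible ν ψ t' s' := by
  refine Integrable.mono' h1 (h.measurable_exp _ _).aestronglyMeasurable (.of_forall fun x ↦ ?_)
  rw [Real.norm_eq_abs, abs_of_pos (Real.exp_pos _)]
  refine Real.exp_le_exp.2 ?_
  nlinarith [mul_le_mul_of_nonneg_right ht (sq_nonneg x),
    mul_le_mul_of_nonneg_right hs (h.nonneg x)]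

/-- For `q ∈ (0, 1)` there is an exponential tilt under which `x²` has mean `q²` and `ψ` has mean
at most `1`, with equality when `ψ` really enters the tilt. -/
theorem exists_tilt (h : IsTiltable ν ψ) {q : ℝ} (hq0 : 0 < q) (hq1 : q < 1) :
    ∃ t s, 0 ≤ s ∧ IsAdmissible ν ψ t s ∧
      MemLp (fun x : ℝ ↦ x ^ 2) 2 (tilt ν ψ t s) ∧ MemLp ψ 2 (tilt ν ψ t s) ∧
      ∫ x, x ^ 2 ∂(tilt ν ψ t s) = q ^ 2 ∧ ∫ x, ψ x ∂(tilt ν ψ t s) ≤ 1 ∧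
      (0 < s → ∫ x, ψ x ∂(tilt ν ψ t s) = 1) := by
  obtain ⟨t, s, hs, hadm, hmin⟩ := h.exists_minimizer hq0 hq1
  have hpr := h.isProbabilityMeasure_tilt hadm
  set m := tilt ν ψ t s with hm
  have hZ := h.partitionFn_pos hadm
  have hratio : ∀ τ σ, 0 ≤ s + σ → IsAdmissible ν ψ (t + τ) (s + σ) →
      1 ≤ ∫ x, Real.exp (τ * x ^ 2 - σ * ψ x + (σ - τ * q ^ 2)) ∂m := by
    intro τ σ h1 h2
    rw [hm, integral_exp_tilt, one_le_div hZ]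
    have := hmin _ _ h1 h2
    have e : Real.exp (s + σ - (t + τ) * q ^ 2) =
      Real.exp (s - t * q ^ 2) * Real.exp (σ - τ * q ^ 2) := by
      rw [← Real.exp_add]; congr 1; ring
    rw [e, mul_assoc] at this
    exact le_of_mul_le_mul_left this (Real.exp_pos _)
  obtain ⟨ε, hε, hεa⟩ := h.open_left t s hs hadm
  -- The room ε in the parameter t pays for ψ², which grows more slowly than any exp(ε x²).
  have hL2ψ : MemLp ψ 2 m := by
    rw [memLp_two_iff_integrable_sq h.measurable.aestronglyMeasurable]
    obtain ⟨C, hC⟩ := h.growth ε hε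
    have hi := (integrable_exp_tilt (t := t) (s := s) (τ := ε) (σ := 0) 0 (by simpa using hεa))
    refine Integrable.mono' (hi.const_mul C) (h.measurable.pow_const 2).aestronglyMeasurable
      (.of_forall fun x ↦ ?_)
    simpa using hC x
  have hint : (0 : ℝ) ∈ interior (integrableExpSet (fun x : ℝ ↦ x ^ 2 - q ^ 2) m) := by
    rw [mem_interior_iff_mem_nhds]
    filter_upwards [Iic_mem_nhds hε] with τ hτ
    have := integrable_exp_tilt (t := t) (s := s) (τ := τ) (σ := 0) (-(τ * q ^ 2))
      (h.admissible_mono hεa (by simpa using hτ) (by simp))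
    refine this.congr (.of_forall fun x ↦ ?_)
    simp only [Real.exp_eq_exp]; ring
  have hL2 : MemLp (fun x : ℝ ↦ x ^ 2) 2 m := by
    have h1 := memLp_of_mem_interior_integrableExpSet hint 2
    have h2 := h1.add (memLp_const (q ^ 2))
    refine (memLp_congr_ae (.of_forall fun x ↦ ?_)).1 h2
    simp
  refine ⟨t, s, hs, hadm, hL2, hL2ψ, ?_, ?_, fun hs0 ↦ ?_⟩
  -- Stationarity in t, which can be moved in both directions.
  · have h1 : ∫ x, (x ^ 2 - q ^ 2) ∂m = 0 := by
      refine integral_eq_zero_of_one_le_mgf hint ?_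
      filter_upwards [Iic_mem_nhds hε] with τ hτ
      have := hratio τ 0 (by simpa using hs)
        (h.admissible_mono hεa (by simpa using hτ) (by simp))
      rw [mgf]
      convert this using 4
      ring
    rw [integral_sub (hL2.integrable (by norm_num)) (integrable_const _)] at h1
    simp at h1
    linarith
  -- Only increasing s is always allowed, which gives an inequality.
  · have h1 : ∫ x, (ψ x - 1) ∂m ≤ 0 := by
      refine integral_nonpos_of_one_le_integral_exp
        ((hL2ψ.integrable (by norm_num)).sub (integrable_const _))
        (fun x ↦ by linarith [h.nonneg x]) fun τ hτ ↦ ?_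
      have := hratio 0 τ (by linarith) (h.admissible_mono hadm (by simp) (by linarith))
      convert this using 4
      ring
    rw [integral_sub (hL2ψ.integrable (by norm_num)) (integrable_const _)] at h1
    simp at h1
    linarith
  -- For s > 0 the parameter can also be decreased, and the inequality becomes an equality:
  -- complementary slackness.
  · obtain ⟨δ, hδ, hδs, hδa⟩ := h.open_right t s hs0 hadm
    have h1 : ∫ x, (ψ x - 1) ∂m = 0 := by
      have hadm' : ∀ τ ≤ δ, IsAdmissible ν ψ (t + 0) (s + -τ) := fun τ hτ ↦
        h.admissible_mono hδa (by simp) (by linarith)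
      refine integral_eq_zero_of_one_le_mgf ?_ ?_
      · rw [mem_interior_iff_mem_nhds]
        filter_upwards [Iic_mem_nhds hδ] with τ hτ
        have := integrable_exp_tilt (t := t) (s := s) (-τ) (hadm' τ hτ)
        refine this.congr (.of_forall fun x ↦ ?_)
        simp only [Real.exp_eq_exp]; ring
      · filter_upwards [Iic_mem_nhds hδ] with τ hτ
        have := hratio 0 (-τ) (by linarith [Set.mem_Iic.1 hτ]) (hadm' τ hτ)
        rw [mgf]
        convert this using 4
        ring
    rw [integral_sub (hL2ψ.integrable (by norm_num)) (integrable_const _)] at h1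
    simp at h1
    linarith

end IsTiltable

/-! ### Product measures: densities and the weak law of large numbers -/

theorem pi_withDensity_ofReal {n : ℕ} (ν : Measure ℝ) [SigmaFinite ν] {g : ℝ → ℝ}
    (hg : Integrable g ν) (hg0 : ∀ x, 0 ≤ g x)
    [SigmaFinite (ν.withDensity fun x ↦ ENNReal.ofReal (g x))] :
    Measure.pi (fun _ : Fin n ↦ ν.withDensity fun x ↦ ENNReal.ofReal (g x)) =
      (Measure.pi fun _ : Fin n ↦ ν).withDensity fun x ↦ ENNReal.ofReal (∏ i, g (x i)) := by
  refine Measure.pi_eq fun s hs ↦ ?_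
  rw [withDensity_apply _ (.univ_pi hs), Measure.restrict_pi_pi,
    ← ofReal_integral_eq_lintegral_ofReal
      (Integrable.fintype_prod (f := fun _ ↦ g) fun i ↦ hg.restrict)
      (.of_forall fun x ↦ Finset.prod_nonneg fun i _ ↦ hg0 _),
    integral_fintype_prod_eq_prod (f := fun _ ↦ g),
    ENNReal.ofReal_prod_of_nonneg fun i _ ↦ integral_nonneg hg0]
  refine Finset.prod_congr rfl fun i _ ↦ ?_
  rw [withDensity_apply _ (hs i), ofReal_integral_eq_lintegral_ofReal hg.restrict (.of_forall hg0)]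

/-- Chebyshev's inequality: the variance of the sum is linear in n, while the squared deviation is
quadratic. -/
theorem tendsto_pi_measure_deviation (m : Measure ℝ) [IsProbabilityMeasure m] {f : ℝ → ℝ}
    (hf : MemLp f 2 m) {δ : ℝ} (hδ : 0 < δ) :
    Tendsto (fun n : ℕ ↦ Measure.pi (fun _ : Fin n ↦ m)
      {x | n * δ ≤ |∑ i, f (x i) - n * ∫ x, f x ∂m|}) atTop (𝓝 0) := by
  have hb : ∀ᶠ n : ℕ in atTop, Measure.pi (fun _ : Fin n ↦ m)
      {x | n * δ ≤ |∑ i, f (x i) - n * ∫ x, f x ∂m|} ≤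
      ENNReal.ofReal (variance f m / δ ^ 2 / n) := by
    filter_upwards [eventually_gt_atTop 0] with n hn
    have hn' : (0 : ℝ) < n := by exact_mod_cast hn
    have hmem : ∀ i : Fin n, MemLp (fun x : Fin n → ℝ ↦ f (x i)) 2 (Measure.pi fun _ ↦ m) :=
      fun i ↦ hf.comp_measurePreserving (measurePreserving_eval _ i)
    have hX : MemLp (∑ i, fun x : Fin n → ℝ ↦ f (x i)) 2 (Measure.pi fun _ ↦ m) :=
      memLp_finsetSum' _ fun i _ ↦ hmem i
    have h1 := meas_ge_le_variance_div_sq hX (show 0 < n * δ by positivity)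
    have hmean : ∫ x, (∑ i, fun x : Fin n → ℝ ↦ f (x i)) x ∂(Measure.pi fun _ ↦ m) =
        n * ∫ x, f x ∂m := by
      simp only [Finset.sum_apply]
      rw [integral_finsetSum _ fun i _ ↦ (hmem i).integrable (by norm_num)]
      have : ∀ i : Fin n, ∫ x : Fin n → ℝ, f (x i) ∂(Measure.pi fun _ ↦ m) = ∫ x, f x ∂m :=
        fun i ↦ integral_comp_eval (μ := fun _ : Fin n ↦ m) (i := i) hf.aestronglyMeasurable
      simp [this]
    rw [hmean, variance_sum_pi fun _ ↦ hf] at h1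
    simp only [Finset.sum_apply, Finset.sum_const, Finset.card_univ, Fintype.card_fin] at h1
    refine h1.trans (ENNReal.ofReal_le_ofReal (le_of_eq ?_))
    simp only [nsmul_eq_mul]
    field_simp
  refine tendsto_of_tendsto_of_tendsto_of_le_of_le' tendsto_const_nhds ?_
    (.of_forall fun _ ↦ zero_le) hb
  rw [← ENNReal.ofReal_zero]
  exact ENNReal.tendsto_ofReal (tendsto_const_div_atTop_nhds_zero_nat _)

namespace IsTiltable

variable {ν : Measure ℝ} {ψ : ℝ → ℝ}

theorem sum_exp_prod (t s Z : ℝ) {n : ℕ} (x : Fin n → ℝ) :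
    ∏ i, Real.exp (t * x i ^ 2 - s * ψ (x i)) / Z =
      Real.exp (t * ∑ i, x i ^ 2 - s * ∑ i, ψ (x i)) / Z ^ n := by
  rw [Finset.prod_div_distrib, ← Real.exp_sum, Finset.sum_sub_distrib, Finset.mul_sum,
    Finset.mul_sum]
  simp

/-- Cramér's lower bound by change of measure. Under the product of the tilted measures the typical
set has probability at least 1/2; there the density is nearly exp(n(t q² - s))/Zⁿ, and the dual
bound controls this by exp(n a). -/
theorem eventually_le_pi_measure (h : IsTiltable ν ψ) [SigmaFinite ν] {q a : ℝ} (hq0 : 0 < q)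
    (hq1 : q < 1) (ha : DualBound ν ψ q a) {ε δ : ℝ} (hε : 0 < ε) (hδ : 0 < δ) :
    ∀ᶠ n : ℕ in atTop, ENNReal.ofReal (Real.exp (-(n * (a + ε)))) ≤
      Measure.pi (fun _ : Fin n ↦ ν)
        {x | |∑ i, x i ^ 2 - n * q ^ 2| < n * δ ∧ ∑ i, ψ (x i) < n * (1 + δ)} := by
  obtain ⟨t, s, hs, hadm, hL2, hL2ψ, hm2, hmψ, hmψ'⟩ := h.exists_tilt hq0 hq1
  have hpr := h.isProbabilityMeasure_tilt hadm
  set m := tilt ν ψ t s with hm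
  have hZ := h.partitionFn_pos hadm
  set Z := partitionFn ν ψ t s with hZdef
  -- The tolerance η is small enough that fluctuations of both sums change the exponent of the
  -- density by at most n ε/2.
  obtain ⟨η, hη, hηδ, hηε⟩ : ∃ η > 0, η ≤ δ ∧ (|t| + s) * η ≤ ε / 2 := by
    refine ⟨min δ (ε / 2 / (|t| + s + 1)), by positivity, min_le_left _ _, ?_⟩
    calc (|t| + s) * min δ (ε / 2 / (|t| + s + 1))
        ≤ (|t| + s + 1) * (ε / 2 / (|t| + s + 1)) := by
          exact mul_le_mul (by linarith) (min_le_right _ _) (by positivity) (by positivity)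
      _ = ε / 2 := by field_simp
  have hd1 := tendsto_pi_measure_deviation m hL2 hη
  have hd2 := tendsto_pi_measure_deviation m hL2ψ hη
  have hexp : ∀ᶠ n : ℕ in atTop, Real.exp (-(n * (ε / 2))) ≤ 1 / 2 := by
    have : Tendsto (fun n : ℕ ↦ Real.exp (-(n * (ε / 2)))) atTop (𝓝 0) := by
      refine Real.tendsto_exp_neg_atTop_nhds_zero.comp ?_
      exact (tendsto_natCast_atTop_atTop).atTop_mul_const (by positivity)
    exact this.eventually_le_const (by norm_num)
  filter_upwards [hd1.eventually_le_const (show (0 : ℝ≥0∞) < 1 / 4 by simp),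
    hd2.eventually_le_const (show (0 : ℝ≥0∞) < 1 / 4 by simp), hexp] with n h1 h2 h3
  set A : Set (Fin n → ℝ) := {x | |∑ i, x i ^ 2 - n * ∫ x, x ^ 2 ∂m| < n * η ∧
    |∑ i, ψ (x i) - n * ∫ x, ψ x ∂m| < n * η} with hA
  have hψm := h.measurable
  have hAm : MeasurableSet A := by
    rw [hA, Set.ofPred_and]
    exact (measurableSet_lt (by fun_prop) measurable_const).inter
      (measurableSet_lt (by fun_prop) measurable_const)
  have hmA : (1 / 2 : ℝ≥0∞) ≤ Measure.pi (fun _ : Fin n ↦ m) A := by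
    have hc : Measure.pi (fun _ : Fin n ↦ m) Aᶜ ≤ 1 / 4 + 1 / 4 := by
      refine (measure_mono ?_).trans ((measure_union_le _ _).trans (add_le_add h1 h2))
      intro x hx
      simp only [hA, Set.mem_compl_iff, Set.mem_ofPred_eq, not_and_or, not_lt] at hx
      exact hx
    have h4 : (1 / 4 + 1 / 4 : ℝ≥0∞) = 1 / 2 := by
      rw [ENNReal.div_add_div_same, ENNReal.div_eq_div_iff] <;> norm_num
    rw [h4] at hc
    rw [prob_compl_eq_one_sub hAm] at hc
    have h5 : (1 : ℝ≥0∞) ≤ 1 / 2 + Measure.pi (fun _ : Fin n ↦ m) A := tsub_le_iff_right.1 hc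
    exact (ENNReal.add_le_add_iff_left (by simp)).1 ((ENNReal.add_halves 1).trans_le h5)
  -- An upper bound for the density of the tilted product on the typical set.
  set D := Real.exp (n * (t * q ^ 2 - s + ε / 2)) / Z ^ n with hD
  have hDpos : 0 < D := by positivity
  have hmν : Measure.pi (fun _ : Fin n ↦ m) A ≤
      ENNReal.ofReal D * Measure.pi (fun _ : Fin n ↦ ν) A := by
    have hm' : m = ν.withDensity fun x ↦
      ENNReal.ofReal (Real.exp (t * x ^ 2 - s * ψ x) / Z) := rfl
    have : SigmaFinite (ν.withDensity fun x ↦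
      ENNReal.ofReal (Real.exp (t * x ^ 2 - s * ψ x) / Z)) := by rw [← hm']; infer_instance
    simp only [hm']
    rw [pi_withDensity_ofReal ν (hadm.div_const _) (fun x ↦ by positivity),
      withDensity_apply _ hAm]
    refine (setLIntegral_mono' hAm (g := fun _ ↦ ENNReal.ofReal D) fun x hx ↦ ?_).trans_eq
      (by simp)
    refine ENNReal.ofReal_le_ofReal ?_
    rw [sum_exp_prod, hD]
    gcongr
    obtain ⟨hx1, hx2⟩ := hx
    rw [hm2, abs_lt] at hx1
    rw [abs_lt] at hx2
    have e1 : t * (∑ i, x i ^ 2 - n * q ^ 2) ≤ |t| * (n * η) := by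
      refine (le_abs_self _).trans ?_
      rw [abs_mul]
      gcongr
      exact abs_le.2 ⟨hx1.1.le, hx1.2.le⟩
    -- Complementary slackness enters here: either s = 0 and the sum is irrelevant, or the mean of ψ
    -- is exactly 1.
    have e2 : -(s * ∑ i, ψ (x i)) ≤ -(n * s) + s * (n * η) := by
      rcases hs.eq_or_lt with hs0 | hs0
      · simp [← hs0]
      · rw [hmψ' hs0] at hx2
        nlinarith [hx2.1]
    have e3 : (n : ℝ) * ((|t| + s) * η) ≤ n * (ε / 2) := by gcongr
    nlinarith
  have hsub : Measure.pi (fun _ : Fin n ↦ ν) A ≤ Measure.pi (fun _ : Fin n ↦ ν)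
        {x | |∑ i, x i ^ 2 - n * q ^ 2| < n * δ ∧ ∑ i, ψ (x i) < n * (1 + δ)} := by
    refine measure_mono fun x hx ↦ ?_
    obtain ⟨hx1, hx2⟩ := hx
    rw [hm2] at hx1
    have e : (n : ℝ) * η ≤ n * δ := by gcongr
    have e' : (n : ℝ) * ∫ x, ψ x ∂m ≤ n * 1 := by gcongr
    exact ⟨hx1.trans_le e, by have := (abs_lt.1 hx2).2; linarith⟩
  refine le_trans ?_ hsub
  have h7 : ENNReal.ofReal (1 / 2 / D) ≤ Measure.pi (fun _ : Fin n ↦ ν) A := by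
    rw [ENNReal.ofReal_div_of_pos hDpos]
    refine ENNReal.div_le_of_le_mul' ?_
    refine le_trans ?_ (hmA.trans hmν)
    rw [one_div, ENNReal.ofReal_inv_of_pos (by norm_num)]
    simp
  refine le_trans (ENNReal.ofReal_le_ofReal ?_) h7
  have h8 := ha t s hs hadm
  rw [← hZdef] at h8
  have h9 : D ≤ Real.exp (n * (a + ε / 2)) := by
    rw [hD, div_le_iff₀ (by positivity), ← Real.exp_log (show 0 < Z ^ n by positivity),
      ← Real.exp_add, Real.log_pow]
    refine Real.exp_le_exp.2 ?_
    have : (0 : ℝ) ≤ n := n.cast_nonneg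
    nlinarith
  rw [le_div_iff₀ hDpos]
  calc Real.exp (-(n * (a + ε))) * D
      ≤ Real.exp (-(n * (a + ε))) * Real.exp (n * (a + ε / 2)) := by gcongr
    _ = Real.exp (-(n * (ε / 2))) := by rw [← Real.exp_add]; congr 1; ring
    _ ≤ 1 / 2 := h3

end IsTiltable

/-! ### The two families of base measures -/

theorem exists_rpow_le_mul_exp (p : ℝ) {ε : ℝ} (hε : 0 < ε) :
    ∃ C, ∀ u : ℝ, 0 ≤ u → u ^ p ≤ C * Real.exp (ε * u) ∨ u < 1 := by
  obtain ⟨k, hk⟩ := exists_nat_ge p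
  refine ⟨k.factorial / ε ^ k, fun u hu ↦ ?_⟩
  rcases lt_or_ge u 1 with h | h
  · exact Or.inr h
  left
  have h1 := Real.pow_div_factorial_le_exp (ε * u) (by positivity) k
  have h2 : u ^ p ≤ u ^ (k : ℝ) := Real.rpow_le_rpow_of_exponent_le h hk
  rw [Real.rpow_natCast] at h2
  rw [div_le_iff₀ (by positivity), mul_pow] at h1
  rw [div_mul_eq_mul_div, le_div_iff₀ (by positivity)]
  calc u ^ p * ε ^ k ≤ u ^ k * ε ^ k := by gcongr
    _ ≤ _ := by linarith

theorem abs_rpow_eq_sq_rpow (p x : ℝ) : |x| ^ p = (x ^ 2) ^ (p / 2) := by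
  rw [← sq_abs, ← Real.rpow_natCast, ← Real.rpow_mul (abs_nonneg x)]
  congr 1; push_cast; ring

/-- Bernoulli's inequality, that is, the tangent of u ↦ u^{p/2} at u = x² = 1. It is the comparison
of p-norm and 2-norm from which all bounds by 1 are derived. -/
theorem one_add_le_abs_rpow {p : ℝ} (hp : 2 ≤ p) (x : ℝ) :
    1 + p / 2 * (x ^ 2 - 1) ≤ |x| ^ p := by
  rw [abs_rpow_eq_sq_rpow]
  have := one_add_mul_self_le_rpow_one_add (s := x ^ 2 - 1) (by nlinarith [sq_nonneg x])
    (p := p / 2) (by linarith)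
  simpa using this

theorem abs_rpow_growth {p : ℝ} (hp : 2 ≤ p) {ε : ℝ} (hε : 0 < ε) :
    ∃ C, ∀ x : ℝ, (|x| ^ p) ^ 2 ≤ C * Real.exp (ε * x ^ 2) := by
  obtain ⟨C, hC⟩ := exists_rpow_le_mul_exp p hε
  refine ⟨max C 1, fun x ↦ ?_⟩
  have e : (|x| ^ p) ^ 2 = (x ^ 2) ^ p := by
    rw [← sq_abs x, ← Real.rpow_natCast, ← Real.rpow_natCast, ← Real.rpow_mul (abs_nonneg x),
      ← Real.rpow_mul (abs_nonneg x)]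
    congr 1; push_cast; ring
  rw [e]
  rcases hC (x ^ 2) (sq_nonneg x) with h | h
  · exact h.trans (by gcongr; exact le_max_left _ _)
  · calc (x ^ 2) ^ p ≤ 1 := Real.rpow_le_one (sq_nonneg x) h.le (by linarith)
      _ ≤ 1 * Real.exp (ε * x ^ 2) := by
        rw [one_mul]; exact Real.one_le_exp (by positivity)
      _ ≤ _ := by gcongr; exact le_max_right _ _

/-- Here p > 2 must be strict: beyond the threshold M the factor |x|^{p-2} outweighs |t|/s, and
below it the quadratic term is bounded. -/
theorem exists_sq_le_abs_rpow {p : ℝ} (hp : 2 < p) (t : ℝ) {s : ℝ} (hs : 0 < s) :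
    ∃ C, ∀ x : ℝ, t * x ^ 2 ≤ s * |x| ^ p + C := by
  set M := ((|t| + 1) / s) ^ (1 / (p - 2)) with hM
  have hM0 : 0 < M := by positivity
  have hMp : M ^ (p - 2) = (|t| + 1) / s := by
    rw [hM, ← Real.rpow_mul (by positivity), one_div_mul_cancel (by linarith), Real.rpow_one]
  refine ⟨|t| * M ^ 2, fun x ↦ ?_⟩
  have h1 : t * x ^ 2 ≤ |t| * x ^ 2 := by gcongr; exact le_abs_self t
  refine h1.trans ?_
  rcases le_or_gt M |x| with hx | hx
  · have h2 : |x| ^ p = |x| ^ (p - 2) * x ^ 2 := by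
      rw [← sq_abs, ← Real.rpow_natCast, ← Real.rpow_add (hM0.trans_le hx)]
      congr 1; push_cast; ring
    have h3 : (|t| + 1) / s ≤ |x| ^ (p - 2) := by
      rw [← hMp]; exact Real.rpow_le_rpow hM0.le hx (by linarith)
    rw [div_le_iff₀ hs] at h3
    rw [h2]
    have : 0 ≤ |t| * M ^ 2 := by positivity
    nlinarith [mul_le_mul_of_nonneg_right h3 (sq_nonneg x), sq_nonneg x]
  · have h2 : x ^ 2 ≤ M ^ 2 := by rw [← sq_abs]; gcongr
    have : 0 ≤ s * |x| ^ p := by positivity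
    nlinarith [mul_le_mul_of_nonneg_left h2 (abs_nonneg t)]

theorem admissible_abs_rpow_of_lt {p : ℝ} (hp : 2 < p) (t : ℝ) {s : ℝ} (hs : 0 < s) :
    IsAdmissible volume (fun x ↦ |x| ^ p) t s := by
  obtain ⟨C, hC⟩ := exists_sq_le_abs_rpow hp (t + 1) hs
  have hi := (integrable_exp_neg_mul_sq (b := 1) one_pos).const_mul (Real.exp C)
  refine Integrable.mono' hi (by fun_prop) (.of_forall fun x ↦ ?_)
  rw [Real.norm_eq_abs, abs_of_pos (Real.exp_pos _), ← Real.exp_add]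
  exact Real.exp_le_exp.2 (by linarith [hC x])

theorem admissible_abs_rpow_zero_iff {p t : ℝ} :
    IsAdmissible volume (fun x ↦ |x| ^ p) t 0 ↔ t < 0 := by
  have := integrable_exp_neg_mul_sq_iff (b := -t)
  simpa [IsAdmissible] using this

theorem admissible_abs_rpow_two_iff {t s : ℝ} :
    IsAdmissible volume (fun x ↦ |x| ^ (2 : ℝ)) t s ↔ t < s := by
  have := integrable_exp_neg_mul_sq_iff (b := s - t)
  rw [IsAdmissible, ← sub_pos, ← this]
  refine integrable_congr (.of_forall fun x ↦ ?_)
  simp only [Real.rpow_two, sq_abs]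
  congr 1; ring

/-- For p = 2 the admissible parameters form the half-plane t < s. For p > 2 every t is admissible
once s > 0, and only t < 0 if s = 0; hence the case distinctions. -/
theorem isTiltable_abs_rpow {p : ℝ} (hp : 2 ≤ p) :
    IsTiltable volume fun x ↦ |x| ^ p where
  measurable := by fun_prop
  nonneg x := by positivity
  le_sq x hx := by
    rcases (abs_nonneg x).eq_or_lt with h | h
    · rw [← h, Real.zero_rpow (by linarith)]; positivity
    · have := Real.rpow_le_rpow_of_exponent_ge h hx hp
      simpa using this
  le_measure_Icc a b _ _ := by simp
  admissible := admissible_abs_rpow_zero_iff.2 (by norm_num)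
  growth ε hε := abs_rpow_growth hp hε
  open_left t s hs h := by
    rcases hp.eq_or_lt with rfl | hp
    · rw [admissible_abs_rpow_two_iff] at h
      exact ⟨(s - t) / 2, by linarith, admissible_abs_rpow_two_iff.2 (by linarith)⟩
    rcases hs.eq_or_lt with rfl | hs
    · rw [admissible_abs_rpow_zero_iff] at h
      exact ⟨-t / 2, by linarith, admissible_abs_rpow_zero_iff.2 (by linarith)⟩
    · exact ⟨1, one_pos, admissible_abs_rpow_of_lt hp _ hs⟩
  open_right t s hs h := by
    rcases hp.eq_or_lt with rfl | hp
    · rw [admissible_abs_rpow_two_iff] at h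
      exact ⟨min s ((s - t) / 2), by simp [hs, h], min_le_left _ _,
        admissible_abs_rpow_two_iff.2 (by linarith [min_le_right s ((s - t) / 2)])⟩
    · exact ⟨s / 2, by linarith, by linarith, admissible_abs_rpow_of_lt hp _ (by linarith)⟩

theorem admissible_cube (t s : ℝ) :
    IsAdmissible (volume.restrict (Set.Icc (-1) 1)) (fun _ ↦ 0) t s :=
  Continuous.integrableOn_Icc (f := fun x : ℝ ↦ Real.exp (t * x ^ 2 - s * 0)) (by fun_prop)

/-- For the cube the constraint is built into the measure, so ψ = 0 and the partition function does
not depend on s. -/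
theorem isTiltable_cube :
    IsTiltable (volume.restrict (Set.Icc (-1) 1)) fun _ ↦ 0 where
  measurable := measurable_const
  nonneg _ := le_rfl
  le_sq x _ := sq_nonneg x
  le_measure_Icc a b ha hb := by
    rw [Measure.restrict_apply measurableSet_Icc, Set.Icc_inter_Icc,
      max_eq_left (by linarith), min_eq_left hb]
    simp
  admissible := admissible_cube _ _
  growth ε _ := ⟨0, fun x ↦ by simp⟩
  open_left t s _ _ := ⟨1, one_pos, admissible_cube _ _⟩
  open_right t s hs _ := ⟨s, hs, le_rfl, admissible_cube _ _⟩

/-- The dual bound is convex in `q²`. -/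
theorem DualBound.convex {ν : Measure ℝ} {ψ : ℝ → ℝ} {q₀ q₁ q a₀ a₁ θ : ℝ}
    (h0 : DualBound ν ψ q₀ a₀) (h1 : DualBound ν ψ q₁ a₁) (hθ0 : 0 ≤ θ) (hθ1 : θ ≤ 1)
    (hq : q ^ 2 = (1 - θ) * q₀ ^ 2 + θ * q₁ ^ 2) :
    DualBound ν ψ q ((1 - θ) * a₀ + θ * a₁) := by
  intro t s hs hts
  have e0 := mul_le_mul_of_nonneg_left (h0 t s hs hts) (sub_nonneg.2 hθ1)
  have e1 := mul_le_mul_of_nonneg_left (h1 t s hs hts) hθ0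
  rw [hq]
  linarith

namespace IsTiltable

variable {ν : Measure ℝ} {ψ : ℝ → ℝ}

theorem exists_dualBound (h : IsTiltable ν ψ) {q : ℝ} (hq0 : 0 < q) (hq1 : q < 1) :
    ∃ a, DualBound ν ψ q a := by
  obtain ⟨t₀, s₀, hs₀, hadm, hmin⟩ := h.exists_minimizer hq0 hq1
  have hZ := h.partitionFn_pos hadm
  refine ⟨t₀ * q ^ 2 - s₀ - Real.log (partitionFn ν ψ t₀ s₀), fun t s hs hts ↦ ?_⟩
  have h1 := Real.log_le_log (by positivity) (hmin t s hs hts)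
  rw [Real.log_mul (Real.exp_ne_zero _) hZ.ne',
    Real.log_mul (Real.exp_ne_zero _) (h.partitionFn_pos hts).ne', Real.log_exp,
    Real.log_exp] at h1
  linarith

/-- Tilting requires q < 1. At q = 1 the point is moved slightly towards 1/2, where some finite dual
bound holds; by convexity the bound increases by an arbitrarily small amount. -/
theorem exists_dualBound_lt (h : IsTiltable ν ψ) {q a b : ℝ} (hq0 : 0 < q) (hq1 : q ≤ 1)
    (ha : DualBound ν ψ q a) (hab : a < b) {V : Set ℝ} (hV : V ∈ 𝓝 q) :
    ∃ q' ∈ V, 0 < q' ∧ q' < 1 ∧ DualBound ν ψ q' b := by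
  rcases hq1.lt_or_eq with hq1 | rfl
  · refine ⟨q, mem_of_mem_nhds hV, hq0, hq1, fun t s hs hts ↦ (ha t s hs hts).trans hab.le⟩
  obtain ⟨c, hc⟩ := h.exists_dualBound (q := 1 / 2) (by norm_num) (by norm_num)
  have hcont : Tendsto (fun θ : ℝ ↦ √((1 - θ) * (1 / 2) ^ 2 + θ * 1 ^ 2)) (𝓝[<] 1) (𝓝 1) := by
    have : Continuous fun θ : ℝ ↦ √((1 - θ) * (1 / 2) ^ 2 + θ * 1 ^ 2) := by fun_prop
    refine tendsto_nhdsWithin_of_tendsto_nhds ?_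
    convert this.tendsto 1 using 2
    simp
  have hcont2 : Tendsto (fun θ : ℝ ↦ (1 - θ) * c + θ * a) (𝓝[<] 1) (𝓝 a) := by
    have : Continuous fun θ : ℝ ↦ (1 - θ) * c + θ * a := by fun_prop
    refine tendsto_nhdsWithin_of_tendsto_nhds ?_
    convert this.tendsto 1 using 2
    simp
  have hev : ∀ᶠ θ : ℝ in 𝓝[<] 1, 0 < θ :=
    nhdsWithin_le_nhds (lt_mem_nhds one_pos)
  obtain ⟨θ, ⟨h1, h2⟩, h3, h4⟩ := (((hcont.eventually hV).and
    (hcont2.eventually_lt_const hab)).and (hev.and self_mem_nhdsWithin)).exists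
  refine ⟨_, h1, Real.sqrt_pos.2 (by nlinarith), ?_, ?_⟩
  · rw [Real.sqrt_lt' one_pos]; nlinarith
  · intro t s hs hts
    refine ((hc.convex ha h3.le h4.le ?_) t s hs hts).trans h2.le
    rw [Real.sq_sqrt (by nlinarith)]

end IsTiltable

/-! ### The rate function `J_p` and the dual bounds -/

/-- The normalizing constant of the `p`-generalized Gaussian density. -/
noncomputable def pGaussianConst (p : ℝ) : ℝ := 2 * p ^ (1 / p) * Real.Gamma (1 + 1 / p)

theorem pGaussianConst_pos {p : ℝ} (hp : 2 ≤ p) : 0 < pGaussianConst p := by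
  have h1 : 0 < 1 + 1 / p := by positivity
  have := Real.Gamma_pos_of_pos h1
  have : 0 < p := by linarith
  unfold pGaussianConst
  positivity

/-- The substitution t₂ = 1/p - s absorbs the Gaussian-type density, so the cumulant becomes a log
partition function for Lebesgue measure. -/
theorem pCumulant_integrand (p t s x : ℝ) :
    Real.exp (t * x ^ 2 + (1 / p - s) * |x| ^ p) * pGaussianDensity p x =
      (pGaussianConst p)⁻¹ * Real.exp (t * x ^ 2 - s * |x| ^ p) := by
  rw [pGaussianDensity, pGaussianConst, mul_left_comm, ← Real.exp_add]
  congr 2; ring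

theorem pCumulant_of_admissible {p t s : ℝ} (hp : 2 ≤ p)
    (h : IsAdmissible volume (fun x ↦ |x| ^ p) t s) :
    pCumulant p t (1 / p - s) = ((Real.log (partitionFn volume (fun x ↦ |x| ^ p) t s) -
      Real.log (pGaussianConst p) : ℝ) : EReal) := by
  have hc := pGaussianConst_pos hp
  have hZ := (isTiltable_abs_rpow hp).partitionFn_pos h
  rw [pCumulant]
  simp only [pCumulant_integrand]
  rw [← ofReal_integral_eq_lintegral_ofReal (h.const_mul _) (.of_forall fun x ↦ by positivity),
    integral_const_mul]
  change ENNReal.log (ENNReal.ofReal (_ * partitionFn volume (fun x ↦ |x| ^ p) t s)) = _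
  rw [ENNReal.log_ofReal_of_pos (by positivity), Real.log_mul (by positivity) hZ.ne',
    Real.log_inv]
  congr 1; ring

theorem pCumulant_of_not_admissible {p t s : ℝ} (hp : 2 ≤ p)
    (h : ¬ IsAdmissible volume (fun x ↦ |x| ^ p) t s) : pCumulant p t (1 / p - s) = ⊤ := by
  have hc := pGaussianConst_pos hp
  rw [pCumulant]
  simp only [pCumulant_integrand]
  rw [ENNReal.log_eq_top_iff]
  by_contra hfin
  refine h ?_
  have h1 : Integrable (fun x ↦ (pGaussianConst p)⁻¹ * Real.exp (t * x ^ 2 - s * |x| ^ p)) := by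
    refine ⟨by fun_prop, ?_⟩
    rw [hasFiniteIntegral_iff_ofReal (.of_forall fun x ↦ by positivity)]
    exact Ne.lt_top hfin
  refine (h1.const_mul (pGaussianConst p)).congr (.of_forall fun x ↦ ?_)
  simp only
  rw [mul_inv_cancel_left₀ hc.ne']

theorem exists_lt_of_lt_pCumulantDual {p x₁ x₂ : ℝ} (hp : 2 ≤ p) {a : ℝ}
    (h : (a : EReal) < pCumulantDual p x₁ x₂) :
    ∃ t s, IsAdmissible volume (fun x ↦ |x| ^ p) t s ∧
      a < t * x₁ + (1 / p - s) * x₂ - Real.log (partitionFn volume (fun x ↦ |x| ^ p) t s) +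
        Real.log (pGaussianConst p) := by
  simp only [pCumulantDual, lt_iSup_iff] at h
  obtain ⟨t, t₂, h⟩ := h
  obtain ⟨s, rfl⟩ : ∃ s, t₂ = 1 / p - s := ⟨1 / p - t₂, by ring⟩
  by_cases hts : IsAdmissible volume (fun x ↦ |x| ^ p) t s
  · refine ⟨t, s, hts, ?_⟩
    rw [pCumulant_of_admissible hp hts, ← EReal.coe_sub, EReal.coe_lt_coe_iff] at h
    linarith
  · rw [pCumulant_of_not_admissible hp hts] at h
    simp at h

theorem le_of_pCumulantDual_lt {p x₁ x₂ : ℝ} (hp : 2 ≤ p) {a : ℝ}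
    (h : pCumulantDual p x₁ x₂ < a) {t s : ℝ}
    (hts : IsAdmissible volume (fun x ↦ |x| ^ p) t s) :
    t * x₁ + (1 / p - s) * x₂ - Real.log (partitionFn volume (fun x ↦ |x| ^ p) t s) +
        Real.log (pGaussianConst p) ≤ a := by
  have h1 : ((t * x₁ + (1 / p - s) * x₂ : ℝ) : EReal) - pCumulant p t (1 / p - s) ≤
      pCumulantDual p x₁ x₂ := le_iSup₂ (f := fun t₁ t₂ : ℝ ↦
        ((t₁ * x₁ + t₂ * x₂ : ℝ) : EReal) - pCumulant p t₁ t₂) t (1 / p - s)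
  rw [pCumulant_of_admissible hp hts, ← EReal.coe_sub] at h1
  have := h1.trans h.le
  rw [EReal.coe_le_coe_iff] at this
  linarith

/-- Homogeneity under x ↦ x/c. It reduces the two-variable dual to the slice x₂ = 1. -/
theorem partitionFn_scale {p c t s : ℝ} (hc : 0 < c) :
    partitionFn volume (fun x ↦ |x| ^ p) (t / c ^ 2) (s / c ^ p) =
      c * partitionFn volume (fun x ↦ |x| ^ p) t s := by
  have h := Measure.integral_comp_mul_left (fun x ↦ Real.exp (t * x ^ 2 - s * |x| ^ p)) c⁻¹
  rw [inv_inv, abs_of_pos hc, smul_eq_mul] at h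
  rw [partitionFn, partitionFn, ← h]
  refine integral_congr_ae (.of_forall fun x ↦ ?_)
  simp only
  rw [abs_mul, abs_inv, abs_of_pos hc, Real.mul_rpow (by positivity) (by positivity),
    Real.inv_rpow hc.le, mul_pow, inv_pow]
  congr 1; ring

theorem admissible_scale {p c t s : ℝ} (hc : 0 < c)
    (h : IsAdmissible volume (fun x ↦ |x| ^ p) t s) :
    IsAdmissible volume (fun x ↦ |x| ^ p) (t / c ^ 2) (s / c ^ p) := by
  have := h.comp_mul_left' (inv_ne_zero hc.ne')
  refine this.congr (.of_forall fun x ↦ ?_)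
  simp only
  rw [abs_mul, abs_inv, abs_of_pos hc, Real.mul_rpow (by positivity) (by positivity),
    Real.inv_rpow hc.le, mul_pow, inv_pow]
  congr 1; ring

/-- The exponential growth rate of the volume of the `ℓ_p^n`-ball of radius `n^{1/p}`. -/
noncomputable def ballRate (p : ℝ≥0∞) : ℝ :=
  if p = ∞ then Real.log 2 else Real.log (pGaussianConst p.toReal) + 1 / p.toReal

/-- The base measure belonging to `p`. -/
noncomputable def baseMeasure (p : ℝ≥0∞) : Measure ℝ :=
  if p = ∞ then volume.restrict (Set.Icc (-1) 1) else volume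

/-- The constraint function belonging to `p`. -/
noncomputable def constraintFn (p : ℝ≥0∞) : ℝ → ℝ :=
  if p = ∞ then fun _ ↦ 0 else fun x ↦ |x| ^ p.toReal

theorem two_le_toReal {p : ℝ≥0∞} (hp : 2 ≤ p) (hp' : p ≠ ∞) : 2 ≤ p.toReal := by
  have := ENNReal.toReal_mono hp' hp
  simpa using this

theorem isTiltable_base {p : ℝ≥0∞} (hp : 2 ≤ p) : IsTiltable (baseMeasure p) (constraintFn p) := by
  by_cases h : p = ∞
  · simpa only [baseMeasure, constraintFn, h, if_true] using isTiltable_cube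
  · simpa only [baseMeasure, constraintFn, h, if_false] using
      isTiltable_abs_rpow (two_le_toReal hp h)

instance (p : ℝ≥0∞) : SigmaFinite (baseMeasure p) := by
  unfold baseMeasure
  split_ifs <;> infer_instance

/-! ### Explicit values and bounds for the partition functions -/

theorem log_partitionFn_gaussian (p : ℝ) {T : ℝ} (hT : 0 < T) :
    Real.log (partitionFn volume (fun x ↦ |x| ^ p) (-T) 0) =
      1 / 2 * Real.log (Real.pi / T) := by
  have : partitionFn volume (fun x ↦ |x| ^ p) (-T) 0 = √(Real.pi / T) := by
    rw [← integral_gaussian, partitionFn]; simp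
  rw [this, Real.log_sqrt (by positivity)]; ring

theorem tendsto_log_div_atTop : Tendsto (fun T : ℝ ↦ 1 / 2 * Real.log (Real.pi / T)) atTop atBot := by
  have h1 : Tendsto (fun T : ℝ ↦ 1 / 2 * (Real.log Real.pi - Real.log T)) atTop atBot := by
    refine Tendsto.const_mul_atBot (by norm_num) ?_
    exact tendsto_atBot_add_const_left _ _ (tendsto_neg_atTop_atBot.comp Real.tendsto_log_atTop)
  refine h1.congr' ?_
  filter_upwards [eventually_gt_atTop 0] with T hT
  rw [Real.log_div Real.pi_ne_zero hT.ne']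

theorem partitionFn_cube (t s : ℝ) :
    partitionFn (volume.restrict (Set.Icc (-1) 1)) (fun _ ↦ 0) t s =
      2 * ∫ x in (0 : ℝ)..1, Real.exp (t * x ^ 2) := by
  have hi : ∀ a b : ℝ, IntervalIntegrable (fun x : ℝ ↦ Real.exp (t * x ^ 2)) volume a b :=
    fun a b ↦ (by fun_prop : Continuous fun x : ℝ ↦ Real.exp (t * x ^ 2)).intervalIntegrable a b
  have h1 : ∫ x in (-1 : ℝ)..0, Real.exp (t * x ^ 2) = ∫ x in (0 : ℝ)..1, Real.exp (t * x ^ 2) := by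
    have := intervalIntegral.integral_comp_neg (a := 0) (b := 1)
      (fun x : ℝ ↦ Real.exp (t * x ^ 2))
    simpa using this.symm
  rw [partitionFn, integral_Icc_eq_integral_Ioc, ← intervalIntegral.integral_of_le (by norm_num)]
  simp only [mul_zero, sub_zero]
  rw [← intervalIntegral.integral_add_adjacent_intervals (hi (-1) 0) (hi 0 1), h1]
  ring

theorem integral_cube_pos (t : ℝ) : 0 < ∫ x in (0 : ℝ)..1, Real.exp (t * x ^ 2) :=
  intervalIntegral.intervalIntegral_pos_of_pos
    ((by fun_prop : Continuous fun x : ℝ ↦ Real.exp (t * x ^ 2)).intervalIntegrable 0 1)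
    (fun x ↦ Real.exp_pos _) one_pos

theorem log_partitionFn_cube (t s : ℝ) :
    Real.log (partitionFn (volume.restrict (Set.Icc (-1) 1)) (fun _ ↦ 0) t s) =
      Real.log 2 + cubeCumulant t := by
  rw [partitionFn_cube, Real.log_mul two_ne_zero (integral_cube_pos t).ne', cubeCumulant]

/-- Comparison with the full Gaussian integral; letting T tend to infinity, it makes J_∞ infinite at
0. -/
theorem cubeCumulant_neg_le {T : ℝ} (hT : 0 < T) :
    cubeCumulant (-T) ≤ 1 / 2 * Real.log (Real.pi / T) := by
  have h1 : ∫ x in (0 : ℝ)..1, Real.exp (-T * x ^ 2) ≤ √(Real.pi / T) := by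
    rw [← integral_gaussian, intervalIntegral.integral_of_le zero_le_one]
    exact setIntegral_le_integral (integrable_exp_neg_mul_sq hT)
      (.of_forall fun x ↦ (Real.exp_pos _).le)
  have h2 := Real.log_le_log (integral_cube_pos _) h1
  rw [Real.log_sqrt (by positivity)] at h2
  rw [cubeCumulant]; linarith

/-- Makes J_∞ infinite beyond 1, where t x² - t is unbounded in t. -/
theorem cubeCumulant_le {t : ℝ} (ht : 0 ≤ t) : cubeCumulant t ≤ t := by
  have h1 : ∫ x in (0 : ℝ)..1, Real.exp (t * x ^ 2) ≤ ∫ x in (0 : ℝ)..1, Real.exp t := by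
    refine intervalIntegral.integral_mono_on zero_le_one
      ((by fun_prop : Continuous fun x : ℝ ↦ Real.exp (t * x ^ 2)).intervalIntegrable 0 1)
      (by simp) fun x hx ↦ Real.exp_le_exp.2 ?_
    have : x ^ 2 ≤ 1 := pow_le_one₀ hx.1 hx.2
    nlinarith
  have h2 := Real.log_le_log (integral_cube_pos _) h1
  simpa [cubeCumulant] using h2

/-- Below `J_p q` there is an admissible tilt that beats the given level. -/
theorem exists_tilt_of_lt_rateJ {p : ℝ≥0∞} (hp : 2 ≤ p) {q a : ℝ} (hq : 0 ≤ q)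
    (h : (a : EReal) < rateJ p q) :
    ∃ t s, (p = ∞ → s = 0) ∧ IsAdmissible (baseMeasure p) (constraintFn p) t s ∧
      a < t * q ^ 2 - s - Real.log (partitionFn (baseMeasure p) (constraintFn p) t s) +
        ballRate p := by
  by_cases hpt : p = ∞
  · simp only [rateJ, baseMeasure, constraintFn, ballRate, hpt, if_true] at h ⊢
    simp only [cubeCumulantDual, lt_iSup_iff] at h
    obtain ⟨t, ht⟩ := h
    rw [EReal.coe_lt_coe_iff] at ht
    refine ⟨t, 0, fun _ ↦ rfl, admissible_cube _ _, ?_⟩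
    rw [log_partitionFn_cube]; linarith
  have hp2 := two_le_toReal hp hpt
  simp only [rateJ, baseMeasure, constraintFn, ballRate, hpt, if_false] at h ⊢
  rcases hq.eq_or_lt with rfl | hq
  -- At q = 0 the infimum defining J_p is over the empty set, so every level has to be beaten:
  -- Gaussian tilts with t = -T and large T do this.
  · obtain ⟨T, hT0, hT⟩ := ((eventually_gt_atTop (0 : ℝ)).and
      (tendsto_log_div_atTop.eventually_lt_atBot
        (Real.log (pGaussianConst p.toReal) + 1 / p.toReal - a))).exists
    refine ⟨-T, 0, fun h ↦ h.elim, admissible_abs_rpow_zero_iff.2 (by linarith), ?_⟩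
    rw [log_partitionFn_gaussian _ hT0]
    linarith
  -- The pair (q², 1) competes in the infimum defining J_p.
  · have h1 : (a : EReal) < pCumulantDual p.toReal (q ^ 2) 1 := by
      refine h.trans_le ?_
      refine iInf_le_of_le (q ^ 2) (iInf_le_of_le 1 (iInf_le_of_le (by positivity)
        (iInf_le_of_le one_pos (iInf_le_of_le ?_ le_rfl))))
      rw [Real.one_rpow, mul_one, ← Real.sqrt_eq_rpow, Real.sqrt_sq hq.le]
    obtain ⟨t, s, hts, hlt⟩ := exists_lt_of_lt_pCumulantDual hp2 h1
    exact ⟨t, s, fun h ↦ h.elim, hts, by linarith⟩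

/-- The tilts (p s/2 - 1, s) follow the tangent in Bernoulli's inequality, so their log partition
function is at most s(p/2 - 1) plus a constant. If x > 1, the dual then grows linearly in s,
contradicting the bound. -/
theorem le_one_of_dualBound_abs_rpow {p x a : ℝ} (hp : 2 ≤ p) (hx : 0 < x)
    (h : DualBound volume (fun x ↦ |x| ^ p) x a) : x ≤ 1 := by
  by_contra! hx1
  have key : ∀ s : ℝ, 0 ≤ s → s * (p / 2 * (x ^ 2 - 1)) ≤ a + x ^ 2 + Real.log √Real.pi := by
    intro s hs
    have hle : ∀ y : ℝ, Real.exp ((p / 2 * s - 1) * y ^ 2 - s * |y| ^ p) ≤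
        Real.exp (s * (p / 2 - 1)) * Real.exp (-1 * y ^ 2) := by
      intro y
      rw [← Real.exp_add]
      refine Real.exp_le_exp.2 ?_
      nlinarith [mul_le_mul_of_nonneg_left (one_add_le_abs_rpow hp y) hs]
    have hi := (integrable_exp_neg_mul_sq (b := 1) one_pos).const_mul (Real.exp (s * (p / 2 - 1)))
    have hadm : IsAdmissible volume (fun x ↦ |x| ^ p) (p / 2 * s - 1) s := by
      refine Integrable.mono' hi (by fun_prop) (.of_forall fun y ↦ ?_)
      rw [Real.norm_eq_abs, abs_of_pos (Real.exp_pos _)]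
      exact hle y
    have hZ : partitionFn volume (fun x ↦ |x| ^ p) (p / 2 * s - 1) s ≤
        Real.exp (s * (p / 2 - 1)) * √Real.pi := by
      have h1 := integral_mono hadm hi hle
      rw [integral_const_mul, integral_gaussian, div_one] at h1
      exact h1
    have h2 := Real.log_le_log ((isTiltable_abs_rpow hp).partitionFn_pos hadm) hZ
    rw [Real.log_mul (Real.exp_ne_zero _) (by positivity), Real.log_exp] at h2
    have h3 := h _ _ hs hadm
    linarith
  have hd : 0 < p / 2 * (x ^ 2 - 1) := by
    have : 0 < x ^ 2 - 1 := by nlinarith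
    positivity
  have := key ((|a + x ^ 2 + Real.log √Real.pi| + 1) / (p / 2 * (x ^ 2 - 1))) (by positivity)
  rw [div_mul_cancel₀ _ hd.ne'] at this
  linarith [le_abs_self (a + x ^ 2 + Real.log √Real.pi)]

/-- Above `J_p x` the dual bound holds. -/
theorem dualBound_of_rateJ_lt {p : ℝ≥0∞} (hp : 2 ≤ p) {x a : ℝ} (hx : 0 ≤ x)
    (h : rateJ p x < a) :
    0 < x ∧ x ≤ 1 ∧ DualBound (baseMeasure p) (constraintFn p) x (a - ballRate p) := by
  by_cases hpt : p = ∞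
  · simp only [rateJ, baseMeasure, constraintFn, ballRate, hpt, if_true] at h ⊢
    have h1 : ∀ t : ℝ, t * x ^ 2 - cubeCumulant t ≤ a := by
      intro t
      have := (le_iSup (fun t : ℝ ↦ ((t * x ^ 2 - cubeCumulant t : ℝ) : EReal)) t).trans h.le
      exact EReal.coe_le_coe_iff.1 this
    refine ⟨hx.lt_of_ne ?_, ?_, fun t s _ _ ↦ ?_⟩
    · rintro rfl
      obtain ⟨T, hT0, hT⟩ := ((eventually_gt_atTop (0 : ℝ)).and
        (tendsto_log_div_atTop.eventually_lt_atBot (-a))).exists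
      have h2 := h1 (-T)
      have h3 := cubeCumulant_neg_le hT0
      linarith
    · by_contra! hx1
      have hd : 0 < x ^ 2 - 1 := by nlinarith
      have h2 := h1 ((|a| + 1) / (x ^ 2 - 1))
      have h3 := cubeCumulant_le (t := (|a| + 1) / (x ^ 2 - 1)) (by positivity)
      have h4 : (|a| + 1) / (x ^ 2 - 1) * (x ^ 2 - 1) = |a| + 1 := by field_simp
      linarith [le_abs_self a]
    · rw [log_partitionFn_cube]
      linarith [h1 t]
  have hp2 := two_le_toReal hp hpt
  have hp0 : 0 < p.toReal := by linarith
  simp only [rateJ, baseMeasure, constraintFn, ballRate, hpt, if_false] at h ⊢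
  simp only [iInf_lt_iff] at h
  obtain ⟨x₁, x₂, hx₁, hx₂, rfl, h⟩ := h
  -- Rescaling by c moves the pair (x₁, x₂) to the slice with second coordinate 1.
  set c := x₂ ^ (1 / p.toReal) with hc
  have hc0 : 0 < c := by positivity
  have hcp : c ^ p.toReal = x₂ := by
    rw [hc, ← Real.rpow_mul hx₂.le, one_div_mul_cancel hp0.ne', Real.rpow_one]
  have hlogc : Real.log c = Real.log x₂ / p.toReal := by
    rw [hc, Real.log_rpow hx₂]; ring
  have hy : x₁ ^ (1 / 2 : ℝ) * x₂ ^ (-(1 / p.toReal)) = √x₁ / c := by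
    rw [Real.rpow_neg hx₂.le, ← Real.sqrt_eq_rpow, ← hc]; rfl
  rw [hy]
  have hy0 : 0 < √x₁ / c := by positivity
  have hD : DualBound volume (fun x ↦ |x| ^ p.toReal) (√x₁ / c)
      (a - (Real.log (pGaussianConst p.toReal) + 1 / p.toReal)) := by
    intro t s hs hts
    have h1 := le_of_pCumulantDual_lt hp2 h (admissible_scale hc0 hts)
    rw [partitionFn_scale hc0, Real.log_mul hc0.ne'
      ((isTiltable_abs_rpow hp2).partitionFn_pos hts).ne', hcp, hlogc] at h1
    have h2 : t / c ^ 2 * x₁ = t * (√x₁ / c) ^ 2 := by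
      rw [div_pow, Real.sq_sqrt hx₁.le]; ring
    have h3 : (1 / p.toReal - s / x₂) * x₂ = x₂ / p.toReal - s := by field_simp
    rw [h2, h3] at h1
    -- By log x₂ ≤ x₂ - 1, replacing x₂ by 1 does not worsen the bound.
    have h4 : 1 / p.toReal + Real.log x₂ / p.toReal ≤ x₂ / p.toReal := by
      rw [← add_div]
      have := Real.log_le_sub_one_of_pos hx₂
      gcongr
      linarith
    linarith
  exact ⟨hy0, le_one_of_dualBound_abs_rpow hp2 hy0 hD, hD⟩

/-! ### Asymptotics of the Gamma function and volumes of balls -/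

/-- Restrict the Gamma integral to t > x, where t^x ≥ x^x. -/
theorem rpow_self_mul_exp_le_Gamma {x : ℝ} (hx : 0 ≤ x) :
    x ^ x * Real.exp (-x) ≤ Real.Gamma (x + 1) := by
  have hi := Real.GammaIntegral_convergent (s := x + 1) (by linarith)
  rw [Real.Gamma_eq_integral (by linarith)]
  calc x ^ x * Real.exp (-x) = ∫ t in Set.Ioi x, Real.exp (-t) * x ^ x := by
        rw [integral_mul_const, integral_exp_neg_Ioi, mul_comm]
    _ ≤ ∫ t in Set.Ioi x, Real.exp (-t) * t ^ (x + 1 - 1) := by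
        refine setIntegral_mono_on ((integrableOn_exp_neg_Ioi x).mul_const _)
          (hi.mono_set (Set.Ioi_subset_Ioi hx)) measurableSet_Ioi fun t ht ↦ ?_
        rw [add_sub_cancel_right]
        gcongr
        exact le_of_lt ht
    _ ≤ _ := by
        refine setIntegral_mono_set hi ?_ (.of_forall (Set.Ioi_subset_Ioi hx))
        filter_upwards [ae_restrict_mem measurableSet_Ioi] with t ht
        have : (0 : ℝ) < t := ht
        positivity

/-- Split exp(-t) as exp(-(1-ε)t) exp(-εt). The product of t^x with the first factor is maximal at t
= x/(1-ε), and the second factor integrates to 1/ε. -/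
theorem Gamma_le_rpow_self_mul_exp {x ε : ℝ} (hx : 0 ≤ x) (hε0 : 0 < ε) (hε1 : ε < 1) :
    Real.Gamma (x + 1) ≤ (x / (1 - ε)) ^ x * Real.exp (-x) / ε := by
  have hi := Real.GammaIntegral_convergent (s := x + 1) (by linarith)
  have h1ε : 0 < 1 - ε := by linarith
  have hint : IntegrableOn (fun t ↦ Real.exp (-ε * t)) (Set.Ioi 0) :=
    integrableOn_exp_mul_Ioi (by linarith) 0
  have hval : ∫ t in Set.Ioi (0 : ℝ), Real.exp (-ε * t) = 1 / ε := by
    rw [integral_exp_mul_Ioi (by linarith)]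
    simp
  rw [Real.Gamma_eq_integral (by linarith)]
  calc _ ≤ ∫ t in Set.Ioi (0 : ℝ), (x / (1 - ε)) ^ x * Real.exp (-x) * Real.exp (-ε * t) := by
        refine setIntegral_mono_on hi (hint.const_mul _) measurableSet_Ioi fun t ht ↦ ?_
        have ht : (0 : ℝ) < t := ht
        rw [add_sub_cancel_right]
        rcases hx.eq_or_lt with rfl | hx
        · simp only [Real.rpow_zero, mul_one, neg_zero, Real.exp_zero, one_mul]
          exact Real.exp_le_exp.2 (by nlinarith)
        · rw [Real.rpow_def_of_pos ht, Real.rpow_def_of_pos (by positivity), ← Real.exp_add,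
            ← Real.exp_add, ← Real.exp_add]
          refine Real.exp_le_exp.2 ?_
          have h2 := Real.log_le_sub_one_of_pos (show 0 < t / (x / (1 - ε)) by positivity)
          rw [Real.log_div ht.ne' (by positivity)] at h2
          have h3 : x * (t / (x / (1 - ε)) - 1) = (1 - ε) * t - x := by field_simp
          nlinarith [mul_le_mul_of_nonneg_left h2 hx.le]
    _ = _ := by rw [integral_const_mul, hval]; ring

/-- A form of Stirling's formula on the exponential scale. -/
theorem tendsto_log_Gamma {x : ℕ → ℝ} {ξ : ℝ} (hx0 : ∀ n, 0 ≤ x n)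
    (hx : Tendsto (fun n : ℕ ↦ x n / n) atTop (𝓝 ξ)) :
    Tendsto (fun n : ℕ ↦ (Real.log (Real.Gamma (x n + 1)) - x n * Real.log n) / n) atTop
      (𝓝 (ξ * Real.log ξ - ξ)) := by
  -- Continuity of u log u, with value 0 at u = 0, covers the degenerate limit ξ = 0 as well.
  have hcont : Tendsto (fun n : ℕ ↦ x n / n * Real.log (x n / n) - x n / n) atTop
      (𝓝 (ξ * Real.log ξ - ξ)) :=
    ((Real.continuous_mul_log.tendsto ξ).comp hx).sub hx
  have hxlog : ∀ n : ℕ, 0 < n → x n / n * Real.log (x n / n) =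
      (x n * Real.log (x n) - x n * Real.log n) / n := by
    intro n hn
    rcases (hx0 n).eq_or_lt with h | h
    · simp [← h]
    · rw [Real.log_div h.ne' (by positivity)]; ring
  have hξ : 0 ≤ ξ := ge_of_tendsto' hx fun n ↦ div_nonneg (hx0 n) n.cast_nonneg
  have hlog : ∀ y : ℝ, 0 ≤ y → Real.log (y ^ y) = y * Real.log y := by
    intro y hy
    rcases hy.eq_or_lt with rfl | hy
    · simp
    · rw [Real.log_rpow hy]
  have hpow : ∀ y : ℝ, 0 ≤ y → 0 < y ^ y := by
    intro y hy
    rcases hy.eq_or_lt with rfl | hy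
    · simp
    · positivity
  refine tendsto_order.2 ⟨fun b hb ↦ ?_, fun b hb ↦ ?_⟩
  · filter_upwards [hcont.eventually_const_lt hb, eventually_gt_atTop 0] with n hn hn0
    refine hn.trans_le ?_
    rw [hxlog n hn0, ← sub_div]
    refine div_le_div_of_nonneg_right ?_ n.cast_nonneg
    have h1 := Real.log_le_log (mul_pos (hpow _ (hx0 n)) (Real.exp_pos _))
      (rpow_self_mul_exp_le_Gamma (hx0 n))
    rw [Real.log_mul (hpow _ (hx0 n)).ne' (Real.exp_ne_zero _), Real.log_exp, hlog _ (hx0 n)] at h1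
    linarith
  · obtain ⟨ε, hε0, hε1, hε⟩ : ∃ ε : ℝ, 0 < ε ∧ ε < 1 ∧
        ξ * Real.log ξ - ξ - ξ * Real.log (1 - ε) < b := by
      have : Tendsto (fun ε : ℝ ↦ ξ * Real.log ξ - ξ - ξ * Real.log (1 - ε)) (𝓝[>] 0)
          (𝓝 (ξ * Real.log ξ - ξ)) := by
        have h1 : ContinuousAt (fun ε : ℝ ↦ ξ * Real.log ξ - ξ - ξ * Real.log (1 - ε)) 0 := by
          have : ContinuousAt (fun ε : ℝ ↦ Real.log (1 - ε)) 0 :=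
            ContinuousAt.log (by fun_prop) (by simp)
          fun_prop
        have h2 := h1.tendsto
        simp only [sub_zero, Real.log_one, mul_zero] at h2
        exact h2.mono_left nhdsWithin_le_nhds
      obtain ⟨ε, ⟨h1, h2⟩, h3⟩ := ((this.eventually_lt_const hb).and
        (eventually_nhdsWithin_of_eventually_nhds (gt_mem_nhds one_pos)) |>.and
          self_mem_nhdsWithin).exists
      exact ⟨ε, h3, h2, h1⟩
    have hup : Tendsto (fun n : ℕ ↦ x n / n * Real.log (x n / n) - x n / n -
        x n / n * Real.log (1 - ε) - Real.log ε / n) atTop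
        (𝓝 (ξ * Real.log ξ - ξ - ξ * Real.log (1 - ε) - 0)) :=
      (hcont.sub (hx.mul_const _)).sub (tendsto_const_div_atTop_nhds_zero_nat _)
    rw [sub_zero] at hup
    filter_upwards [hup.eventually_lt_const hε, eventually_gt_atTop 0] with n hn hn0
    refine lt_of_le_of_lt ?_ hn
    rw [hxlog n hn0, div_mul_eq_mul_div, ← sub_div, ← sub_div, ← sub_div]
    refine div_le_div_of_nonneg_right ?_ n.cast_nonneg
    have hΓ := Real.Gamma_pos_of_pos (show 0 < x n + 1 by linarith [hx0 n])
    have h1 := Real.log_le_log hΓ (Gamma_le_rpow_self_mul_exp (hx0 n) hε0 hε1)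
    have h1ε : 0 < 1 - ε := by linarith
    have h2 : (x n / (1 - ε)) ^ x n = x n ^ x n / (1 - ε) ^ x n :=
      Real.div_rpow (hx0 n) h1ε.le _
    have h3 := hpow _ (hx0 n)
    rw [Real.log_div (by rw [h2]; positivity) hε0.ne', Real.log_mul (by rw [h2]; positivity)
      (Real.exp_ne_zero _), Real.log_exp, h2, Real.log_div h3.ne' (by positivity),
      hlog _ (hx0 n), Real.log_rpow h1ε] at h1
    linarith

/-- The volume of the `m`-dimensional unit ball of `ℓ_p`. -/
noncomputable def unitBallVolume (p : ℝ) (m : ℕ) : ℝ :=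
  (2 * Real.Gamma (1 / p + 1)) ^ m / Real.Gamma (m / p + 1)

theorem unitBallVolume_pos {p : ℝ} (hp : 1 ≤ p) (m : ℕ) : 0 < unitBallVolume p m := by
  have h1 := Real.Gamma_pos_of_pos (show 0 < 1 / p + 1 by positivity)
  have h2 := Real.Gamma_pos_of_pos (show 0 < m / p + 1 by positivity)
  unfold unitBallVolume
  positivity

theorem tendsto_log_unitBallVolume {p : ℝ} (hp : 1 ≤ p) {m : ℕ → ℕ} {κ : ℝ}
    (hm : Tendsto (fun n : ℕ ↦ (m n : ℝ) / n) atTop (𝓝 κ)) :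
    Tendsto (fun n : ℕ ↦ (Real.log (unitBallVolume p (m n)) + m n / p * Real.log n) / n) atTop
      (𝓝 (κ * Real.log (2 * Real.Gamma (1 / p + 1)) -
        (κ / p * Real.log (κ / p) - κ / p))) := by
  have h1 : Tendsto (fun n : ℕ ↦ ((m n : ℝ) / p) / n) atTop (𝓝 (κ / p)) := by
    refine (hm.div_const p).congr fun n ↦ ?_
    ring
  have h2 := tendsto_log_Gamma (x := fun n ↦ (m n : ℝ) / p) (fun n ↦ by positivity) h1
  refine ((hm.mul_const (Real.log (2 * Real.Gamma (1 / p + 1)))).sub h2).congr fun n ↦ ?_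
  have h3 := Real.Gamma_pos_of_pos (show 0 < 1 / p + 1 by positivity)
  have h4 := Real.Gamma_pos_of_pos (show 0 < m n / p + 1 by positivity)
  rw [unitBallVolume, Real.log_div (by positivity) h4.ne', Real.log_pow]
  ring

theorem volume_sum_abs_rpow_le {ι : Type*} [Fintype ι] [Nonempty ι] {p : ℝ} (hp : 1 ≤ p) {r : ℝ}
    (hr : 0 ≤ r) :
    volume {x : ι → ℝ | ∑ i, |x i| ^ p ≤ r} =
      ENNReal.ofReal (r ^ (Fintype.card ι / p) * unitBallVolume p (Fintype.card ι)) := by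
  have h := volume_sum_rpow_le ι hp (r ^ (1 / p))
  have e : {x : ι → ℝ | (∑ i, |x i| ^ p) ^ (1 / p) ≤ r ^ (1 / p)} =
      {x : ι → ℝ | ∑ i, |x i| ^ p ≤ r} := by
    ext x
    simp only [Set.mem_ofPred_eq]
    exact Real.rpow_le_rpow_iff (by positivity) hr (by positivity)
  rw [e] at h
  rw [h, ENNReal.ofReal_mul (by positivity), unitBallVolume, ← ENNReal.ofReal_pow (by positivity),
    ← Real.rpow_natCast, ← Real.rpow_mul hr]
  congr 3
  ring

/-! ### The uniform distribution on the `ℓ_p^n`-ball in product coordinates -/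

/-- The `ℓ_p`-norm on `ℝⁿ`. -/
noncomputable def pNorm (p : ℝ≥0∞) {n : ℕ} (x : EuclideanSpace ℝ (Fin n)) : ℝ :=
  ‖(WithLp.toLp p (WithLp.ofLp x) : PiLp p fun _ : Fin n ↦ ℝ)‖

theorem mem_lpBall {p : ℝ≥0∞} {n : ℕ} {x : EuclideanSpace ℝ (Fin n)} :
    x ∈ lpBall p n ↔ pNorm p x ≤ 1 := Iff.rfl

theorem pNorm_smul {p : ℝ≥0∞} (hp : 2 ≤ p) {n : ℕ} (r : ℝ) (x : EuclideanSpace ℝ (Fin n)) :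
    pNorm p (r • x) = |r| * pNorm p x := by
  have : Fact (1 ≤ p) := ⟨le_trans (by norm_num) hp⟩
  exact norm_smul r (WithLp.toLp p (WithLp.ofLp x) : PiLp p fun _ : Fin n ↦ ℝ)

theorem pNorm_nonneg {p : ℝ≥0∞} (hp : 2 ≤ p) {n : ℕ} (x : EuclideanSpace ℝ (Fin n)) :
    0 ≤ pNorm p x := by
  have : Fact (1 ≤ p) := ⟨le_trans (by norm_num) hp⟩
  exact norm_nonneg (WithLp.toLp p (WithLp.ofLp x) : PiLp p fun _ : Fin n ↦ ℝ)

theorem continuous_pNorm {p : ℝ≥0∞} (hp : 2 ≤ p) (n : ℕ) :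
    Continuous (pNorm p : EuclideanSpace ℝ (Fin n) → ℝ) := by
  have : Fact (1 ≤ p) := ⟨le_trans (by norm_num) hp⟩
  have h : Continuous fun x : EuclideanSpace ℝ (Fin n) ↦
      (WithLp.toLp p (WithLp.ofLp x) : PiLp p fun _ : Fin n ↦ ℝ) :=
    (PiLp.continuous_toLp p _).comp (PiLp.continuous_ofLp 2 _)
  exact h.norm

theorem measurableSet_lpBall {p : ℝ≥0∞} (hp : 2 ≤ p) (n : ℕ) : MeasurableSet (lpBall p n) :=
  (isClosed_le (continuous_pNorm hp n) continuous_const).measurableSet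

theorem pNorm_rpow {p : ℝ≥0∞} (hp : 2 ≤ p) (hp' : p ≠ ∞) {n : ℕ}
    (x : EuclideanSpace ℝ (Fin n)) :
    pNorm p x ^ p.toReal = ∑ i, |x i| ^ p.toReal := by
  have h0 : 0 < p.toReal := by linarith [two_le_toReal hp hp']
  rw [pNorm, PiLp.norm_eq_sum h0, ← Real.rpow_mul (by positivity), one_div_mul_cancel h0.ne',
    Real.rpow_one]
  rfl

theorem pNorm_top_le_one {n : ℕ} (x : EuclideanSpace ℝ (Fin n)) :
    pNorm ∞ x ≤ 1 ↔ ∀ i, x i ∈ Set.Icc (-1 : ℝ) 1 := by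
  have : Fact (1 ≤ (∞ : ℝ≥0∞)) := ⟨le_top⟩
  have h : pNorm ∞ x = ‖WithLp.ofLp x‖ := PiLp.norm_toLp _
  rw [h, pi_norm_le_iff_of_nonneg zero_le_one]
  simp only [Real.norm_eq_abs, abs_le, Set.mem_Icc]

/-- The set of points satisfying the constraint `∑ ψ (y i) ≤ n`. -/
def constraintSet (p : ℝ≥0∞) (n : ℕ) : Set (Fin n → ℝ) :=
  {y | ∑ i, constraintFn p (y i) ≤ n}

/-- The product of the base measures. -/
noncomputable abbrev basePi (p : ℝ≥0∞) (n : ℕ) : Measure (Fin n → ℝ) :=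
  Measure.pi fun _ : Fin n ↦ baseMeasure p

theorem basePi_apply_of_ne_top {p : ℝ≥0∞} (hp : p ≠ ∞) (n : ℕ) : basePi p n = volume := by
  simp [basePi, baseMeasure, hp, volume_pi]

theorem basePi_top_apply (n : ℕ) (A : Set (Fin n → ℝ)) :
    basePi ∞ n A = volume (A ∩ Set.univ.pi fun _ ↦ Set.Icc (-1 : ℝ) 1) := by
  simp only [basePi, baseMeasure, if_true]
  rw [← Measure.restrict_pi_pi, ← volume_pi, Measure.restrict_apply']
  exact .univ_pi fun _ ↦ measurableSet_Icc

/-- The embedding of product coordinates, scaled such that the constraint set becomes the ball. -/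
noncomputable def scaledPoint (p : ℝ≥0∞) {n : ℕ} (y : Fin n → ℝ) : EuclideanSpace ℝ (Fin n) :=
  (n : ℝ) ^ (-(p⁻¹).toReal) • WithLp.toLp 2 y

theorem pNorm_scaledPoint_rpow {p : ℝ≥0∞} (hp : 2 ≤ p) (hp' : p ≠ ∞) {n : ℕ} (y : Fin n → ℝ) :
    pNorm p (scaledPoint p y) ^ p.toReal = (∑ i, |y i| ^ p.toReal) / n := by
  have h0 : 0 < p.toReal := by linarith [two_le_toReal hp hp']
  have hc : |(n : ℝ) ^ (-(p⁻¹).toReal)| ^ p.toReal = (n : ℝ)⁻¹ := by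
    rw [abs_of_nonneg (by positivity), ← Real.rpow_mul n.cast_nonneg, ENNReal.toReal_inv, neg_mul,
      inv_mul_cancel₀ h0.ne', Real.rpow_neg_one]
  rw [scaledPoint, pNorm_smul hp, Real.mul_rpow (abs_nonneg _) (pNorm_nonneg hp _), hc,
    pNorm_rpow hp hp']
  rw [div_eq_inv_mul]

theorem volume_scaledPoint_preimage (p : ℝ≥0∞) {n : ℕ} (hn : 0 < n)
    (T : Set (EuclideanSpace ℝ (Fin n))) :
    volume {y : Fin n → ℝ | scaledPoint p y ∈ T} =
      ENNReal.ofReal |(((n : ℝ) ^ (-(p⁻¹).toReal)) ^ n)⁻¹| * volume T := by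
  have hc : (n : ℝ) ^ (-(p⁻¹).toReal) ≠ 0 := by positivity
  have h1 := Measure.addHaar_preimage_smul (volume : Measure (Fin n → ℝ)) hc
    ((MeasurableEquiv.toLp 2 (Fin n → ℝ)) ⁻¹' T)
  rw [(PiLp.volume_preserving_toLp (Fin n)).measure_preimage_equiv
    (f := MeasurableEquiv.toLp 2 (Fin n → ℝ)), Module.finrank_fin_fun] at h1
  exact h1

theorem basePi_constraintSet_inter {p : ℝ≥0∞} (hp : 2 ≤ p) {n : ℕ} (hn : 0 < n)
    (A : Set (EuclideanSpace ℝ (Fin n))) :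
    basePi p n (constraintSet p n ∩ {y | scaledPoint p y ∈ A}) =
      volume {y : Fin n → ℝ | scaledPoint p y ∈ lpBall p n ∩ A} := by
  by_cases hp' : p = ∞
  · subst hp'
    rw [basePi_top_apply]
    congr 1
    ext y
    have h1 : scaledPoint ∞ y = WithLp.toLp 2 y := by simp [scaledPoint]
    simp only [constraintSet, constraintFn, if_true, Set.mem_inter_iff, Set.mem_ofPred_eq,
      mem_lpBall, h1, pNorm_top_le_one, Set.mem_univ_pi]
    simp
    tauto
  · rw [basePi_apply_of_ne_top hp']
    congr 1
    ext y
    have h0 : 0 < p.toReal := by linarith [two_le_toReal hp hp']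
    have hn' : (0 : ℝ) < n := by exact_mod_cast hn
    have h1 : pNorm p (scaledPoint p y) ≤ 1 ↔ ∑ i, |y i| ^ p.toReal ≤ n := by
      rw [← Real.rpow_le_rpow_iff (pNorm_nonneg hp _) zero_le_one h0,
        pNorm_scaledPoint_rpow hp hp', Real.one_rpow, div_le_one hn']
    simp only [constraintSet, constraintFn, hp', if_false, Set.mem_inter_iff, Set.mem_ofPred_eq,
      mem_lpBall, h1]

/-- Passing to product coordinates multiplies numerator and denominator by the same Jacobian, which
cancels. -/
theorem lpBallUniform_eq {p : ℝ≥0∞} (hp : 2 ≤ p) {n : ℕ} (hn : 0 < n)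
    (A : Set (EuclideanSpace ℝ (Fin n))) :
    lpBallUniform p n A = (basePi p n (constraintSet p n))⁻¹ *
      basePi p n (constraintSet p n ∩ {y | scaledPoint p y ∈ A}) := by
  have h1 := basePi_constraintSet_inter hp hn A
  have h2 := basePi_constraintSet_inter hp hn Set.univ
  simp only [Set.mem_univ, Set.inter_univ, Set.ofPred_true] at h2
  have hc : ENNReal.ofReal |(((n : ℝ) ^ (-(p⁻¹).toReal)) ^ n)⁻¹| ≠ 0 := by
    rw [ENNReal.ofReal_ne_zero_iff]; positivity
  rw [h1, h2, lpBallUniform, cond_apply (measurableSet_lpBall hp n),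
    volume_scaledPoint_preimage p hn, volume_scaledPoint_preimage p hn,
    ENNReal.mul_inv (Or.inl hc) (Or.inl ENNReal.ofReal_ne_top), mul_mul_mul_comm,
    ENNReal.inv_mul_cancel hc ENNReal.ofReal_ne_top, one_mul]

/-- The powers of n combine to n^{-1/2} for every p, so the normalized norm is the root mean square
of the product coordinates. -/
theorem scaled_norm_scaledPoint (p : ℝ≥0∞) {n : ℕ} (hn : 0 < n) (y : Fin n → ℝ) :
    (n : ℝ) ^ ((p⁻¹).toReal - 1 / 2) * ‖scaledPoint p y‖ = √((∑ i, y i ^ 2) / n) := by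
  have hn' : (0 : ℝ) < n := by exact_mod_cast hn
  rw [scaledPoint, norm_smul, Real.norm_eq_abs, abs_of_pos (by positivity), ← mul_assoc,
    ← Real.rpow_add hn', EuclideanSpace.norm_eq, Real.sqrt_div' _ hn'.le]
  have : (p⁻¹).toReal - 1 / 2 + -(p⁻¹).toReal = -(1 / 2) := by ring
  rw [this, Real.rpow_neg hn'.le, ← Real.sqrt_eq_rpow, div_eq_inv_mul]
  simp

/-- For p = ∞ the set has measure 2ⁿ. For finite p the factor n^{n/p} of the radius cancels the
superexponential decay of the volume of the unit ball. -/
theorem eventually_basePi_constraintSet {p : ℝ≥0∞} (hp : 2 ≤ p) {ε : ℝ} (hε : 0 < ε) :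
    ∀ᶠ n : ℕ in atTop,
      ENNReal.ofReal (Real.exp (n * (ballRate p - ε))) ≤ basePi p n (constraintSet p n) ∧
      basePi p n (constraintSet p n) ≤ ENNReal.ofReal (Real.exp (n * (ballRate p + ε))) := by
  obtain ⟨v, hv, hv0, hlim⟩ : ∃ v : ℕ → ℝ,
      (∀ n, 0 < n → basePi p n (constraintSet p n) = ENNReal.ofReal (v n)) ∧
      (∀ n, 0 < n → 0 < v n) ∧
      Tendsto (fun n : ℕ ↦ Real.log (v n) / n) atTop (𝓝 (ballRate p)) := by
    by_cases hp' : p = ∞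
    · subst hp'
      refine ⟨fun n ↦ 2 ^ n, fun n _ ↦ ?_, fun n _ ↦ by positivity, ?_⟩
      · rw [basePi_top_apply]
        have : constraintSet ∞ n = Set.univ := by ext; simp [constraintSet, constraintFn]
        rw [this, Set.univ_inter, volume_pi, Measure.pi_pi, Real.volume_Icc, Finset.prod_const,
          Finset.card_univ, Fintype.card_fin, ← ENNReal.ofReal_pow (by norm_num)]
        norm_num
      · refine tendsto_const_nhds.congr' ?_
        filter_upwards [eventually_gt_atTop 0] with n hn
        rw [Real.log_pow, ballRate, if_pos rfl]
        field_simp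
    · have hp2 := two_le_toReal hp hp'
      have h0 : 0 < p.toReal := by linarith
      refine ⟨fun n ↦ (n : ℝ) ^ (n / p.toReal) * unitBallVolume p.toReal n, fun n hn ↦ ?_,
        fun n hn ↦ mul_pos (by positivity) (unitBallVolume_pos (by linarith) n), ?_⟩
      · rw [basePi_apply_of_ne_top hp']
        have : Nonempty (Fin n) := ⟨⟨0, hn⟩⟩
        have h := volume_sum_abs_rpow_le (ι := Fin n) (p := p.toReal) (by linarith)
          (Nat.cast_nonneg n)
        rw [Fintype.card_fin] at h
        rw [← h]
        simp [constraintSet, constraintFn, hp']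
      · have h1 : Tendsto (fun n : ℕ ↦ (n : ℝ) / n) atTop (𝓝 1) := by
          refine tendsto_const_nhds.congr' ?_
          filter_upwards [eventually_gt_atTop 0] with n hn
          field_simp
        have h2 := tendsto_log_unitBallVolume (p := p.toReal) (by linarith) (m := id) h1
        have h3 : ballRate p = 1 * Real.log (2 * Real.Gamma (1 / p.toReal + 1)) -
            (1 / p.toReal * Real.log (1 / p.toReal) - 1 / p.toReal) := by
          have hΓ := Real.Gamma_pos_of_pos (show 0 < 1 + 1 / p.toReal by positivity)
          rw [ballRate, if_neg hp', pGaussianConst, Real.log_mul (by positivity) hΓ.ne',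
            Real.log_mul two_ne_zero (by positivity), Real.log_rpow h0, add_comm _ (1 : ℝ),
            Real.log_mul two_ne_zero hΓ.ne', one_div, Real.log_inv]
          ring
        rw [h3]
        refine h2.congr' ?_
        filter_upwards [eventually_gt_atTop 0] with n hn
        rw [Real.log_mul (by positivity) (unitBallVolume_pos (by linarith) n).ne',
          Real.log_rpow (by positivity)]
        simp only [id]
        ring
  filter_upwards [hlim.eventually_const_lt (show ballRate p - ε < ballRate p by linarith),
    hlim.eventually_lt_const (show ballRate p < ballRate p + ε by linarith),
    eventually_gt_atTop 0] with n h1 h2 hn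
  have hn' : (0 : ℝ) < n := by exact_mod_cast hn
  rw [hv n hn]
  rw [lt_div_iff₀ hn'] at h1
  rw [div_lt_iff₀ hn'] at h2
  constructor
  · refine ENNReal.ofReal_le_ofReal ?_
    rw [← Real.le_log_iff_exp_le (hv0 n hn)]
    linarith
  · refine ENNReal.ofReal_le_ofReal ?_
    rw [← Real.log_le_iff_le_exp (hv0 n hn)]
    linarith

/-- The Chernoff bound for products of the base measure. -/
theorem IsTiltable.pi_measure_le {ν : Measure ℝ} [SigmaFinite ν] {ψ : ℝ → ℝ}
    (h : IsTiltable ν ψ) {t s : ℝ} (hts : IsAdmissible ν ψ t s) (n : ℕ) (b : ℝ) :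
    Measure.pi (fun _ : Fin n ↦ ν) {y | b ≤ t * ∑ i, y i ^ 2 - s * ∑ i, ψ (y i)} ≤
      ENNReal.ofReal (Real.exp (n * Real.log (partitionFn ν ψ t s) - b)) := by
  have hm := h.measurable
  have hZ := h.partitionFn_pos hts
  have hg : Measurable fun y : Fin n → ℝ ↦
      ENNReal.ofReal (∏ i, Real.exp (t * y i ^ 2 - s * ψ (y i))) := by fun_prop
  have h1 := mul_meas_ge_le_lintegral (μ := Measure.pi fun _ : Fin n ↦ ν) hg
    (ENNReal.ofReal (Real.exp b))
  rw [← ofReal_integral_eq_lintegral_ofReal (Integrable.fintype_prod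
    (f := fun (_ : Fin n) x ↦ Real.exp (t * x ^ 2 - s * ψ x)) fun i ↦ hts)
    (.of_forall fun x ↦ Finset.prod_nonneg fun i _ ↦ (Real.exp_pos _).le),
    integral_fintype_prod_eq_prod (f := fun (_ : Fin n) x ↦ Real.exp (t * x ^ 2 - s * ψ x))] at h1
  have h2 : ∏ _i : Fin n, ∫ x, Real.exp (t * x ^ 2 - s * ψ x) ∂ν =
      Real.exp (n * Real.log (partitionFn ν ψ t s)) := by
    rw [Finset.prod_const, Finset.card_univ, Fintype.card_fin, ← Real.log_pow,
      Real.exp_log (by positivity)]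
    rfl
  have h3 : {y : Fin n → ℝ | b ≤ t * ∑ i, y i ^ 2 - s * ∑ i, ψ (y i)} =
      {y | ENNReal.ofReal (Real.exp b) ≤
        ENNReal.ofReal (∏ i, Real.exp (t * y i ^ 2 - s * ψ (y i)))} := by
    ext y
    simp only [Set.mem_ofPred_eq]
    rw [ENNReal.ofReal_le_ofReal_iff (Finset.prod_nonneg fun i _ ↦ (Real.exp_pos _).le),
      ← Real.exp_sum, Real.exp_le_exp, Finset.sum_sub_distrib, Finset.mul_sum, Finset.mul_sum]
  rw [h3, Real.exp_sub, ENNReal.ofReal_div_of_pos (Real.exp_pos b), ENNReal.le_div_iff_mul_le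
    (Or.inl (by simp [Real.exp_pos])) (Or.inl ENNReal.ofReal_ne_top), mul_comm, ← h2]
  exact h1

/-! ### Local large deviation estimates for the radial part -/

/-- The normalized Euclidean norm `n^{1/p-1/2} ‖x‖₂`. -/
noncomputable def normalizedNorm (p : ℝ≥0∞) {n : ℕ} (x : EuclideanSpace ℝ (Fin n)) : ℝ :=
  (n : ℝ) ^ ((p⁻¹).toReal - 1 / 2) * ‖x‖

/-- Chernoff's bound at a nearly optimal tilt. Its s may be negative, so the constraint sum must be
controlled from below too; this is the purpose of the condition that the p-norm be at least 1 - δ.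
-/
theorem lpBallUniform_le {p : ℝ≥0∞} (hp : 2 ≤ p) {q a : ℝ} (hq : 0 ≤ q)
    (h : (a : EReal) < rateJ p q) :
    ∃ V ∈ 𝓝 q, ∃ δ : ℝ, 0 < δ ∧ δ < 1 ∧ ∀ᶠ n : ℕ in atTop,
      lpBallUniform p n {x | 1 - δ ≤ pNorm p x ∧ normalizedNorm p x ∈ V} ≤
        ENNReal.ofReal (Real.exp (-(n * a))) := by
  obtain ⟨t, s, hst, hts, hlt⟩ := exists_tilt_of_lt_rateJ hp hq h
  set Z := partitionFn (baseMeasure p) (constraintFn p) t s with hZ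
  -- One γ each is spent on the neighbourhood of q, the width of the shell, and the volume of the
  -- ball.
  obtain ⟨γ, hγ, hγa⟩ : ∃ γ > 0, a + 3 * γ ≤ t * q ^ 2 - s - Real.log Z + ballRate p :=
    ⟨(t * q ^ 2 - s - Real.log Z + ballRate p - a) / 3, by linarith, by linarith⟩
  have hV : {v : ℝ | t * q ^ 2 - γ < t * v ^ 2} ∈ 𝓝 q := by
    have : Continuous fun v : ℝ ↦ t * v ^ 2 := by fun_prop
    exact this.continuousAt.eventually (lt_mem_nhds (by linarith))
  obtain ⟨δ, hδ0, hδ1, hδ⟩ : ∃ δ : ℝ, 0 < δ ∧ δ < 1 ∧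
      (p ≠ ∞ → |s| * (1 - (1 - δ) ^ p.toReal) ≤ γ) := by
    by_cases hp' : p = ∞
    · exact ⟨1 / 2, by norm_num, by norm_num, fun h ↦ (h hp').elim⟩
    have h0 : 0 < p.toReal := by linarith [two_le_toReal hp hp']
    have hc : Tendsto (fun δ : ℝ ↦ |s| * (1 - (1 - δ) ^ p.toReal)) (𝓝[>] 0) (𝓝 0) := by
      have h1 : Continuous fun δ : ℝ ↦ |s| * (1 - (1 - δ) ^ p.toReal) := by
        have := Real.continuous_rpow_const (q := p.toReal) h0.le
        fun_prop
      refine tendsto_nhdsWithin_of_tendsto_nhds ?_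
      convert h1.tendsto 0 using 2
      simp
    obtain ⟨δ, ⟨h1, h2⟩, h3⟩ := ((hc.eventually_le_const hγ).and
      (eventually_nhdsWithin_of_eventually_nhds (gt_mem_nhds one_pos)) |>.and
        self_mem_nhdsWithin).exists
    exact ⟨δ, h3, h2, fun _ ↦ h1⟩
  refine ⟨_, hV, δ, hδ0, hδ1, ?_⟩
  filter_upwards [eventually_basePi_constraintSet hp hγ, eventually_gt_atTop 0] with n hn hn0
  have hn' : (0 : ℝ) < n := by exact_mod_cast hn0
  rw [lpBallUniform_eq hp hn0]
  have hsub : constraintSet p n ∩ {y | scaledPoint p y ∈ {x : EuclideanSpace ℝ (Fin n) |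
      1 - δ ≤ pNorm p x ∧ normalizedNorm p x ∈ {v : ℝ | t * q ^ 2 - γ < t * v ^ 2}}} ⊆
      {y | n * (t * q ^ 2 - s - 2 * γ) ≤
        t * ∑ i, y i ^ 2 - s * ∑ i, constraintFn p (y i)} := by
    rintro y ⟨hy1, hy2, hy3⟩
    simp only [Set.mem_ofPred_eq] at hy3 ⊢
    rw [normalizedNorm, scaled_norm_scaledPoint p hn0,
      Real.sq_sqrt (div_nonneg (Finset.sum_nonneg fun i _ ↦ sq_nonneg _) hn'.le),
      mul_div_assoc', lt_div_iff₀ hn'] at hy3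
    have hs : s * ∑ i, constraintFn p (y i) ≤ n * (s + γ) := by
      by_cases hp' : p = ∞
      · rw [hst hp']; simp; positivity
      · have h0 : 0 < p.toReal := by linarith [two_le_toReal hp hp']
        simp only [constraintSet, constraintFn, hp', if_false, Set.mem_ofPred_eq] at hy1 ⊢
        have h1 : (1 - δ) ^ p.toReal ≤ (∑ i, |y i| ^ p.toReal) / n := by
          rw [← pNorm_scaledPoint_rpow hp hp']
          exact Real.rpow_le_rpow (by linarith) hy2 h0.le
        rw [le_div_iff₀ hn'] at h1
        have h2 : s * (∑ i, |y i| ^ p.toReal - n) ≤ |s| * (n - (1 - δ) ^ p.toReal * n) := by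
          refine (le_abs_self _).trans ?_
          rw [abs_mul]
          gcongr
          rw [abs_of_nonpos (by linarith)]
          linarith
        nlinarith [hδ hp']
    nlinarith
  have h1 := (measure_mono hsub).trans ((isTiltable_base hp).pi_measure_le hts n _)
  calc (basePi p n (constraintSet p n))⁻¹ * basePi p n _
      ≤ (ENNReal.ofReal (Real.exp (n * (ballRate p - γ))))⁻¹ *
        ENNReal.ofReal (Real.exp (n * Real.log Z - n * (t * q ^ 2 - s - 2 * γ))) :=
        mul_le_mul' (ENNReal.inv_le_inv.2 hn.1) h1
    _ = ENNReal.ofReal (Real.exp (-(n * (ballRate p - γ)) +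
        (n * Real.log Z - n * (t * q ^ 2 - s - 2 * γ)))) := by
        rw [← ENNReal.ofReal_inv_of_pos (Real.exp_pos _), ← Real.exp_neg,
          ← ENNReal.ofReal_mul (Real.exp_pos _).le, ← Real.exp_add]
    _ ≤ _ := by
        refine ENNReal.ofReal_le_ofReal (Real.exp_le_exp.2 ?_)
        nlinarith

open scoped Pointwise in
theorem lpBallUniform_smul_le (p : ℝ≥0∞) {n : ℕ} {r : ℝ} (hp : 2 ≤ p) (hr : 0 ≤ r)
    {A B : Set (EuclideanSpace ℝ (Fin n))} (h : lpBall p n ∩ A ⊆ r • (lpBall p n ∩ B)) :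
    lpBallUniform p n A ≤ ENNReal.ofReal (r ^ n) * lpBallUniform p n B := by
  rw [lpBallUniform, cond_apply (measurableSet_lpBall hp n),
    cond_apply (measurableSet_lpBall hp n), mul_left_comm]
  gcongr
  refine (measure_mono h).trans_eq ?_
  rw [Measure.addHaar_smul_of_nonneg _ hr, finrank_euclideanSpace_fin]

theorem normalizedNorm_smul (p : ℝ≥0∞) {n : ℕ} {r : ℝ} (hr : 0 ≤ r)
    (x : EuclideanSpace ℝ (Fin n)) : normalizedNorm p (r • x) = r * normalizedNorm p x := by
  rw [normalizedNorm, normalizedNorm, norm_smul, Real.norm_eq_abs, abs_of_nonneg hr]; ring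

-- Dividing by r maps the shell of radius r into the shell of radius 1; the factor r^n is the source
-- of the cost -log r.
open scoped Pointwise in
theorem lpBallUniform_scaled_le {p : ℝ≥0∞} (hp : 2 ≤ p) (n : ℕ) {r δ : ℝ} (hr : 0 < r)
    (V : Set ℝ) :
    lpBallUniform p n {x | (1 - δ) * r ≤ pNorm p x ∧ pNorm p x ≤ r ∧
        normalizedNorm p x / r ∈ V} ≤
      ENNReal.ofReal (r ^ n) *
        lpBallUniform p n {x | 1 - δ ≤ pNorm p x ∧ normalizedNorm p x ∈ V} := by
  refine lpBallUniform_smul_le p hp hr.le ?_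
  rintro x ⟨-, h1, h2, h3⟩
  refine Set.mem_smul_set.2 ⟨r⁻¹ • x, ⟨?_, ?_, ?_⟩, smul_inv_smul₀ hr.ne' x⟩
  · rw [mem_lpBall, pNorm_smul hp, abs_of_pos (by positivity), inv_mul_le_one₀ hr]
    exact h2
  · rw [pNorm_smul hp, abs_of_pos (by positivity), le_inv_mul_iff₀ hr]
    linarith
  · rwa [normalizedNorm_smul p (by positivity), inv_mul_eq_div]

theorem isProbabilityMeasure_lpBallUniform {p : ℝ≥0∞} (hp : 2 ≤ p) {n : ℕ} :
    IsProbabilityMeasure (lpBallUniform p n) := by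
  have : Fact (1 ≤ p) := ⟨le_trans (by norm_num) hp⟩
  refine cond_isProbabilityMeasure_of_finite ?_ ?_
  · have hopen : IsOpen {x : EuclideanSpace ℝ (Fin n) | pNorm p x < 1} :=
      isOpen_lt (continuous_pNorm hp n) continuous_const
    have h0 : (0 : EuclideanSpace ℝ (Fin n)) ∈ {x | pNorm p x < 1} := by
      have := pNorm_smul hp (0 : ℝ) (0 : EuclideanSpace ℝ (Fin n))
      simp only [zero_smul, abs_zero, zero_mul] at this
      simp [this]
    have := (hopen.measure_pos volume ⟨0, h0⟩).trans_le
      (measure_mono (t := lpBall p n) fun x (hx : pNorm p x < 1) ↦ mem_lpBall.2 hx.le)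
    exact this.ne'
  · have h1 : lpBall p n = (fun x : EuclideanSpace ℝ (Fin n) ↦
        (WithLp.toLp p (WithLp.ofLp x) : PiLp p fun _ : Fin n ↦ ℝ)) ⁻¹' Metric.closedBall 0 1 := by
      ext x
      simp only [Set.mem_preimage, mem_closedBall_zero_iff]
      rfl
    have h2 : IsCompact (lpBall p n) := by
      let e : EuclideanSpace ℝ (Fin n) ≃ₜ PiLp p fun _ : Fin n ↦ ℝ :=
        ((PiLp.continuousLinearEquiv 2 ℝ fun _ : Fin n ↦ ℝ).trans
          (PiLp.continuousLinearEquiv p ℝ fun _ : Fin n ↦ ℝ).symm).toHomeomorph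
      rw [h1]
      exact e.isCompact_preimage.2 (isCompact_closedBall 0 1)
    exact h2.measure_ne_top

open scoped Pointwise in
theorem lpBallUniform_pNorm_le {p : ℝ≥0∞} (hp : 2 ≤ p) (n : ℕ) {r : ℝ} (hr : 0 < r) :
    lpBallUniform p n {x | pNorm p x ≤ r} ≤ ENNReal.ofReal (r ^ n) := by
  have := isProbabilityMeasure_lpBallUniform hp (n := n)
  refine (lpBallUniform_smul_le p (B := Set.univ) hp hr.le ?_).trans (by simp)
  rintro x ⟨-, h1⟩
  refine Set.mem_smul_set.2 ⟨r⁻¹ • x, ⟨?_, trivial⟩, smul_inv_smul₀ hr.ne' x⟩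
  rw [mem_lpBall, pNorm_smul hp, abs_of_pos (by positivity), inv_mul_le_one₀ hr]
  exact h1

-- The tilted estimate produces points that violate the constraint by a factor 1 + δ at most. A
-- contraction by (1 + δ)^{-1/p} brings them back into the ball, at a cost of at most exp(-nε) in
-- volume.
open scoped Pointwise in
theorem le_lpBallUniform {p : ℝ≥0∞} (hp : 2 ≤ p) {x a : ℝ} (hx : 0 ≤ x) (h : rateJ p x < a)
    {V : Set ℝ} (hV : V ∈ 𝓝 x) :
    ∀ᶠ n : ℕ in atTop, ENNReal.ofReal (Real.exp (-(n * a))) ≤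
      lpBallUniform p n {x | normalizedNorm p x ∈ V} := by
  obtain ⟨a', ha', haa'⟩ := EReal.lt_iff_exists_real_btwn.1 h
  rw [EReal.coe_lt_coe_iff] at haa'
  obtain ⟨hx0, hx1, hD⟩ := dualBound_of_rateJ_lt hp hx ha'
  -- The four ε pay for moving x to q, for the tilted estimate, for the contraction, and for the
  -- volume of the ball.
  obtain ⟨ε, hε, hεa⟩ : ∃ ε > 0, a' + 4 * ε ≤ a := ⟨(a - a') / 4, by linarith, by linarith⟩
  obtain ⟨W, hWV, hWo, hxW⟩ := mem_nhds_iff.1 hV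
  obtain ⟨q, hqW, hq0, hq1, hDq⟩ := (isTiltable_base hp).exists_dualBound_lt hx0 hx1 hD
    (show a' - ballRate p < a' - ballRate p + ε by linarith) (hWo.mem_nhds hxW)
  have hqV : V ∈ 𝓝 q := mem_of_superset (hWo.mem_nhds hqW) hWV
  -- For p = ∞ the exponent is 2/0 = 0 by convention, so the factor is 1, in accordance with the
  -- absence of a contraction.
  obtain ⟨δ, hδ0, hδε, hδV⟩ : ∃ δ : ℝ, 0 < δ ∧ δ ≤ ε ∧ ∀ u : ℝ, |u - q ^ 2| < δ →
      √((1 + δ)⁻¹ ^ (2 / p.toReal) * u) ∈ V := by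
    have h1 : ContinuousAt (fun z : ℝ × ℝ ↦ √((1 + z.1)⁻¹ ^ (2 / p.toReal) * z.2)) (0, q ^ 2) := by
      have : ContinuousAt (fun z : ℝ × ℝ ↦ (1 + z.1)⁻¹) (0, q ^ 2) :=
        ContinuousAt.inv₀ (by fun_prop) (by simp)
      have h2 : ContinuousAt (fun z : ℝ × ℝ ↦ (1 + z.1)⁻¹ ^ (2 / p.toReal)) (0, q ^ 2) :=
        this.rpow_const (Or.inr (by positivity))
      fun_prop
    have h2 := h1.preimage_mem_nhds (t := V) (by simpa [Real.sqrt_sq hq0.le] using hqV)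
    obtain ⟨η, hη, hηV⟩ := Metric.mem_nhds_iff.1 h2
    refine ⟨min (η / 2) ε, by positivity, min_le_right _ _, fun u hu ↦ ?_⟩
    refine hηV (?_ : (_, u) ∈ _)
    rw [Metric.mem_ball, Prod.dist_eq, max_lt_iff]
    simp only [Real.dist_eq, sub_zero]
    have hm : min (η / 2) ε ≤ η / 2 := min_le_left _ _
    have hm0 : 0 < min (η / 2) ε := by positivity
    exact ⟨by rw [abs_of_pos hm0]; linarith, by linarith⟩
  filter_upwards [(isTiltable_base hp).eventually_le_pi_measure hq0 hq1 hDq hε hδ0,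
    eventually_basePi_constraintSet hp hε, eventually_gt_atTop 0] with n hn hn2 hn0
  have hn' : (0 : ℝ) < n := by exact_mod_cast hn0
  rw [lpBallUniform_eq hp hn0]
  set A : Set (Fin n → ℝ) := {x | |∑ i, x i ^ 2 - n * q ^ 2| < n * δ ∧
    ∑ i, constraintFn p (x i) < n * (1 + δ)} with hA
  set T := constraintSet p n ∩ {y | scaledPoint p y ∈
    {x : EuclideanSpace ℝ (Fin n) | normalizedNorm p x ∈ V}} with hT
  have hAq : ∀ y ∈ A, |(∑ i, y i ^ 2) / n - q ^ 2| < δ := by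
    intro y hy
    have e : (∑ i, y i ^ 2) / n - q ^ 2 = (∑ i, y i ^ 2 - n * q ^ 2) / n := by field_simp
    rw [e, abs_div, abs_of_pos hn', div_lt_iff₀ hn', mul_comm δ]
    exact hy.1
  have hAT : ENNReal.ofReal (Real.exp (-(n * ε))) * basePi p n A ≤ basePi p n T := by
    by_cases hp' : p = ∞
    · have h1 : A ⊆ T := by
        intro y hy
        refine ⟨?_, ?_⟩
        · simp [constraintSet, constraintFn, hp']
        · change normalizedNorm p (scaledPoint p y) ∈ V
          rw [normalizedNorm, scaled_norm_scaledPoint p hn0]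
          have := hδV _ (hAq y hy)
          simpa [hp'] using this
      calc _ ≤ 1 * basePi p n A := by
            gcongr
            rw [ENNReal.ofReal_le_one, Real.exp_le_one_iff]
            have : 0 < n * ε := by positivity
            linarith
        _ ≤ _ := by rw [one_mul]; exact measure_mono h1
    · have h0 : 0 < p.toReal := by linarith [two_le_toReal hp hp']
      have hp2 := two_le_toReal hp hp'
      have h1δ : 0 < 1 + δ := by linarith
      set l : ℝ := (1 + δ)⁻¹ ^ (1 / p.toReal) with hl
      have hl0 : 0 < l := by positivity
      have hlp : l ^ p.toReal = (1 + δ)⁻¹ := by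
        rw [hl, ← Real.rpow_mul (by positivity), one_div_mul_cancel h0.ne', Real.rpow_one]
      have hl2 : l ^ 2 = (1 + δ)⁻¹ ^ (2 / p.toReal) := by
        rw [hl, ← Real.rpow_natCast, ← Real.rpow_mul (by positivity)]
        congr 1; push_cast; ring
      have h1 : l • A ⊆ T := by
        rintro _ ⟨y, hy, rfl⟩
        refine ⟨?_, ?_⟩
        · have h2 := hy.2
          simp only [constraintFn, hp', if_false] at h2
          simp only [constraintSet, constraintFn, hp', if_false, Set.mem_ofPred_eq,
            Pi.smul_apply, smul_eq_mul, abs_mul, abs_of_pos hl0]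
          simp only [Real.mul_rpow hl0.le (abs_nonneg _), ← Finset.mul_sum, hlp]
          rw [inv_mul_le_iff₀ h1δ]
          linarith
        · change normalizedNorm p (scaledPoint p (l • y)) ∈ V
          rw [normalizedNorm, scaled_norm_scaledPoint p hn0]
          have := hδV _ (hAq y hy)
          rw [← hl2] at this
          simp only [Pi.smul_apply, smul_eq_mul, mul_pow, ← Finset.mul_sum]
          rwa [mul_div_assoc]
      have h2 : basePi p n (l • A) = ENNReal.ofReal (l ^ n) * basePi p n A := by
        rw [basePi_apply_of_ne_top hp', Measure.addHaar_smul_of_nonneg _ hl0.le,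
          Module.finrank_fin_fun]
      refine le_trans ?_ ((h2 ▸ measure_mono h1 :))
      gcongr
      have h3 : -ε ≤ Real.log l := by
        rw [hl, Real.log_rpow (by positivity), Real.log_inv]
        have h4 : Real.log (1 + δ) ≤ δ := by
          have := Real.log_le_sub_one_of_pos h1δ; linarith
        have h5 : 0 ≤ Real.log (1 + δ) := Real.log_nonneg (by linarith)
        have h6 : 1 / p.toReal ≤ 1 := by rw [div_le_one h0]; linarith
        have h7 : 0 < 1 / p.toReal := by positivity
        nlinarith
      rw [← Real.exp_log (show 0 < l ^ n by positivity), Real.log_pow]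
      refine Real.exp_le_exp.2 ?_
      nlinarith
  calc ENNReal.ofReal (Real.exp (-(n * a)))
      ≤ ENNReal.ofReal (Real.exp (-(n * (ballRate p + ε)) + (-(n * ε) +
          -(n * (a' - ballRate p + ε + ε))))) := by
        refine ENNReal.ofReal_le_ofReal (Real.exp_le_exp.2 ?_)
        nlinarith
    _ = (ENNReal.ofReal (Real.exp (n * (ballRate p + ε))))⁻¹ *
        (ENNReal.ofReal (Real.exp (-(n * ε))) *
          ENNReal.ofReal (Real.exp (-(n * (a' - ballRate p + ε + ε))))) := by
        rw [← ENNReal.ofReal_inv_of_pos (Real.exp_pos _), ← Real.exp_neg,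
          ← ENNReal.ofReal_mul (Real.exp_pos _).le, ← ENNReal.ofReal_mul (Real.exp_pos _).le,
          ← Real.exp_add, ← Real.exp_add]
    _ ≤ (basePi p n (constraintSet p n))⁻¹ * basePi p n T :=
        mul_le_mul' (ENNReal.inv_le_inv.2 hn2.2) (le_trans (by gcongr) hAT)

/-! ### Projections of the uniform distribution on the Euclidean ball -/

theorem EReal.exists_real_lt_add {a : ℝ} {x y : EReal} (hx : x ≠ ⊥) (hy : y ≠ ⊥)
    (h : (a : EReal) < x + y) : ∃ b c : ℝ, (b : EReal) < x ∧ (c : EReal) < y ∧ a < b + c := by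
  induction x with
  | bot => exact (hx rfl).elim
  | top =>
    obtain ⟨c, hc⟩ := EReal.lt_iff_exists_real_btwn.1 (bot_lt_iff_ne_bot.2 hy)
    exact ⟨a - c + 1, c, EReal.coe_lt_top _, hc.2, by linarith⟩
  | coe x =>
    induction y with
    | bot => exact (hy rfl).elim
    | top => exact ⟨x - 1, a - x + 2, by exact_mod_cast (by linarith), EReal.coe_lt_top _, by linarith⟩
    | coe y =>
      have h' : a < x + y := by exact_mod_cast h
      exact ⟨x - (x + y - a) / 3, y - (x + y - a) / 3, by exact_mod_cast (by linarith),
        by exact_mod_cast (by linarith), by linarith⟩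

/-- Excluding ⊥ matters: ⊥ + ⊤ = ⊥ is below every real number, whereas no real number exceeds ⊤. -/
theorem EReal.exists_real_gt_add {a : ℝ} {x y : EReal} (hx : x ≠ ⊥) (hy : y ≠ ⊥)
    (h : x + y < (a : EReal)) : ∃ b c : ℝ, x < (b : EReal) ∧ y < (c : EReal) ∧ b + c < a := by
  induction x with
  | bot => exact (hx rfl).elim
  | top => rw [EReal.top_add_of_ne_bot hy] at h; simp at h
  | coe x =>
    induction y with
    | bot => exact (hy rfl).elim
    | top => simp at h
    | coe y =>
      have h' : x + y < a := by exact_mod_cast h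
      exact ⟨x + (a - x - y) / 3, y + (a - x - y) / 3, by exact_mod_cast (by linarith),
        by exact_mod_cast (by linarith), by linarith⟩

/-- The sum of the squares of the first `k` coordinates. -/
noncomputable def headSq (k : ℕ) {n : ℕ} (y : Fin n → ℝ) : ℝ :=
  ∑ i : {i : Fin n // (i : ℕ) < k}, y i ^ 2

/-- The sum of the squares of the remaining coordinates. -/
noncomputable def tailSq (k : ℕ) {n : ℕ} (y : Fin n → ℝ) : ℝ :=
  ∑ i : {i : Fin n // ¬(i : ℕ) < k}, y i ^ 2

theorem headSq_add_tailSq (k : ℕ) {n : ℕ} (y : Fin n → ℝ) :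
    headSq k y + tailSq k y = ∑ i, y i ^ 2 :=
  Fintype.sum_subtype_add_sum_subtype (fun i : Fin n ↦ (i : ℕ) < k) fun i ↦ y i ^ 2

theorem headSq_nonneg (k : ℕ) {n : ℕ} (y : Fin n → ℝ) : 0 ≤ headSq k y :=
  Finset.sum_nonneg fun _ _ ↦ sq_nonneg _

theorem tailSq_nonneg (k : ℕ) {n : ℕ} (y : Fin n → ℝ) : 0 ≤ tailSq k y :=
  Finset.sum_nonneg fun _ _ ↦ sq_nonneg _

theorem volume_head_tail (k n : ℕ) (A B : Set ℝ) :
    volume {y : Fin n → ℝ | headSq k y ∈ A ∧ tailSq k y ∈ B} =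
      volume {u : {i : Fin n // (i : ℕ) < k} → ℝ | ∑ i, u i ^ 2 ∈ A} *
        volume {v : {i : Fin n // ¬(i : ℕ) < k} → ℝ | ∑ i, v i ^ 2 ∈ B} := by
  have h := (volume_preserving_piEquivPiSubtypeProd (fun _ : Fin n ↦ ℝ)
    fun i : Fin n ↦ (i : ℕ) < k).measure_preimage_equiv
    ({u | ∑ i, u i ^ 2 ∈ A} ×ˢ {v | ∑ i, v i ^ 2 ∈ B})
  rw [Measure.volume_eq_prod, Measure.prod_prod] at h
  exact h

theorem card_head {n k : ℕ} (hk : k ≤ n) : Fintype.card {i : Fin n // (i : ℕ) < k} = k := by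
  rw [Fintype.card_subtype, Fin.card_filter_val_lt, min_eq_right hk]

theorem card_tail {n k : ℕ} (hk : k ≤ n) :
    Fintype.card {i : Fin n // ¬(i : ℕ) < k} = n - k := by
  rw [Fintype.card_subtype_compl, card_head hk, Fintype.card_fin]

theorem volume_sum_sq_le {ι : Type*} [Fintype ι] [Nonempty ι] {α : ℝ} {n : ℝ} (hn : 0 ≤ n)
    (hα : 0 ≤ α) :
    volume {x : ι → ℝ | ∑ i, x i ^ 2 ∈ Set.Iic (n * α ^ 2)} =
      ENNReal.ofReal (n ^ ((Fintype.card ι : ℝ) / 2) * α ^ Fintype.card ι *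
        unitBallVolume 2 (Fintype.card ι)) := by
  have h := volume_sum_abs_rpow_le (ι := ι) (p := 2) (by norm_num) (r := n * α ^ 2) (by positivity)
  have e : (n * α ^ 2) ^ ((Fintype.card ι : ℝ) / 2) =
      n ^ ((Fintype.card ι : ℝ) / 2) * α ^ Fintype.card ι := by
    rw [Real.mul_rpow hn (by positivity), ← Real.rpow_natCast α 2, ← Real.rpow_mul hα,
      ← Real.rpow_natCast α]
    congr 2; push_cast; ring
  rw [e] at h
  rw [← h]
  simp

/-- The removed inner ball has proportion (1-η)^d ≤ 1-η in every dimension d ≥ 1. The lower bound is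
uniform in the dimension, so passing from balls to shells costs nothing exponentially. -/
theorem volume_annulus {ι : Type*} [Fintype ι] [Nonempty ι] {α η : ℝ} {n : ℝ} (hn : 0 ≤ n)
    (hα : 0 ≤ α) (hη0 : 0 ≤ η) (hη1 : η ≤ 1) :
    ENNReal.ofReal η * volume {x : ι → ℝ | ∑ i, x i ^ 2 ∈ Set.Iic (n * α ^ 2)} ≤
      volume {x : ι → ℝ | ∑ i, x i ^ 2 ∈ Set.Ioc (n * ((1 - η) * α) ^ 2) (n * α ^ 2)} := by
  have hsub : {x : ι → ℝ | ∑ i, x i ^ 2 ∈ Set.Iic (n * α ^ 2)} \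
      {x : ι → ℝ | ∑ i, x i ^ 2 ∈ Set.Iic (n * ((1 - η) * α) ^ 2)} ⊆
      {x : ι → ℝ | ∑ i, x i ^ 2 ∈ Set.Ioc (n * ((1 - η) * α) ^ 2) (n * α ^ 2)} := by
    rintro x ⟨h1, h2⟩
    exact ⟨not_le.1 h2, h1⟩
  refine le_trans ?_ (measure_mono hsub)
  refine le_trans ?_ le_measure_sdiff
  have h1η : 0 ≤ 1 - η := by linarith
  rw [volume_sum_sq_le hn hα, volume_sum_sq_le hn (mul_nonneg h1η hα),
    ← ENNReal.ofReal_mul hη0]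
  have hv := unitBallVolume_pos (p := 2) (by norm_num) (Fintype.card ι)
  rw [← ENNReal.ofReal_sub _ (by positivity)]
  refine ENNReal.ofReal_le_ofReal ?_
  have h1 : (1 - η) ^ Fintype.card ι ≤ 1 - η :=
    pow_le_of_le_one h1η (by linarith) Fintype.card_ne_zero
  set X := n ^ ((Fintype.card ι : ℝ) / 2) * α ^ Fintype.card ι *
    unitBallVolume 2 (Fintype.card ι) with hX
  have hX0 : 0 ≤ X := by positivity
  have e : n ^ ((Fintype.card ι : ℝ) / 2) * ((1 - η) * α) ^ Fintype.card ι *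
    unitBallVolume 2 (Fintype.card ι) = (1 - η) ^ Fintype.card ι * X := by
    rw [mul_pow, hX]; ring
  rw [e]
  nlinarith

/-- The exponential rate of a product of two balls of radii `α` and `β`. -/
noncomputable def splitRate (lam α β : ℝ) : ℝ :=
  lam / 2 * Real.log lam + (1 - lam) / 2 * Real.log (1 - lam) - lam * Real.log α -
    (1 - lam) * Real.log β

/-- The normalized volume of a product of two balls. -/
noncomputable def splitVolume (k n : ℕ) (α β : ℝ) : ℝ≥0∞ :=
  (basePi 2 n (constraintSet 2 n))⁻¹ *
    volume {y : Fin n → ℝ | headSq k y ∈ Set.Iic (n * α ^ 2) ∧ tailSq k y ∈ Set.Iic (n * β ^ 2)}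

/-- Stirling for both balls; the terms with log n cancel against the radii √n α and √n β. The limits
λ = 0 and λ = 1 are included, as κ log κ is continuous at 0. -/
theorem eventually_splitVolume {k : ℕ → ℕ} (hk : ∀ n, 2 ≤ n → 1 ≤ k n ∧ k n ≤ n - 1) {lam : ℝ}
    (hlam : Tendsto (fun n : ℕ ↦ (k n : ℝ) / n) atTop (𝓝 lam)) {α β ε : ℝ} (hα : 0 < α)
    (hβ : 0 < β) (hε : 0 < ε) :
    ∀ᶠ n : ℕ in atTop,
      ENNReal.ofReal (Real.exp (-(n * (splitRate lam α β + ε)))) ≤ splitVolume (k n) n α β ∧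
      splitVolume (k n) n α β ≤ ENNReal.ofReal (Real.exp (-(n * (splitRate lam α β - ε)))) := by
  have hlam' : Tendsto (fun n : ℕ ↦ ((n - k n : ℕ) : ℝ) / n) atTop (𝓝 (1 - lam)) := by
    refine (hlam.const_sub 1).congr' ?_
    filter_upwards [eventually_ge_atTop 2] with n hn
    have hn' : (n : ℝ) ≠ 0 := by positivity
    rw [Nat.cast_sub (by have := hk n hn; omega)]
    field_simp
  set h : ℝ → ℝ := fun κ ↦ κ * Real.log (2 * Real.Gamma (1 / 2 + 1)) -
    (κ / 2 * Real.log (κ / 2) - κ / 2) with hh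
  have h1 := tendsto_log_unitBallVolume (p := 2) (by norm_num) hlam
  have h2 := tendsto_log_unitBallVolume (p := 2) (by norm_num) hlam'
  have hlogκ : ∀ κ : ℝ, κ / 2 * Real.log (κ / 2) = κ / 2 * Real.log κ - κ / 2 * Real.log 2 := by
    intro κ
    by_cases hκ : κ = 0
    · simp [hκ]
    · rw [Real.log_div hκ two_ne_zero]; ring
  have hball : ballRate 2 = h 1 := by
    have hΓ := Real.Gamma_pos_of_pos (show (0 : ℝ) < 1 + 1 / 2 by norm_num)
    rw [ballRate, if_neg (by simp), ENNReal.toReal_ofNat, pGaussianConst,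
      Real.log_mul (by positivity) hΓ.ne', Real.log_mul two_ne_zero (by positivity),
      Real.log_rpow two_pos, hh]
    simp only
    rw [add_comm (1 / 2 : ℝ) 1, Real.log_mul two_ne_zero hΓ.ne', one_div, Real.log_inv]
    ring
  have hrate : -splitRate lam α β + ballRate 2 =
      h lam + h (1 - lam) + lam * Real.log α + (1 - lam) * Real.log β := by
    rw [hball, splitRate]
    simp only [hh, hlogκ, Real.log_one]
    ring
  have hlim := (((h1.add h2).add (hlam.mul_const (Real.log α))).add
    (hlam'.mul_const (Real.log β)))
  rw [show (lam * Real.log (2 * Real.Gamma (1 / 2 + 1)) - (lam / 2 * Real.log (lam / 2) - lam / 2) +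
    ((1 - lam) * Real.log (2 * Real.Gamma (1 / 2 + 1)) -
      ((1 - lam) / 2 * Real.log ((1 - lam) / 2) - (1 - lam) / 2)) + lam * Real.log α +
        (1 - lam) * Real.log β) = -splitRate lam α β + ballRate 2 by rw [hrate]] at hlim
  have hε2 : 0 < ε / 2 := by linarith
  filter_upwards [eventually_basePi_constraintSet (p := 2) le_rfl hε2, eventually_ge_atTop 2,
    hlim.eventually_const_lt (show -splitRate lam α β + ballRate 2 - ε / 2 < _ by linarith),
    hlim.eventually_lt_const (show _ < -splitRate lam α β + ballRate 2 + ε / 2 by linarith)]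
    with n hn hn2 hlow hup
  obtain ⟨hk1, hk2⟩ := hk n hn2
  have hn' : (0 : ℝ) < n := by positivity
  have : Nonempty {i : Fin n // (i : ℕ) < k n} := ⟨⟨⟨0, by omega⟩, hk1⟩⟩
  have : Nonempty {i : Fin n // ¬(i : ℕ) < k n} := ⟨⟨⟨n - 1, by omega⟩, by simpa using hk2⟩⟩
  have hv1 := unitBallVolume_pos (p := 2) (by norm_num) (k n)
  have hv2 := unitBallVolume_pos (p := 2) (by norm_num) (n - k n)
  set X : ℝ := ((n : ℝ) ^ ((k n : ℝ) / 2) * α ^ k n * unitBallVolume 2 (k n)) *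
    ((n : ℝ) ^ (((n - k n : ℕ) : ℝ) / 2) * β ^ (n - k n) * unitBallVolume 2 (n - k n)) with hX
  have hX0 : 0 < X := by positivity
  have hvol : volume {y : Fin n → ℝ | headSq (k n) y ∈ Set.Iic (n * α ^ 2) ∧
      tailSq (k n) y ∈ Set.Iic (n * β ^ 2)} = ENNReal.ofReal X := by
    rw [volume_head_tail, volume_sum_sq_le hn'.le hα.le, volume_sum_sq_le hn'.le hβ.le,
      card_head (by omega), card_tail (by omega), ← ENNReal.ofReal_mul (by positivity)]
  have hlogX : Real.log X = ((Real.log (unitBallVolume 2 (k n)) + k n / 2 * Real.log n) / n +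
      (Real.log (unitBallVolume 2 (n - k n)) + (n - k n : ℕ) / 2 * Real.log n) / n +
      k n / n * Real.log α + (n - k n : ℕ) / n * Real.log β) * n := by
    rw [hX, Real.log_mul (by positivity) (by positivity), Real.log_mul (by positivity) hv1.ne',
      Real.log_mul (by positivity) hv2.ne', Real.log_mul (by positivity) (by positivity),
      Real.log_mul (by positivity) (by positivity), Real.log_rpow hn', Real.log_rpow hn',
      Real.log_pow, Real.log_pow]
    field_simp
    ring
  rw [splitVolume, hvol]
  constructor
  · calc ENNReal.ofReal (Real.exp (-(n * (splitRate lam α β + ε))))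
        ≤ ENNReal.ofReal (Real.exp (-(n * (ballRate 2 + ε / 2)) + Real.log X)) := by
          refine ENNReal.ofReal_le_ofReal (Real.exp_le_exp.2 ?_)
          rw [hlogX]
          nlinarith
      _ = (ENNReal.ofReal (Real.exp (n * (ballRate 2 + ε / 2))))⁻¹ * ENNReal.ofReal X := by
          rw [← ENNReal.ofReal_inv_of_pos (Real.exp_pos _), ← Real.exp_neg,
            ← ENNReal.ofReal_mul (Real.exp_pos _).le, Real.exp_add, Real.exp_log hX0]
      _ ≤ _ := by gcongr; exact hn.2
  · calc _ ≤ (ENNReal.ofReal (Real.exp (n * (ballRate 2 - ε / 2))))⁻¹ * ENNReal.ofReal X := by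
          gcongr; exact hn.1
      _ = ENNReal.ofReal (Real.exp (-(n * (ballRate 2 - ε / 2)) + Real.log X)) := by
          rw [← ENNReal.ofReal_inv_of_pos (Real.exp_pos _), ← Real.exp_neg,
            ← ENNReal.ofReal_mul (Real.exp_pos _).le, Real.exp_add, Real.exp_log hX0]
      _ ≤ _ := by
          refine ENNReal.ofReal_le_ofReal (Real.exp_le_exp.2 ?_)
          rw [hlogX]
          nlinarith

/-- The ratio of the norm of the first `k` coordinates to the Euclidean norm. -/
noncomputable def headRatio (k : ℕ) {n : ℕ} (y : Fin n → ℝ) : ℝ :=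
  √(headSq k y / ∑ i, y i ^ 2)

open Classical in
/-- The rate function of `headRatio`. -/
noncomputable def betaRate (lam r : ℝ) : EReal :=
  (if lam = 0 then 0 else if r = 0 then ⊤ else ((lam / 2 * Real.log (lam / r ^ 2) : ℝ) : EReal)) +
  (if lam = 1 then 0 else if r = 1 then ⊤ else
    (((1 - lam) / 2 * Real.log ((1 - lam) / (1 - r ^ 2)) : ℝ) : EReal))

theorem headRatio_sq_mul (k : ℕ) {n : ℕ} (y : Fin n → ℝ) :
    headRatio k y ^ 2 * ∑ i, y i ^ 2 = headSq k y := by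
  have h1 := headSq_add_tailSq k y
  have h2 := headSq_nonneg k y
  have h3 := tailSq_nonneg k y
  have h4 : 0 ≤ ∑ i, y i ^ 2 := by linarith
  rw [headRatio, Real.sq_sqrt (by positivity)]
  by_cases h : ∑ i, y i ^ 2 = 0
  · rw [h]; linarith
  · field_simp

theorem headRatio_nonneg (k : ℕ) {n : ℕ} (y : Fin n → ℝ) : 0 ≤ headRatio k y := Real.sqrt_nonneg _

theorem headRatio_le_one (k : ℕ) {n : ℕ} (y : Fin n → ℝ) : headRatio k y ≤ 1 := by
  have h1 := headSq_add_tailSq k y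
  have h2 := headSq_nonneg k y
  have h3 := tailSq_nonneg k y
  rw [headRatio, Real.sqrt_le_iff, one_pow]
  exact ⟨zero_le_one, div_le_one_of_le₀ (by linarith) (by linarith)⟩

theorem headRatio_smul (k : ℕ) {n : ℕ} {c : ℝ} (hc : c ≠ 0) (y : Fin n → ℝ) :
    headRatio k (c • y) = headRatio k y := by
  simp only [headRatio, headSq, Pi.smul_apply, smul_eq_mul, mul_pow, ← Finset.mul_sum]
  rw [mul_div_mul_left _ _ (by positivity)]

theorem lpBallUniform_two_headRatio (k : ℕ) {n : ℕ} (hn : 0 < n) (V : Set ℝ) :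
    lpBallUniform 2 n {x | headRatio k (WithLp.ofLp x) ∈ V} =
      (basePi 2 n (constraintSet 2 n))⁻¹ *
        volume {y : Fin n → ℝ | ∑ i, y i ^ 2 ≤ n ∧ headRatio k y ∈ V} := by
  rw [lpBallUniform_eq le_rfl hn, basePi_apply_of_ne_top (by simp)]
  congr 2
  ext y
  have hc : (n : ℝ) ^ (-((2 : ℝ≥0∞)⁻¹).toReal) ≠ 0 := by positivity
  have h1 : headRatio k (WithLp.ofLp (scaledPoint 2 y)) = headRatio k y :=
    headRatio_smul k hc y
  simp [h1, constraintSet, constraintFn]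

/-- If the ratio is within δ of r, the head lies in a ball of radius √n (r + δ) and the tail in one
of radius √n √(1 - (r - δ)²). The rate of this product tends to `betaRate` as δ decreases to 0,
diverging where the latter is infinite. -/
theorem lpBallUniform_headRatio_le {k : ℕ → ℕ} (hk : ∀ n, 2 ≤ n → 1 ≤ k n ∧ k n ≤ n - 1) {lam : ℝ}
    (hlam : Tendsto (fun n : ℕ ↦ (k n : ℝ) / n) atTop (𝓝 lam)) {r a : ℝ} (hr0 : 0 ≤ r)
    (hr1 : r ≤ 1) (h : (a : EReal) < betaRate lam r) :
    ∃ V ∈ 𝓝 r, ∀ᶠ n : ℕ in atTop,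
      lpBallUniform 2 n {x | headRatio (k n) (WithLp.ofLp x) ∈ V} ≤
        ENNReal.ofReal (Real.exp (-(n * a))) := by
  obtain ⟨b, c, hb, hc, habc⟩ := EReal.exists_real_lt_add
    (by split_ifs <;> first | exact EReal.coe_ne_bot _ | simp)
    (by split_ifs <;> first | exact EReal.coe_ne_bot _ | simp) h
  have hb' : ∀ᶠ δ in 𝓝[>] (0 : ℝ), b < lam / 2 * Real.log lam - lam * Real.log (r + δ) := by
    by_cases h0 : lam = 0
    · have hb0 : b < 0 := by simpa [h0] using hb
      exact .of_forall fun δ ↦ by simpa [h0] using hb0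
    rcases hr0.eq_or_lt with rfl | hr0
    · have hpos : 0 < lam := lt_of_le_of_ne (ge_of_tendsto' hlam fun n ↦ by positivity) (Ne.symm h0)
      have h1 : Tendsto (fun δ : ℝ ↦ lam / 2 * Real.log lam + lam * -Real.log (0 + δ)) (𝓝[>] 0)
          atTop := by
        refine tendsto_atTop_add_const_left _ _ (Tendsto.const_mul_atTop hpos ?_)
        simp only [zero_add]
        exact tendsto_neg_atBot_atTop.comp Real.tendsto_log_nhdsGT_zero
      filter_upwards [h1.eventually_gt_atTop b] with δ hδ
      linarith
    · have h1 : ContinuousAt (fun δ : ℝ ↦ lam / 2 * Real.log lam - lam * Real.log (r + δ)) 0 := by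
        have : ContinuousAt (fun δ : ℝ ↦ Real.log (r + δ)) 0 :=
          ContinuousAt.log (by fun_prop) (by simp [hr0.ne'])
        fun_prop
      refine nhdsWithin_le_nhds (h1.eventually (lt_mem_nhds ?_))
      simp only [h0, hr0.ne', if_false] at hb
      rw [EReal.coe_lt_coe_iff, Real.log_div h0 (by positivity), Real.log_pow] at hb
      simp only [add_zero]
      push_cast at hb
      linarith
  have hc' : ∀ᶠ δ in 𝓝[>] (0 : ℝ), c < (1 - lam) / 2 * Real.log (1 - lam) -
      (1 - lam) * Real.log √(1 - max (r - δ) 0 ^ 2) := by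
    by_cases h1 : lam = 1
    · have hc0 : c < 0 := by simpa [h1] using hc
      exact .of_forall fun δ ↦ by simpa [h1] using hc0
    have hpos : 0 < 1 - lam := by
      refine sub_pos.2 (lt_of_le_of_ne ?_ h1)
      refine le_of_tendsto hlam ?_
      filter_upwards [eventually_ge_atTop 2] with n hn
      have hn' : (0 : ℝ) < n := by positivity
      rw [div_le_one hn']
      exact_mod_cast (hk n hn).2.trans (Nat.sub_le _ _)
    rcases hr1.eq_or_lt with rfl | hr1
    · have h2 : Tendsto (fun δ : ℝ ↦ √(1 - max (1 - δ) 0 ^ 2)) (𝓝[>] 0) (𝓝[>] 0) := by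
        refine tendsto_nhdsWithin_iff.2 ⟨?_, ?_⟩
        · have : Continuous fun δ : ℝ ↦ √(1 - max (1 - δ) 0 ^ 2) := by fun_prop
          refine tendsto_nhdsWithin_of_tendsto_nhds ?_
          convert this.tendsto 0 using 2
          simp
        · filter_upwards [self_mem_nhdsWithin] with δ (hδ : 0 < δ)
          refine Real.sqrt_pos.2 (sub_pos.2 ?_)
          have h3 : max (1 - δ) 0 < 1 := max_lt (by linarith) one_pos
          have h4 : 0 ≤ max (1 - δ) 0 := le_max_right _ _
          nlinarith
      have h3 : Tendsto (fun δ : ℝ ↦ (1 - lam) / 2 * Real.log (1 - lam) +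
          (1 - lam) * -Real.log √(1 - max (1 - δ) 0 ^ 2)) (𝓝[>] 0) atTop := by
        refine tendsto_atTop_add_const_left _ _ (Tendsto.const_mul_atTop hpos ?_)
        exact tendsto_neg_atBot_atTop.comp (Real.tendsto_log_nhdsGT_zero.comp h2)
      filter_upwards [h3.eventually_gt_atTop c] with δ hδ
      linarith
    · have hr2 : 0 < 1 - r ^ 2 := by nlinarith
      have h2 : ContinuousAt (fun δ : ℝ ↦ (1 - lam) / 2 * Real.log (1 - lam) -
          (1 - lam) * Real.log √(1 - max (r - δ) 0 ^ 2)) 0 := by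
        have : ContinuousAt (fun δ : ℝ ↦ Real.log √(1 - max (r - δ) 0 ^ 2)) 0 := by
          refine ContinuousAt.log (by fun_prop) ?_
          simp only [sub_zero, max_eq_left hr0]
          positivity
        fun_prop
      refine nhdsWithin_le_nhds (h2.eventually (lt_mem_nhds ?_))
      simp only [h1, hr1.ne, if_false] at hc
      rw [EReal.coe_lt_coe_iff, Real.log_div (by linarith) hr2.ne'] at hc
      simp only [sub_zero, max_eq_left hr0]
      rw [Real.log_sqrt hr2.le]
      linarith
  obtain ⟨δ, ⟨hδb, hδc⟩, hδ0⟩ := ((hb'.and hc').and self_mem_nhdsWithin).exists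
  have hδ0 : 0 < δ := hδ0
  set m := max (r - δ) 0 with hm
  have hm0 : 0 ≤ m := le_max_right _ _
  have hm1 : m < 1 := max_lt (by linarith) one_pos
  have hm2 : 0 < 1 - m ^ 2 := by nlinarith
  have hrate : a < splitRate lam (r + δ) √(1 - m ^ 2) := by rw [splitRate]; linarith
  refine ⟨Metric.ball r δ, Metric.ball_mem_nhds r hδ0, ?_⟩
  filter_upwards [eventually_splitVolume hk hlam (α := r + δ) (by linarith)
    (Real.sqrt_pos.2 hm2) (sub_pos.2 hrate), eventually_gt_atTop 0] with n hn hn0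
  have hn' : (0 : ℝ) < n := by exact_mod_cast hn0
  rw [lpBallUniform_two_headRatio _ hn0]
  refine le_trans ?_ (hn.2.trans_eq (by rw [sub_sub_cancel]))
  rw [splitVolume]
  refine mul_le_mul' le_rfl (measure_mono ?_)
  rintro y ⟨hy1, hy2⟩
  rw [Metric.mem_ball, Real.dist_eq, abs_lt] at hy2
  have e1 := headRatio_sq_mul (k n) y
  have e2 := headSq_add_tailSq (k n) y
  have e3 := headRatio_nonneg (k n) y
  have e6 := headRatio_le_one (k n) y
  have e4 : m ≤ headRatio (k n) y := max_le (by linarith) e3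
  have e5 : 0 ≤ ∑ i, y i ^ 2 := Finset.sum_nonneg fun i _ ↦ sq_nonneg _
  refine ⟨?_, ?_⟩
  · rw [Set.mem_Iic, ← e1, mul_comm]
    gcongr
    linarith
  · rw [Set.mem_Iic, Real.sq_sqrt hm2.le]
    have e7 : tailSq (k n) y = (∑ i, y i ^ 2) * (1 - headRatio (k n) y ^ 2) := by linarith
    rw [e7]
    have e8 : 0 ≤ 1 - headRatio (k n) y ^ 2 := by nlinarith
    gcongr

/-- In the interior the two rates agree. The endpoint 0 has finite rate only for λ = 0, and the
endpoint 1 only for λ = 1; the surviving expression is then continuous there, so the endpoint can be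
replaced by an interior point. -/
theorem exists_splitRate_lt {lam r a : ℝ} (hr0 : 0 ≤ r) (hr1 : r ≤ 1)
    (h : betaRate lam r < a) {V : Set ℝ} (hV : V ∈ 𝓝 r) :
    ∃ r' ∈ V, 0 < r' ∧ r' < 1 ∧ splitRate lam r' √(1 - r' ^ 2) < a := by
  rcases hr0.eq_or_lt with rfl | hr0
  · have h0 : lam = 0 := by
      by_contra h0
      simp only [betaRate, h0, if_false, if_true] at h
      rw [EReal.top_add_of_ne_bot
        (by split_ifs <;> first | exact EReal.coe_ne_bot _ | simp)] at h
      exact not_top_lt h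
    subst h0
    have ha : 0 < a := by
      rw [← EReal.coe_lt_coe_iff]
      refine lt_of_eq_of_lt ?_ h
      simp [betaRate]
    have hc : ContinuousAt (fun x : ℝ ↦ splitRate 0 x √(1 - x ^ 2)) 0 := by
      have : ContinuousAt (fun x : ℝ ↦ Real.log √(1 - x ^ 2)) 0 :=
        ContinuousAt.log (by fun_prop) (by simp)
      simp only [splitRate, zero_mul, sub_zero, zero_div]
      fun_prop
    have h2 := hc.eventually (gt_mem_nhds (show splitRate 0 0 √(1 - 0 ^ 2) < a by
      simpa [splitRate] using ha))
    obtain ⟨x, ⟨⟨h3, h4⟩, h5⟩, h6⟩ := (((h2.filter_mono nhdsWithin_le_nhds).and ((eventually_mem_set.2 hV).filter_mono nhdsWithin_le_nhds)).and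
      (eventually_nhdsWithin_of_eventually_nhds (gt_mem_nhds one_pos)) |>.and
        (self_mem_nhdsWithin (a := (0 : ℝ)) (s := Set.Ioi 0))).exists
    exact ⟨x, h4, h6, h5, h3⟩
  rcases hr1.eq_or_lt with rfl | hr1
  · have h1 : lam = 1 := by
      by_contra h1
      simp only [betaRate, h1, if_false, if_true] at h
      rw [EReal.add_top_of_ne_bot
        (by split_ifs <;> first | exact EReal.coe_ne_bot _ | simp)] at h
      exact not_top_lt h
    subst h1
    have ha : 0 < a := by
      rw [← EReal.coe_lt_coe_iff]
      refine lt_of_eq_of_lt ?_ h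
      simp [betaRate]
    have hc : ContinuousAt (fun x : ℝ ↦ splitRate 1 x √(1 - x ^ 2)) 1 := by
      have : ContinuousAt (fun x : ℝ ↦ Real.log x) 1 :=
        ContinuousAt.log (by fun_prop) (by simp)
      simp only [splitRate, sub_self, zero_mul, sub_zero, zero_div]
      fun_prop
    have h2 := hc.eventually (gt_mem_nhds (show splitRate 1 1 √(1 - 1 ^ 2) < a by
      simpa [splitRate] using ha))
    obtain ⟨x, ⟨⟨h3, h4⟩, h5⟩, h6⟩ := (((h2.filter_mono nhdsWithin_le_nhds).and ((eventually_mem_set.2 hV).filter_mono nhdsWithin_le_nhds)).and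
      (eventually_nhdsWithin_of_eventually_nhds (lt_mem_nhds one_pos)) |>.and
        (self_mem_nhdsWithin (a := (1 : ℝ)) (s := Set.Iio 1))).exists
    exact ⟨x, h4, h5, h6, h3⟩
  · refine ⟨r, mem_of_mem_nhds hV, hr0, hr1, ?_⟩
    have hr2 : 0 < 1 - r ^ 2 := by nlinarith
    rw [← EReal.coe_lt_coe_iff]
    refine lt_of_eq_of_lt ?_ h
    rw [betaRate, splitRate, Real.log_sqrt hr2.le]
    by_cases h0 : lam = 0
    · subst h0
      simp only [if_true, zero_ne_one, hr1.ne, if_false, zero_add, sub_zero, EReal.coe_eq_coe_iff]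
      rw [Real.log_div one_ne_zero hr2.ne', Real.log_one]
      ring
    by_cases h1 : lam = 1
    · subst h1
      simp only [if_true, one_ne_zero, hr0.ne', if_false, add_zero, EReal.coe_eq_coe_iff]
      rw [Real.log_div one_ne_zero (by positivity), Real.log_one, Real.log_pow]
      push_cast
      ring
    simp only [h0, h1, hr0.ne', hr1.ne, if_false]
    rw [Real.log_div h0 (by positivity), Real.log_div (sub_ne_zero.2 (Ne.symm h1)) hr2.ne',
      Real.log_pow, ← EReal.coe_add]
    congr 1
    push_cast
    linarith

/-- A product of thin shells of radii √n s and √n √(1-s²) lies in the ball, and its points have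
ratio close to s. It occupies at least the proportion η² of the product of full balls. -/
theorem le_lpBallUniform_headRatio {k : ℕ → ℕ} (hk : ∀ n, 2 ≤ n → 1 ≤ k n ∧ k n ≤ n - 1) {lam : ℝ}
    (hlam : Tendsto (fun n : ℕ ↦ (k n : ℝ) / n) atTop (𝓝 lam)) {r a : ℝ} (hr0 : 0 ≤ r)
    (hr1 : r ≤ 1) (h : betaRate lam r < a) {V : Set ℝ} (hV : V ∈ 𝓝 r) :
    ∀ᶠ n : ℕ in atTop, ENNReal.ofReal (Real.exp (-(n * a))) ≤
      lpBallUniform 2 n {x | headRatio (k n) (WithLp.ofLp x) ∈ V} := by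
  obtain ⟨W, hWV, hWo, hrW⟩ := mem_nhds_iff.1 hV
  obtain ⟨s, hsW, hs0, hs1, hs⟩ := exists_splitRate_lt hr0 hr1 h (hWo.mem_nhds hrW)
  have hs2 : 0 < 1 - s ^ 2 := by nlinarith
  obtain ⟨η, hη0, hη1, hηW⟩ : ∃ η : ℝ, 0 < η ∧ η < 1 ∧
      Set.Icc ((1 - η) * s) (s / (1 - η)) ⊆ W := by
    obtain ⟨d, hd, hdW⟩ := Metric.isOpen_iff.1 hWo s hsW
    have c1 : ContinuousAt (fun η : ℝ ↦ (1 - η) * s) 0 := by fun_prop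
    have c2 : ContinuousAt (fun η : ℝ ↦ s / (1 - η)) 0 :=
      ContinuousAt.div (by fun_prop) (by fun_prop) (by simp)
    have e1 := c1.eventually (lt_mem_nhds (show s - d < (1 - 0) * s by linarith))
    have e2 := c2.eventually (gt_mem_nhds (show s / (1 - 0) < s + d by simpa using hd))
    obtain ⟨η, ⟨⟨h3, h4⟩, h5⟩, h6⟩ := (((e1.filter_mono nhdsWithin_le_nhds).and (e2.filter_mono nhdsWithin_le_nhds)).and
      (eventually_nhdsWithin_of_eventually_nhds (gt_mem_nhds one_pos)) |>.and
        (self_mem_nhdsWithin (a := (0 : ℝ)) (s := Set.Ioi 0))).exists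
    refine ⟨η, h6, h5, fun x hx ↦ hdW ?_⟩
    rw [Metric.mem_ball, Real.dist_eq, abs_lt]
    exact ⟨by linarith [hx.1], by linarith [hx.2]⟩
  have h1η : 0 < 1 - η := by linarith
  set β := √(1 - s ^ 2) with hβ
  have hβ0 : 0 < β := Real.sqrt_pos.2 hs2
  have hβ2 : β ^ 2 = 1 - s ^ 2 := Real.sq_sqrt hs2.le
  obtain ⟨ε, hε, hεa⟩ : ∃ ε > 0, splitRate lam s β + 2 * ε ≤ a :=
    ⟨(a - splitRate lam s β) / 2, by linarith, by linarith⟩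
  have hexp : ∀ᶠ n : ℕ in atTop, Real.exp (-(n * ε)) ≤ η * η := by
    have : Tendsto (fun n : ℕ ↦ Real.exp (-(n * ε))) atTop (𝓝 0) :=
      Real.tendsto_exp_neg_atTop_nhds_zero.comp
        (tendsto_natCast_atTop_atTop.atTop_mul_const hε)
    exact this.eventually_le_const (by positivity)
  filter_upwards [eventually_splitVolume hk hlam hs0 hβ0 hε, eventually_ge_atTop 2, hexp]
    with n hn hn2 hηn
  obtain ⟨hk1, hk2⟩ := hk n hn2
  have hn' : (0 : ℝ) < n := by positivity
  have : Nonempty {i : Fin n // (i : ℕ) < k n} := ⟨⟨⟨0, by omega⟩, hk1⟩⟩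
  have : Nonempty {i : Fin n // ¬(i : ℕ) < k n} := ⟨⟨⟨n - 1, by omega⟩, by simpa using hk2⟩⟩
  rw [lpBallUniform_two_headRatio _ (by omega)]
  have hsub : {y : Fin n → ℝ | headSq (k n) y ∈ Set.Ioc (n * ((1 - η) * s) ^ 2) (n * s ^ 2) ∧
      tailSq (k n) y ∈ Set.Ioc (n * ((1 - η) * β) ^ 2) (n * β ^ 2)} ⊆
      {y | ∑ i, y i ^ 2 ≤ n ∧ headRatio (k n) y ∈ V} := by
    rintro y ⟨⟨hy1, hy2⟩, hy3, hy4⟩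
    have e2 := headSq_add_tailSq (k n) y
    have e3 := headRatio_nonneg (k n) y
    have hle : ∑ i, y i ^ 2 ≤ n := by rw [← e2]; nlinarith
    refine ⟨hle, hWV (hηW ?_)⟩
    have hlow : n * (1 - η) ^ 2 < ∑ i, y i ^ 2 := by
      rw [← e2]
      rw [mul_pow] at hy1 hy3
      rw [hβ2] at hy3
      nlinarith
    have hpos : 0 < ∑ i, y i ^ 2 := lt_of_le_of_lt (by positivity) hlow
    constructor
    · rw [headRatio]
      refine Real.le_sqrt_of_sq_le ?_
      rw [le_div_iff₀ hpos]
      refine le_trans ?_ hy1.le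
      rw [mul_comm]
      gcongr
    · rw [headRatio, Real.sqrt_le_iff]
      refine ⟨by positivity, ?_⟩
      rw [div_pow, div_le_div_iff₀ hpos (by positivity)]
      calc headSq (k n) y * (1 - η) ^ 2 ≤ n * s ^ 2 * (1 - η) ^ 2 := by gcongr
        _ = s ^ 2 * (n * (1 - η) ^ 2) := by ring
        _ ≤ _ := by gcongr
  have h1 : ENNReal.ofReal (η * η) * splitVolume (k n) n s β ≤ (basePi 2 n (constraintSet 2 n))⁻¹ *
      volume {y : Fin n → ℝ | ∑ i, y i ^ 2 ≤ n ∧ headRatio (k n) y ∈ V} := by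
    rw [splitVolume, mul_left_comm]
    gcongr
    refine le_trans ?_ (measure_mono hsub)
    rw [volume_head_tail, volume_head_tail, ENNReal.ofReal_mul hη0.le, mul_mul_mul_comm]
    exact mul_le_mul' (volume_annulus hn'.le hs0.le hη0.le hη1.le)
      (volume_annulus hn'.le hβ0.le hη0.le hη1.le)
  refine le_trans ?_ h1
  calc ENNReal.ofReal (Real.exp (-(n * a)))
      ≤ ENNReal.ofReal (Real.exp (-(n * ε)) * Real.exp (-(n * (splitRate lam s β + ε)))) := by
        rw [← Real.exp_add]
        refine ENNReal.ofReal_le_ofReal (Real.exp_le_exp.2 ?_)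
        nlinarith
    _ = ENNReal.ofReal (Real.exp (-(n * ε))) *
        ENNReal.ofReal (Real.exp (-(n * (splitRate lam s β + ε)))) :=
        ENNReal.ofReal_mul (Real.exp_pos _).le
    _ ≤ _ := mul_le_mul' (ENNReal.ofReal_le_ofReal hηn) hn.1

/-! ### The law of the norm of a random projection -/

-- The norm of the projection is the maximum of ⟨x, u⟩ over the unit ball of the subspace, and a
-- maximizer for E has a point of the unit ball of F within the Hausdorff distance. This gives joint
-- continuity, hence measurability.
open scoped InnerProductSpace in
theorem norm_starProjection_le_add {n k : ℕ} (E F : RealGrassmannian n k)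
    (x : EuclideanSpace ℝ (Fin n)) :
    ‖E.1.starProjection x‖ ≤ ‖F.1.starProjection x‖ + ‖x‖ * dist E F := by
  rcases (norm_nonneg (E.1.starProjection x)).eq_or_lt with h0 | h0
  · rw [← h0]; positivity
  set w := E.1.starProjection x with hw
  set u := ‖w‖⁻¹ • w with hu
  have hwE : w ∈ E.1 := Submodule.starProjection_apply_mem _ _
  have huE : u ∈ E.unitBall := RealGrassmannian.mem_unitBall.2
    ⟨E.1.smul_mem _ hwE, by simp [hu, norm_smul, h0.ne']⟩
  have hfin : Metric.hausdorffEDist (E.unitBall : Set (EuclideanSpace ℝ (Fin n))) F.unitBall ≠ ⊤ :=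
    Metric.hausdorffEDist_ne_top_of_nonempty_of_bounded E.unitBall.nonempty F.unitBall.nonempty
      E.unitBall.isCompact.isBounded F.unitBall.isCompact.isBounded
  obtain ⟨v, hv, hd⟩ := F.unitBall.isCompact.exists_infDist_eq_dist F.unitBall.nonempty u
  have hdist : ‖u - v‖ ≤ dist E F := by
    rw [← dist_eq_norm, ← hd]
    exact Metric.infDist_le_hausdorffDist_of_mem huE hfin
  obtain ⟨hvF, hv1⟩ := RealGrassmannian.mem_unitBall.1 hv
  have hxu : ⟪x, u⟫_ℝ = ‖w‖ := by
    have h1 : ⟪x - w, u⟫_ℝ = 0 := Submodule.starProjection_inner_eq_zero _ _ (E.1.smul_mem _ hwE)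
    rw [inner_sub_left, sub_eq_zero] at h1
    rw [h1, hu, real_inner_smul_right, real_inner_self_eq_norm_sq]
    field_simp
  have hxv : ⟪x, v⟫_ℝ ≤ ‖F.1.starProjection x‖ := by
    have h1 : ⟪x - F.1.starProjection x, v⟫_ℝ = 0 :=
      Submodule.starProjection_inner_eq_zero _ _ hvF
    rw [inner_sub_left, sub_eq_zero] at h1
    rw [h1]
    refine (real_inner_le_norm _ _).trans ?_
    exact mul_le_of_le_one_right (norm_nonneg _) hv1
  have hxuv : ⟪x, u - v⟫_ℝ ≤ ‖x‖ * dist E F := by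
    refine (real_inner_le_norm _ _).trans ?_
    gcongr
  rw [inner_sub_right] at hxuv
  linarith

theorem continuous_norm_starProjection (n k : ℕ) :
    Continuous fun z : EuclideanSpace ℝ (Fin n) × RealGrassmannian n k ↦
      ‖z.2.1.starProjection z.1‖ := by
  rw [continuous_iff_continuousAt]
  rintro ⟨x, E⟩
  rw [ContinuousAt, tendsto_iff_dist_tendsto_zero]
  have hb : Tendsto (fun z : EuclideanSpace ℝ (Fin n) × RealGrassmannian n k ↦
      ‖z.1 - x‖ + ‖x‖ * dist z.2 E) (𝓝 (x, E)) (𝓝 0) := by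
    have : Continuous fun z : EuclideanSpace ℝ (Fin n) × RealGrassmannian n k ↦
      ‖z.1 - x‖ + ‖x‖ * dist z.2 E := by fun_prop
    convert this.tendsto (x, E) using 2
    simp
  refine squeeze_zero (fun _ ↦ dist_nonneg) (fun z ↦ ?_) hb
  have h1 : |‖z.2.1.starProjection z.1‖ - ‖z.2.1.starProjection x‖| ≤ ‖z.1 - x‖ := by
    refine (abs_norm_sub_norm_le _ _).trans ?_
    rw [← map_sub]
    exact Submodule.norm_starProjection_apply_le _ _
  have h2 := norm_starProjection_le_add z.2 E x
  have h3 := norm_starProjection_le_add E z.2 x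
  rw [dist_comm] at h3
  rw [abs_le] at h1
  simp only
  rw [Real.dist_eq, abs_le]
  constructor <;> linarith

/-- An orthogonal operator as a linear isometric equivalence. -/
noncomputable def OrthogonalOps.toIsometry {n : ℕ} (T : OrthogonalOps n) :
    EuclideanSpace ℝ (Fin n) ≃ₗᵢ[ℝ] EuclideanSpace ℝ (Fin n) :=
  Unitary.linearIsometryEquiv T

theorem OrthogonalOps.toIsometry_mul {n : ℕ} (T S : OrthogonalOps n)
    (x : EuclideanSpace ℝ (Fin n)) : (T * S).toIsometry x = T.toIsometry (S.toIsometry x) := rfl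

theorem OrthogonalOps.toIsometry_inv {n : ℕ} (T : OrthogonalOps n)
    (x : EuclideanSpace ℝ (Fin n)) : T⁻¹.toIsometry x = T.toIsometry.symm x := by
  rw [LinearIsometryEquiv.eq_symm_apply, ← OrthogonalOps.toIsometry_mul, mul_inv_cancel]
  rfl

theorem starProjection_grassmannOrbit {n k : ℕ} (hk : k ≤ n) (T : OrthogonalOps n)
    (x : EuclideanSpace ℝ (Fin n)) :
    ‖(grassmannOrbit hk T).1.starProjection x‖ =
      ‖(coordSubspace n k).starProjection (T⁻¹.toIsometry x)‖ := by
  rw [T.toIsometry_inv, ← LinearIsometryEquiv.norm_map T.toIsometry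
    ((coordSubspace n k).starProjection _)]
  congr 1
  refine Submodule.eq_starProjection_of_mem_of_inner_eq_zero
    (K := (grassmannOrbit hk T).1) ?_ ?_
  · exact ⟨_, Submodule.starProjection_apply_mem _ _, rfl⟩
  · rintro _ ⟨u, hu, rfl⟩
    have h1 := Submodule.starProjection_inner_eq_zero (K := coordSubspace n k) (T.toIsometry.symm x) u hu
    rw [← T.toIsometry.inner_map_map, map_sub, LinearIsometryEquiv.apply_symm_apply] at h1
    exact h1

/-- The reflection in the hyperplane orthogonal to x - y exchanges two vectors of equal norm. -/
theorem OrthogonalOps.exists_map_eq {n : ℕ} {x y : EuclideanSpace ℝ (Fin n)} (h : ‖x‖ = ‖y‖) :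
    ∃ S : OrthogonalOps n, S.toIsometry x = y := by
  refine ⟨Unitary.linearIsometryEquiv.symm (Submodule.reflection (ℝ ∙ (x - y))ᗮ), ?_⟩
  rw [OrthogonalOps.toIsometry, MulEquiv.apply_symm_apply]
  exact Submodule.reflection_sub h

/-- Left invariance of Haar measure: replacing T by S T turns T⁻¹(S x) into T⁻¹ x. -/
theorem orthogonalHaar_proj_congr {n k : ℕ} {x y : EuclideanSpace ℝ (Fin n)} (h : ‖x‖ = ‖y‖)
    (V : Set ℝ) :
    orthogonalHaar n {T | ‖(coordSubspace n k).starProjection (T⁻¹.toIsometry x)‖ ∈ V} =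
      orthogonalHaar n {T | ‖(coordSubspace n k).starProjection (T⁻¹.toIsometry y)‖ ∈ V} := by
  obtain ⟨S, rfl⟩ := OrthogonalOps.exists_map_eq h
  have : Measure.IsMulLeftInvariant (orthogonalHaar n) := by
    unfold orthogonalHaar; infer_instance
  refine Eq.trans ?_ (measure_preimage_mul (orthogonalHaar n) S _)
  congr 1
  ext T
  simp only [Set.mem_preimage, Set.mem_ofPred_eq, mul_inv_rev, OrthogonalOps.toIsometry_mul,
    S.toIsometry_inv, LinearIsometryEquiv.symm_apply_apply]

theorem norm_starProjection_coordSubspace {n : ℕ} (k : ℕ) (z : EuclideanSpace ℝ (Fin n)) :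
    ‖(coordSubspace n k).starProjection z‖ = ‖z‖ * headRatio k (WithLp.ofLp z) := by
  set w : EuclideanSpace ℝ (Fin n) := WithLp.toLp 2 fun i ↦ if (i : ℕ) < k then z i else 0 with hw
  have hP : (coordSubspace n k).starProjection z = w := by
    refine Submodule.eq_starProjection_of_mem_of_inner_eq_zero ?_ ?_
    · have : w = ∑ i : Fin n, if (i : ℕ) < k then z i • EuclideanSpace.single i (1 : ℝ) else 0 := by
        ext j
        simp only [hw, WithLp.ofLp_sum, Finset.sum_apply]
        rw [Finset.sum_eq_single j]
        · split_ifs <;> simp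
        · intro i _ hij
          split_ifs <;> simp [Ne.symm hij]
        · simp
      rw [this]
      refine Submodule.sum_mem _ fun i _ ↦ ?_
      split_ifs with hi
      · exact Submodule.smul_mem _ _ (Submodule.subset_span ⟨i, hi, rfl⟩)
      · exact Submodule.zero_mem _
    · intro u hu
      induction hu using Submodule.span_induction with
      | mem u hu =>
        obtain ⟨i, hi, rfl⟩ := hu
        rw [EuclideanSpace.inner_single_right]
        simp [hw, hi]
      | zero => simp
      | add u v _ _ hu hv => rw [inner_add_right, hu, hv, add_zero]
      | smul c u _ hu => rw [real_inner_smul_right, hu, mul_zero]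
  have hw2 : ‖w‖ ^ 2 = headSq k (WithLp.ofLp z) := by
    rw [EuclideanSpace.real_norm_sq_eq, headSq,
      ← Finset.sum_subtype (Finset.univ.filter fun i : Fin n ↦ (i : ℕ) < k) (by simp)
        (fun i ↦ z i ^ 2), Finset.sum_filter]
    refine Finset.sum_congr rfl fun i _ ↦ ?_
    simp only [hw]
    split_ifs <;> simp
  have hz2 : ‖z‖ ^ 2 = ∑ i, z i ^ 2 := EuclideanSpace.real_norm_sq_eq z
  have h1 := headRatio_sq_mul k (WithLp.ofLp z)
  have h3 := headRatio_nonneg k (WithLp.ofLp z)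
  rw [hP, ← sq_eq_sq₀ (norm_nonneg _) (by positivity), hw2, mul_pow, hz2, ← h1]
  ring

theorem lpBall_two_eq (n : ℕ) : lpBall 2 n = Metric.closedBall 0 1 := by
  ext x
  rw [mem_closedBall_zero_iff]
  rfl

theorem map_isometry_lpBallUniform_two {n : ℕ}
    (e : EuclideanSpace ℝ (Fin n) ≃ₗᵢ[ℝ] EuclideanSpace ℝ (Fin n))
    {s : Set (EuclideanSpace ℝ (Fin n))} (hs : MeasurableSet s) :
    lpBallUniform 2 n (e ⁻¹' s) = lpBallUniform 2 n s := by
  have hB : MeasurableSet (lpBall 2 n) := measurableSet_lpBall le_rfl n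
  have hpre : e ⁻¹' lpBall 2 n = lpBall 2 n := by
    ext x
    simp [lpBall_two_eq]
  rw [lpBallUniform, cond_apply hB, cond_apply hB]
  congr 1
  conv_lhs => rw [← hpre, ← Set.preimage_inter]
  exact e.measurePreserving.measure_preimage (hB.inter hs).nullMeasurableSet

theorem measurable_headRatio (n k : ℕ) :
    Measurable fun z : EuclideanSpace ℝ (Fin n) ↦ headRatio k (WithLp.ofLp z) := by
  unfold headRatio headSq
  fun_prop

theorem lpBallUniform_two_singleton {n : ℕ} (hn : n ≠ 0) :
    lpBallUniform 2 n {0} = 0 := by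
  have : Nonempty (Fin n) := ⟨⟨0, Nat.pos_of_ne_zero hn⟩⟩
  have hB : MeasurableSet (lpBall 2 n) := measurableSet_lpBall le_rfl n
  rw [lpBallUniform, cond_apply hB]
  rw [measure_mono_null Set.inter_subset_right (measure_singleton _), mul_zero]

theorem continuous_inv_toIsometry (n : ℕ) :
    Continuous fun z : EuclideanSpace ℝ (Fin n) × OrthogonalOps n ↦ z.2⁻¹.toIsometry z.1 := by
  have h : Continuous fun z : EuclideanSpace ℝ (Fin n) × OrthogonalOps n ↦ (z.2⁻¹).1 :=
    continuous_subtype_val.comp (continuous_inv.comp continuous_snd)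
  exact h.clm_apply continuous_fst

/-- Fubini for a uniform point z of the Euclidean ball and an independent rotation T. For fixed z ≠
0 the vector x may be replaced by the multiple of z of the same norm; for fixed T the rotation
disappears by invariance of the ball. -/
theorem orthogonalHaar_proj {n k : ℕ} (hn : n ≠ 0) (x : EuclideanSpace ℝ (Fin n))
    {V : Set ℝ} (hV : MeasurableSet V) :
    orthogonalHaar n {T | ‖(coordSubspace n k).starProjection (T⁻¹.toIsometry x)‖ ∈ V} =
      lpBallUniform 2 n {z | ‖x‖ * headRatio k (WithLp.ofLp z) ∈ V} := by
  have := isProbabilityMeasure_lpBallUniform (p := 2) le_rfl (n := n)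
  have hscale : ∀ (T : OrthogonalOps n) (z : EuclideanSpace ℝ (Fin n)),
      ‖(coordSubspace n k).starProjection (T⁻¹.toIsometry ((‖x‖ / ‖z‖) • z))‖ =
        ‖x‖ * headRatio k (WithLp.ofLp (T⁻¹.toIsometry z)) := by
    intro T z
    rw [map_smul, map_smul, norm_smul, norm_starProjection_coordSubspace,
      LinearIsometryEquiv.norm_map, Real.norm_of_nonneg (by positivity)]
    rcases eq_or_ne z 0 with rfl | hz
    · simp [headRatio]
    · have : ‖z‖ ≠ 0 := norm_ne_zero_iff.2 hz
      field_simp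
  have hmeas : MeasurableSet {z : EuclideanSpace ℝ (Fin n) × OrthogonalOps n |
      ‖x‖ * headRatio k (WithLp.ofLp (z.2⁻¹.toIsometry z.1)) ∈ V} :=
    ((measurable_headRatio n k).comp (continuous_inv_toIsometry n).measurable).const_mul ‖x‖ hV
  have h1 := Measure.prod_apply (μ := lpBallUniform 2 n) (ν := orthogonalHaar n) hmeas
  have h2 := Measure.prod_apply_symm (μ := lpBallUniform 2 n) (ν := orthogonalHaar n) hmeas
  rw [h1] at h2
  have hl : ∫⁻ z, orthogonalHaar n (Prod.mk z ⁻¹' {z : EuclideanSpace ℝ (Fin n) × OrthogonalOps n |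
      ‖x‖ * headRatio k (WithLp.ofLp (z.2⁻¹.toIsometry z.1)) ∈ V}) ∂(lpBallUniform 2 n) =
      ∫⁻ _, orthogonalHaar n {T | ‖(coordSubspace n k).starProjection (T⁻¹.toIsometry x)‖ ∈ V}
        ∂(lpBallUniform 2 n) := by
    refine lintegral_congr_ae ?_
    have h0 : ∀ᵐ z ∂(lpBallUniform 2 n), z ≠ 0 := by
      rw [ae_iff]
      simpa using lpBallUniform_two_singleton hn
    filter_upwards [h0] with z hz
    have hz' : ‖z‖ ≠ 0 := norm_ne_zero_iff.2 hz
    have hnorm : ‖(‖x‖ / ‖z‖) • z‖ = ‖x‖ := by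
      rw [norm_smul, Real.norm_of_nonneg (by positivity)]
      field_simp
    rw [← orthogonalHaar_proj_congr hnorm]
    simp only [hscale]
    rfl
  have hr : ∫⁻ T, lpBallUniform 2 n ((fun z ↦ (z, T)) ⁻¹'
      {z : EuclideanSpace ℝ (Fin n) × OrthogonalOps n |
        ‖x‖ * headRatio k (WithLp.ofLp (z.2⁻¹.toIsometry z.1)) ∈ V}) ∂(orthogonalHaar n) =
      ∫⁻ _, lpBallUniform 2 n {z | ‖x‖ * headRatio k (WithLp.ofLp z) ∈ V}
        ∂(orthogonalHaar n) := by
    refine lintegral_congr fun T ↦ ?_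
    exact map_isometry_lpBallUniform_two T⁻¹.toIsometry
      ((measurable_headRatio n k).const_mul ‖x‖ hV)
  rw [hl, hr] at h2
  simpa using h2

/-- The norm of the projection of a random vector onto a uniformly distributed subspace has the law
of the norm of the vector times the relative norm of the head of an independent vector that is
uniformly distributed in the Euclidean ball. -/
theorem prod_grassmannHaar_norm_starProjection {p : ℝ≥0∞} {n k : ℕ} (hn : n ≠ 0)
    (hk : k ≤ n) {V : Set ℝ} (hV : MeasurableSet V) :
    (lpBallUniform p n).prod (grassmannHaar hk) {z | ‖z.2.1.starProjection z.1‖ ∈ V} =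
      (lpBallUniform p n).prod (lpBallUniform 2 n)
        {z | ‖z.1‖ * headRatio k (WithLp.ofLp z.2) ∈ V} := by
  have := isProbabilityMeasure_lpBallUniform (p := 2) le_rfl (n := n)
  have h1 : MeasurableSet {z : EuclideanSpace ℝ (Fin n) × RealGrassmannian n k |
      ‖z.2.1.starProjection z.1‖ ∈ V} := (continuous_norm_starProjection n k).measurable hV
  have h2 : MeasurableSet {z : EuclideanSpace ℝ (Fin n) × EuclideanSpace ℝ (Fin n) |
      ‖z.1‖ * headRatio k (WithLp.ofLp z.2) ∈ V} :=
    (measurable_fst.norm.mul ((measurable_headRatio n k).comp measurable_snd)) hV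
  refine (Measure.prod_apply h1).trans (Eq.trans ?_ (Measure.prod_apply h2).symm)
  refine lintegral_congr fun x ↦ ?_
  rw [grassmannHaar, Measure.map_apply (continuous_grassmannOrbit hk).measurable
    (measurable_prodMk_left h1)]
  refine Eq.trans ?_ (orthogonalHaar_proj hn x hV)
  congr 1
  ext T
  simp only [Set.mem_preimage, Set.mem_ofPred_eq, starProjection_grassmannOrbit]
  exact Iff.rfl

/-! ### From local estimates to a large deviation principle -/

theorem neg_le_inv_mul_log {n : ℕ} (hn : 0 < n) {a : ℝ} {q : ℝ≥0∞}
    (h : ENNReal.ofReal (Real.exp (-(n * a))) ≤ q) :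
    ((-a : ℝ) : EReal) ≤ (((n : ℝ)⁻¹ : ℝ) : EReal) * ENNReal.log q := by
  have hn' : (0 : ℝ) < n := by exact_mod_cast hn
  have h1 := ENNReal.log_le_log h
  rw [ENNReal.log_ofReal_of_pos (Real.exp_pos _), Real.log_exp] at h1
  have h2 : ((-a : ℝ) : EReal) = (((n : ℝ)⁻¹ : ℝ) : EReal) * ((-(n * a) : ℝ) : EReal) := by
    rw [← EReal.coe_mul]
    congr 1
    field_simp
  rw [h2]
  exact mul_le_mul_of_nonneg_left h1 (by exact_mod_cast (inv_pos.2 hn').le)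

theorem inv_mul_log_le_neg {n : ℕ} (hn : 0 < n) {a : ℝ} {q : ℝ≥0∞}
    (h : q ≤ ENNReal.ofReal (Real.exp (-(n * a)))) :
    (((n : ℝ)⁻¹ : ℝ) : EReal) * ENNReal.log q ≤ ((-a : ℝ) : EReal) := by
  have hn' : (0 : ℝ) < n := by exact_mod_cast hn
  have h1 := ENNReal.log_le_log h
  rw [ENNReal.log_ofReal_of_pos (Real.exp_pos _), Real.log_exp] at h1
  have h2 : ((-a : ℝ) : EReal) = (((n : ℝ)⁻¹ : ℝ) : EReal) * ((-(n * a) : ℝ) : EReal) := by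
    rw [← EReal.coe_mul]
    congr 1
    field_simp
  rw [h2]
  exact mul_le_mul_of_nonneg_left h1 (by exact_mod_cast (inv_pos.2 hn').le)

theorem le_of_ofReal_exp_le {n : ℕ} (hn : 0 < n) {a b : ℝ}
    (h : ENNReal.ofReal (Real.exp (-(n * a))) ≤ ENNReal.ofReal (Real.exp (-(n * b)))) :
    b ≤ a := by
  have hn' : (0 : ℝ) < n := by exact_mod_cast hn
  rw [ENNReal.ofReal_le_ofReal_iff (Real.exp_pos _).le, Real.exp_le_exp, neg_le_neg_iff] at h
  exact le_of_mul_le_mul_left h hn'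

theorem eventually_const_mul_exp_le (M : ℕ) {a b : ℝ} (h : b < a) :
    ∀ᶠ n : ℕ in atTop, (M : ℝ≥0∞) * ENNReal.ofReal (Real.exp (-(n * a))) ≤
      ENNReal.ofReal (Real.exp (-(n * b))) := by
  have h1 : Tendsto (fun n : ℕ ↦ Real.exp (n * (a - b))) atTop atTop :=
    Real.tendsto_exp_atTop.comp (tendsto_natCast_atTop_atTop.atTop_mul_const (sub_pos.2 h))
  filter_upwards [h1.eventually_ge_atTop (M : ℝ)] with n hn
  rw [← ENNReal.ofReal_natCast, ← ENNReal.ofReal_mul (Nat.cast_nonneg M)]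
  refine ENNReal.ofReal_le_ofReal ?_
  calc (M : ℝ) * Real.exp (-(n * a)) ≤ Real.exp (n * (a - b)) * Real.exp (-(n * a)) := by gcongr
    _ = Real.exp (-(n * b)) := by rw [← Real.exp_add]; ring_nf

/-- A family of uniform local exponential estimates on the probabilities of small neighbourhoods
yields a large deviation principle when the variables stay in a compact set. -/
theorem satisfiesLDP_of_local {Ω : Type*} [MeasurableSpace Ω] (P : Measure Ω)
    [IsProbabilityMeasure P] (Y : ℕ → Ω → ℝ) (I : ℝ → EReal) {K : Set ℝ} (hK : IsCompact K)
    (hYK : ∀ᶠ n in atTop, P {ω | Y n ω ∉ K} = 0)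
    (hU : ∀ y (a : ℝ), (a : EReal) < I y → ∃ V ∈ 𝓝 y, ∀ᶠ n : ℕ in atTop,
      P {ω | Y n ω ∈ V} ≤ ENNReal.ofReal (Real.exp (-(n * a))))
    (hL : ∀ y (a : ℝ), I y < a → ∀ V ∈ 𝓝 y, ∀ᶠ n : ℕ in atTop,
      ENNReal.ofReal (Real.exp (-(n * a))) ≤ P {ω | Y n ω ∈ V}) :
    SatisfiesLDP P Y (fun n ↦ (n : ℝ)) I := by
  -- A point z near y with smaller rate would have a lower estimate on the neighbourhood V of y that
  -- contradicts the upper estimate there.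
  have hlsc : LowerSemicontinuous I := by
    intro y c hc
    obtain ⟨a, hca, hay⟩ := EReal.lt_iff_exists_real_btwn.1 hc
    obtain ⟨b, hab, hby⟩ := EReal.lt_iff_exists_real_btwn.1 hay
    obtain ⟨V, hV, hVn⟩ := hU y b hby
    filter_upwards [eventually_eventually_nhds.2 (eventually_mem_set.2 hV)] with z hz
    by_contra! hzc
    obtain ⟨n, h1, h2, hn⟩ :=
      ((hL z a (hzc.trans_lt hca) V hz).and (hVn.and (eventually_gt_atTop 0))).exists
    exact absurd (le_of_ofReal_exp_le hn (h1.trans h2)) (not_le.2 (by exact_mod_cast hab))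
  refine ⟨fun y ↦ ?_, hlsc, fun α ↦ ?_, fun A _ ↦ ?_, fun A _ ↦ ?_⟩
  · by_contra! hy
    obtain ⟨a, hya, ha⟩ := EReal.lt_iff_exists_real_btwn.1 hy
    obtain ⟨n, h1, hn⟩ := ((hL y a hya Set.univ univ_mem).and (eventually_gt_atTop 0)).exists
    have h2 : ENNReal.ofReal (Real.exp (-(n * a))) ≤ ENNReal.ofReal (Real.exp (-(n * 0))) := by
      refine h1.trans ?_
      simp
    exact absurd (le_of_ofReal_exp_le hn h2) (not_le.2 (by exact_mod_cast ha))
  · refine hK.of_isClosed_subset (hlsc.isClosed_preimage _) fun y hy ↦ ?_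
    by_contra hyK
    obtain ⟨n, h1, h2⟩ := ((hL y (α + 1) (lt_of_le_of_lt hy (by exact_mod_cast lt_add_one α)) Kᶜ
      (hK.isClosed.isOpen_compl.mem_nhds hyK)).and hYK).exists
    have h3 := h1.trans_eq h2
    rw [nonpos_iff_eq_zero, ENNReal.ofReal_eq_zero] at h3
    exact absurd h3 (not_le.2 (Real.exp_pos _))
  · rw [EReal.neg_le]
    refine le_iInf₂ fun y hy ↦ ?_
    rw [EReal.neg_le]
    by_contra! h
    obtain ⟨b, h1, h2⟩ := EReal.lt_iff_exists_real_btwn.1 h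
    refine absurd h1 (not_lt.2 (le_liminf_of_le (by isBoundedDefault) ?_))
    have h3 : I y < ((-b : ℝ) : EReal) := by
      rw [EReal.coe_neg]
      exact EReal.lt_neg_comm.1 h2
    filter_upwards [hL y (-b) h3 A (mem_interior_iff_mem_nhds.1 hy), eventually_gt_atTop 0]
      with n hn hn0
    simpa using neg_le_inv_mul_log hn0 hn
  · by_contra! h
    obtain ⟨b, h1, h2⟩ := EReal.lt_iff_exists_real_btwn.1 h
    refine absurd h2 (not_lt.2 (limsup_le_of_le (by isBoundedDefault) ?_))
    have h3 : ((-b : ℝ) : EReal) < ⨅ x ∈ closure A, I x := by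
      rw [EReal.coe_neg]
      exact EReal.neg_lt_comm.1 h1
    obtain ⟨a, hba, ha⟩ := EReal.lt_iff_exists_real_btwn.1 h3
    -- Compactness leaves finitely many neighbourhoods, and their number M is absorbed by the
    -- exponential.
    have hcov : ∃ M : ℕ, ∀ᶠ n : ℕ in atTop, P {ω | Y n ω ∈ closure A ∩ K} ≤
        M * ENNReal.ofReal (Real.exp (-(n * a))) := by
      refine (hK.inter_left isClosed_closure).induction_on
        (p := fun s ↦ ∃ M : ℕ, ∀ᶠ n : ℕ in atTop, P {ω | Y n ω ∈ s} ≤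
          M * ENNReal.ofReal (Real.exp (-(n * a)))) ⟨0, by simp⟩ ?_ ?_ ?_
      · rintro s t hst ⟨M, hM⟩
        exact ⟨M, hM.mono fun n hn ↦ le_trans (measure_mono (Set.preimage_mono hst)) hn⟩
      · rintro s t ⟨M, hM⟩ ⟨N, hN⟩
        refine ⟨M + N, ?_⟩
        filter_upwards [hM, hN] with n h1 h2
        rw [Nat.cast_add, add_mul]
        exact (measure_union_le {ω | Y n ω ∈ s} {ω | Y n ω ∈ t}).trans (add_le_add h1 h2)
      · intro y hy
        obtain ⟨V, hV, hVn⟩ := hU y a (ha.trans_le (iInf₂_le y hy.1))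
        exact ⟨V, mem_nhdsWithin_of_mem_nhds hV, 1, by simpa using hVn⟩
    obtain ⟨M, hM⟩ := hcov
    filter_upwards [hM, hYK, eventually_const_mul_exp_le M (a := a) (b := -b)
      (by exact_mod_cast hba), eventually_gt_atTop 0] with n h4 h5 h6 hn
    have h7 : P {ω | Y n ω ∈ A} ≤ ENNReal.ofReal (Real.exp (-(n * -b))) := by
      refine le_trans ?_ (h4.trans h6)
      refine (measure_mono (t := {ω | Y n ω ∈ closure A ∩ K} ∪ {ω | Y n ω ∉ K})
        fun ω hω ↦ ?_).trans ((measure_union_le _ _).trans (by rw [h5, add_zero]))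
      by_cases h : Y n ω ∈ K
      · exact Or.inl ⟨subset_closure hω, h⟩
      · exact Or.inr h
    simpa using inv_mul_log_le_neg hn h7

/-! ### Properties of the rate functions -/

theorem betaRate_ne_bot (lam r : ℝ) : betaRate lam r ≠ ⊥ := by
  unfold betaRate
  rw [Ne, EReal.add_eq_bot_iff]
  split_ifs <;> simp [-EReal.coe_mul]

/-- A negative value would make the probabilities in the lower estimate exceed 1. -/
theorem rateJ_nonneg {p : ℝ≥0∞} (hp : 2 ≤ p) {q : ℝ} (hq : 0 ≤ q) : 0 ≤ rateJ p q := by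
  by_contra! h
  obtain ⟨a, ha, ha0⟩ := EReal.lt_iff_exists_real_btwn.1 h
  obtain ⟨n, h1, hn⟩ := ((le_lpBallUniform hp hq ha univ_mem).and (eventually_gt_atTop 0)).exists
  have := isProbabilityMeasure_lpBallUniform hp (n := n)
  have h2 : ENNReal.ofReal (Real.exp (-(n * a))) ≤ ENNReal.ofReal (Real.exp (-(n * 0))) := by
    refine h1.trans (prob_le_one.trans_eq ?_)
    simp
  exact absurd (le_of_ofReal_exp_le hn h2) (not_le.2 (by exact_mod_cast ha0))

theorem rateJ_ne_bot {p : ℝ≥0∞} (hp : 2 ≤ p) {q : ℝ} (hq : 0 ≤ q) : rateJ p q ≠ ⊥ :=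
  (lt_of_lt_of_le (by simp) (rateJ_nonneg hp hq)).ne'

theorem rateJ_zero {p : ℝ≥0∞} (hp : 2 ≤ p) : rateJ p 0 = ⊤ := by
  by_contra h
  obtain ⟨a, ha, -⟩ := EReal.lt_iff_exists_real_btwn.1 (lt_top_iff_ne_top.2 h)
  exact absurd (dualBound_of_rateJ_lt hp le_rfl ha).1 (lt_irrefl 0)

theorem projectionCost_eq_betaRate (lam : ℝ) {x y : ℝ} (hy : 0 < y) (hyx : y ≤ x) :
    projectionCost lam x y = betaRate lam (y / x) := by
  have hx : 0 < x := hy.trans_le hyx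
  have h1 : y / x ≠ 0 := by positivity
  have h2 : y / x = 1 ↔ x = y := by rw [div_eq_one_iff_eq hx.ne', eq_comm]
  have h3 : lam / (y ^ 2 / x ^ 2) = lam * x ^ 2 / y ^ 2 := by field_simp
  simp only [projectionCost, betaRate, h1, h2, h3, if_false, div_pow]

/-- The first summand grows by -λ log ρ ≤ -log ρ, and the second decreases. So reducing the ratio by
ρ costs no more than shrinking the ball by ρ. -/
theorem betaRate_mul_le {lam ρ r : ℝ} (hlam1 : lam ≤ 1) (hρ0 : 0 < ρ)
    (hρ1 : ρ ≤ 1) (hr0 : 0 < r) (hr1 : r ≤ 1) :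
    betaRate lam (ρ * r) ≤ ((-Real.log ρ : ℝ) : EReal) + betaRate lam r := by
  have hlog : Real.log ρ ≤ 0 := Real.log_nonpos hρ0.le hρ1
  have e1 : (if lam = 0 then (0 : EReal) else if ρ * r = 0 then ⊤ else
      ((lam / 2 * Real.log (lam / (ρ * r) ^ 2) : ℝ) : EReal)) ≤
      ((-Real.log ρ : ℝ) : EReal) + (if lam = 0 then (0 : EReal) else if r = 0 then ⊤ else
      ((lam / 2 * Real.log (lam / r ^ 2) : ℝ) : EReal)) := by
    by_cases h0 : lam = 0
    · simp only [h0, if_true, add_zero]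
      exact_mod_cast neg_nonneg.2 hlog
    · simp only [h0, if_false, hr0.ne', (mul_pos hρ0 hr0).ne']
      rw [← EReal.coe_add, EReal.coe_le_coe_iff, Real.log_div h0 (by positivity),
        Real.log_div h0 (by positivity), mul_pow, Real.log_mul (by positivity) (by positivity),
        Real.log_pow, Real.log_pow]
      push_cast
      nlinarith
  have e2 : (if lam = 1 then (0 : EReal) else if ρ * r = 1 then ⊤ else
      (((1 - lam) / 2 * Real.log ((1 - lam) / (1 - (ρ * r) ^ 2)) : ℝ) : EReal)) ≤
      (if lam = 1 then (0 : EReal) else if r = 1 then ⊤ else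
      (((1 - lam) / 2 * Real.log ((1 - lam) / (1 - r ^ 2)) : ℝ) : EReal)) := by
    by_cases h1 : lam = 1
    · simp [h1]
    by_cases hr : r = 1
    · simp [h1, hr]
    have hr1' : r < 1 := lt_of_le_of_ne hr1 hr
    have hρr : ρ * r ≤ r := mul_le_of_le_one_left hr0.le hρ1
    have hl : 0 < 1 - lam := sub_pos.2 (lt_of_le_of_ne hlam1 h1)
    have h2 : 0 < 1 - r ^ 2 := by nlinarith
    have h3 : 1 - r ^ 2 ≤ 1 - (ρ * r) ^ 2 := by gcongr
    simp only [h1, hr, if_false, (hρr.trans_lt hr1').ne]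
    rw [EReal.coe_le_coe_iff]
    have h4 : 0 < 1 - (ρ * r) ^ 2 := by linarith
    gcongr
  rw [betaRate, betaRate, ← add_assoc]
  exact add_le_add e1 e2

/-- The right-hand side is the cost of p-norm ρ, normalized norm q and ratio r. Enlarging the point
to p-norm 1 and reducing the ratio to ρ r gives the same product at no greater cost, so x = q/ρ is
the competitor in the infimum. -/
theorem projectionRate_le {p : ℝ≥0∞} (hp : 2 ≤ p) {lam ρ q r : ℝ} (hlam1 : lam ≤ 1) (hρ0 : 0 < ρ) (hρ1 : ρ ≤ 1) (hq0 : 0 ≤ q) (hr0 : 0 ≤ r) (hr1 : r ≤ 1) :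
    projectionRate p lam (q * r) ≤
      ((-Real.log ρ : ℝ) : EReal) + rateJ p (q / ρ) + betaRate lam r := by
  have hJ := rateJ_nonneg hp (div_nonneg hq0 hρ0.le)
  have hlog : (0 : EReal) ≤ ((-Real.log ρ : ℝ) : EReal) := by
    exact_mod_cast neg_nonneg.2 (Real.log_nonpos hρ0.le hρ1)
  rcases hq0.eq_or_lt with rfl | hq0
  · rw [zero_div, rateJ_zero hp, EReal.coe_add_top, EReal.top_add_of_ne_bot (betaRate_ne_bot _ _)]
    exact le_top
  rcases hr0.eq_or_lt with rfl | hr0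
  · by_cases h0 : lam = 0
    · subst h0
      have hb : betaRate 0 0 = 0 := by simp [betaRate]
      rw [hb, add_zero]
      simp only [projectionRate, mul_zero, lt_irrefl, if_false, if_true]
      exact (iInf₂_le _ (div_nonneg hq0.le hρ0.le)).trans (le_add_of_nonneg_left hlog)
    · have hb : betaRate lam 0 = ⊤ := by
        simp only [betaRate, h0, if_false, if_true]
        refine EReal.top_add_of_ne_bot ?_
        split_ifs <;> simp [-EReal.coe_mul]
      rw [hb, EReal.add_top_of_ne_bot]
      · exact le_top
      · exact (lt_of_lt_of_le (by simp) (add_nonneg hlog hJ)).ne'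
  have hy : 0 < q * r := mul_pos hq0 hr0
  have hyx : q * r ≤ q / ρ := by
    rw [le_div_iff₀ hρ0, mul_assoc]
    exact mul_le_of_le_one_right hq0.le (mul_le_one₀ hr1 hρ0.le hρ1)
  rw [projectionRate, if_pos hy]
  refine (iInf₂_le (q / ρ) hyx).trans ?_
  have hd : q * r / (q / ρ) = ρ * r := by field_simp
  rw [projectionCost_eq_betaRate lam hy hyx, hd, add_right_comm]
  exact add_le_add (betaRate_mul_le hlam1 hρ0 hρ1 hr0 hr1) le_rfl

theorem normalizedNorm_nonneg (p : ℝ≥0∞) {n : ℕ} (x : EuclideanSpace ℝ (Fin n)) :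
    0 ≤ normalizedNorm p x := by
  unfold normalizedNorm
  positivity

/-- Bernoulli's inequality at the rescaled coordinates n^{1/p} x i, summed over i. -/
theorem normalizedNorm_le_one {p : ℝ≥0∞} (hp : 2 ≤ p) {n : ℕ} (hn : 0 < n)
    {x : EuclideanSpace ℝ (Fin n)} (hx : pNorm p x ≤ 1) : normalizedNorm p x ≤ 1 := by
  have hn' : (0 : ℝ) < n := by exact_mod_cast hn
  have key : ((n : ℝ) ^ (p⁻¹).toReal) ^ 2 * ∑ i, x i ^ 2 ≤ n := by
    by_cases hpt : p = ∞
    · subst hpt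
      rw [pNorm_top_le_one] at hx
      have : ∑ i, x i ^ 2 ≤ ∑ _i : Fin n, (1 : ℝ) :=
        Finset.sum_le_sum fun i _ ↦ by
          rw [sq_le_one_iff_abs_le_one, abs_le]
          exact hx i
      simpa using this
    have hp2 := two_le_toReal hp hpt
    have hp0 : 0 < p.toReal := by linarith
    set c := (n : ℝ) ^ (p⁻¹).toReal with hc
    have hc0 : 0 < c := by positivity
    have hcp : c ^ p.toReal = n := by
      rw [hc, ← Real.rpow_mul hn'.le, ENNReal.toReal_inv, inv_mul_cancel₀ hp0.ne', Real.rpow_one]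
    have h1 : ∑ i, |x i| ^ p.toReal ≤ 1 := by
      rw [← pNorm_rpow hp hpt]
      exact Real.rpow_le_one (pNorm_nonneg hp x) hx hp0.le
    have h2 : ∑ i, (1 + p.toReal / 2 * ((c * x i) ^ 2 - 1)) ≤ ∑ i, n * |x i| ^ p.toReal := by
      refine Finset.sum_le_sum fun i _ ↦ (one_add_le_abs_rpow hp2 (c * x i)).trans_eq ?_
      rw [abs_mul, Real.mul_rpow (abs_nonneg _) (abs_nonneg _), abs_of_pos hc0, hcp]
    simp only [mul_pow, Finset.sum_add_distrib, ← Finset.mul_sum, Finset.sum_sub_distrib,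
      Finset.sum_const, Finset.card_univ, Fintype.card_fin, nsmul_eq_mul, mul_one] at h2
    have h3 : (n : ℝ) * ∑ i, |x i| ^ p.toReal ≤ n := mul_le_of_le_one_right hn'.le h1
    have h4 : p.toReal / 2 * (c ^ 2 * ∑ i, x i ^ 2 - n) ≤ 0 := by linarith
    have h5 := nonpos_of_mul_nonpos_right h4 (by positivity)
    linarith
  have h1 : normalizedNorm p x ^ 2 ≤ 1 := by
    rw [normalizedNorm, mul_pow, EuclideanSpace.real_norm_sq_eq, Real.rpow_sub hn', div_pow,
      ← Real.sqrt_eq_rpow, Real.sq_sqrt hn'.le, div_mul_eq_mul_div, div_le_one hn']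
    exact key
  exact (sq_le_one_iff₀ (normalizedNorm_nonneg p x)).1 h1

/-! ### The large deviation principle for the product model -/

/-- The joint law of a uniform point of the `ℓ_p`-ball and an independent uniform point of the
Euclidean ball. -/
noncomputable def ballPair (p : ℝ≥0∞) (n : ℕ) :
    Measure (EuclideanSpace ℝ (Fin n) × EuclideanSpace ℝ (Fin n)) :=
  (lpBallUniform p n).prod (lpBallUniform 2 n)

/-- The `p`-norm, the normalized Euclidean norm and the head ratio of a pair of points. -/
noncomputable def ballStat (p : ℝ≥0∞) {n : ℕ} (k : ℕ)
    (z : EuclideanSpace ℝ (Fin n) × EuclideanSpace ℝ (Fin n)) : ℝ × ℝ × ℝ :=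
  (pNorm p z.1, normalizedNorm p z.1, headRatio k (WithLp.ofLp z.2))

theorem ballPair_prod_le {p : ℝ≥0∞} (hp : 2 ≤ p) {n : ℕ}
    {s : Set (EuclideanSpace ℝ (Fin n) × EuclideanSpace ℝ (Fin n))}
    {A B : Set (EuclideanSpace ℝ (Fin n))} (h : ∀ z ∈ s, z.1 ∈ A ∧ z.2 ∈ B) :
    ballPair p n s ≤ lpBallUniform p n A * lpBallUniform 2 n B := by
  have := isProbabilityMeasure_lpBallUniform hp (n := n)
  have := isProbabilityMeasure_lpBallUniform (p := 2) le_rfl (n := n)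
  rw [ballPair, ← Measure.prod_prod]
  exact measure_mono h

/-- Near a given p-norm ρ, normalized norm q and ratio r, the homothety, the radial estimate and the
ratio estimate multiply; `projectionRate_le` compares the total exponent with the rate at q r. -/
theorem ballPair_eventually_le {p : ℝ≥0∞} (hp : 2 ≤ p) {k : ℕ → ℕ}
    (hk : ∀ n, 2 ≤ n → 1 ≤ k n ∧ k n ≤ n - 1) {lam : ℝ}
    (hlam : Tendsto (fun n : ℕ ↦ (k n : ℝ) / n) atTop (𝓝 lam)) (hlam1 : lam ≤ 1) {ρ q r a : ℝ}
    (hρ0 : 0 ≤ ρ) (hρ1 : ρ ≤ 1) (hq0 : 0 ≤ q) (hr0 : 0 ≤ r) (hr1 : r ≤ 1)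
    (h : (a : EReal) < projectionRate p lam (q * r)) :
    ∃ W ∈ 𝓝 (ρ, q, r), ∀ᶠ n : ℕ in atTop,
      ballPair p n {z | ballStat p (k n) z ∈ W} ≤ ENNReal.ofReal (Real.exp (-(n * a))) := by
  rcases hρ0.eq_or_lt with rfl | hρ0
  -- Near the origin no radial estimate is needed: the ball of radius exp(-a) already has
  -- probability at most exp(-na).
  · refine ⟨{w | w.1 < Real.exp (-a)}, (isOpen_lt continuous_fst continuous_const).mem_nhds
      (Real.exp_pos _), .of_forall fun n ↦ ?_⟩
    have := isProbabilityMeasure_lpBallUniform (p := 2) le_rfl (n := n)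
    refine (ballPair_prod_le hp (A := {x | pNorm p x ≤ Real.exp (-a)}) (B := Set.univ)
      fun z (hz : pNorm p z.1 < Real.exp (-a)) ↦ ⟨hz.le, trivial⟩).trans ?_
    rw [measure_univ, mul_one]
    refine (lpBallUniform_pNorm_le hp n (Real.exp_pos _)).trans_eq ?_
    rw [← Real.exp_nat_mul, mul_neg]
  have hq : 0 ≤ q / ρ := div_nonneg hq0 hρ0.le
  have hJ0 := rateJ_nonneg hp hq
  have hlog : (0 : EReal) ≤ ((-Real.log ρ : ℝ) : EReal) := by
    exact_mod_cast neg_nonneg.2 (Real.log_nonpos hρ0.le hρ1)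
  obtain ⟨d, c, hd, hc, hadc⟩ := EReal.exists_real_lt_add
    (lt_of_lt_of_le (by simp) (add_nonneg hlog hJ0)).ne' (betaRate_ne_bot _ _)
    (h.trans_le (projectionRate_le hp hlam1 hρ0 hρ1 hq0 hr0 hr1))
  obtain ⟨e, b, he, hb, hdeb⟩ := EReal.exists_real_lt_add (EReal.coe_ne_bot _)
    (rateJ_ne_bot hp hq) hd
  rw [EReal.coe_lt_coe_iff] at he
  obtain ⟨V, hV, δ, hδ0, hδ1, hVn⟩ := lpBallUniform_le hp hq hb
  obtain ⟨V', hV', hVn'⟩ := lpBallUniform_headRatio_le hk hlam hr0 hr1 hc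
  have c1 : ∀ᶠ R in 𝓝 ρ, q / R ∈ interior V :=
    ContinuousAt.eventually_mem (f := fun R ↦ q / R)
      (continuousAt_const.div continuousAt_id hρ0.ne') (interior_mem_nhds.2 hV)
  have c2 : ∀ᶠ R in 𝓝 ρ, e < -Real.log R :=
    (Real.continuousAt_log hρ0.ne').neg.tendsto.eventually_const_lt he
  have c3 : ∀ᶠ R in 𝓝 ρ, (1 - δ) * R < ρ :=
    (by fun_prop : ContinuousAt (fun R ↦ (1 - δ) * R) ρ).tendsto.eventually_lt_const
      (by nlinarith)
  -- The outer radius R slightly exceeds ρ, so that ρ is interior to the shell from (1-δ)R to R.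
  obtain ⟨R, ⟨⟨h1, h2⟩, h3⟩, hR⟩ := ((((c1.and c2).and c3).filter_mono
    nhdsWithin_le_nhds).and (self_mem_nhdsWithin (s := Set.Ioi ρ))).exists
  have hR : ρ < R := hR
  have hR0 : 0 < R := hρ0.trans hR
  refine ⟨{w | ((1 - δ) * R < w.1 ∧ w.1 < R) ∧ w.2.1 / R ∈ interior V ∧ w.2.2 ∈ V'}, ?_, ?_⟩
  · refine inter_mem (inter_mem ?_ ?_) (inter_mem ?_ ?_)
    · exact (isOpen_lt continuous_const continuous_fst).mem_nhds h3
    · exact (isOpen_lt continuous_fst continuous_const).mem_nhds hR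
    · have hc : Continuous fun w : ℝ × ℝ × ℝ ↦ w.2.1 / R := by fun_prop
      exact (isOpen_interior.preimage hc).mem_nhds h1
    · have hc : ContinuousAt (fun w : ℝ × ℝ × ℝ ↦ w.2.2) (ρ, q, r) := by fun_prop
      exact hc.preimage_mem_nhds hV'
  filter_upwards [hVn, hVn'] with n hn hn'
  refine (ballPair_prod_le hp (A := {x | (1 - δ) * R ≤ pNorm p x ∧ pNorm p x ≤ R ∧
      normalizedNorm p x / R ∈ V}) (B := {x | headRatio (k n) (WithLp.ofLp x) ∈ V'})
    fun z hz ↦ ⟨⟨hz.1.1.le, hz.1.2.le, interior_subset hz.2.1⟩, hz.2.2⟩).trans ?_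
  refine (mul_le_mul' ((lpBallUniform_scaled_le hp n hR0 V).trans (mul_le_mul' le_rfl hn))
    hn').trans ?_
  rw [← ENNReal.ofReal_mul (by positivity), ← ENNReal.ofReal_mul (by positivity)]
  refine ENNReal.ofReal_le_ofReal ?_
  have hRn : R ^ n = Real.exp (n * Real.log R) := by rw [Real.exp_nat_mul, Real.exp_log hR0]
  rw [hRn, ← Real.exp_add, ← Real.exp_add, Real.exp_le_exp]
  have h5 : a ≤ -Real.log R + b + c := by linarith
  nlinarith [mul_le_mul_of_nonneg_left h5 (Nat.cast_nonneg (α := ℝ) n)]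

theorem ae_ballStat_mem {p : ℝ≥0∞} (hp : 2 ≤ p) {n : ℕ} (hn : 0 < n) (k : ℕ) :
    ballPair p n {z | ballStat p k z ∉
      Set.Icc (0 : ℝ) 1 ×ˢ Set.Icc (0 : ℝ) 1 ×ˢ Set.Icc (0 : ℝ) 1} = 0 := by
  have h0 : lpBallUniform p n (lpBall p n)ᶜ = 0 := by
    rw [lpBallUniform, cond_apply (measurableSet_lpBall hp n), Set.inter_compl_self, measure_empty,
      mul_zero]
  have h1 : ∀ z : EuclideanSpace ℝ (Fin n) × EuclideanSpace ℝ (Fin n), z.1 ∈ lpBall p n →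
      ballStat p k z ∈ Set.Icc (0 : ℝ) 1 ×ˢ Set.Icc (0 : ℝ) 1 ×ˢ Set.Icc (0 : ℝ) 1 :=
    fun z hz ↦ ⟨⟨pNorm_nonneg hp _, mem_lpBall.1 hz⟩,
      ⟨normalizedNorm_nonneg _ _, normalizedNorm_le_one hp hn (mem_lpBall.1 hz)⟩,
      ⟨headRatio_nonneg _ _, headRatio_le_one _ _⟩⟩
  have h2 : ∀ z ∈ {z | ballStat p k z ∉
      Set.Icc (0 : ℝ) 1 ×ˢ Set.Icc (0 : ℝ) 1 ×ˢ Set.Icc (0 : ℝ) 1},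
      z.1 ∈ (lpBall p n)ᶜ ∧ z.2 ∈ Set.univ := fun z hz ↦ ⟨fun hz1 ↦ hz (h1 z hz1), trivial⟩
  refine nonpos_iff_eq_zero.1 ((ballPair_prod_le hp h2).trans_eq ?_)
  rw [h0, zero_mul]

/-- The three statistics stay in a compact cube, which finitely many local estimates cover. -/
theorem ballPair_upper {p : ℝ≥0∞} (hp : 2 ≤ p) {k : ℕ → ℕ}
    (hk : ∀ n, 2 ≤ n → 1 ≤ k n ∧ k n ≤ n - 1) {lam : ℝ}
    (hlam : Tendsto (fun n : ℕ ↦ (k n : ℝ) / n) atTop (𝓝 lam)) (hlam1 : lam ≤ 1) {y a : ℝ}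
    (h : (a : EReal) < projectionRate p lam y) :
    ∃ V, IsOpen V ∧ y ∈ V ∧ ∀ᶠ n : ℕ in atTop,
      ballPair p n {z | normalizedNorm p z.1 * headRatio (k n) (WithLp.ofLp z.2) ∈ V} ≤
        ENNReal.ofReal (Real.exp (-(n * a))) := by
  obtain ⟨a', haa', ha'⟩ := EReal.lt_iff_exists_real_btwn.1 h
  rw [EReal.coe_lt_coe_iff] at haa'
  set K : Set (ℝ × ℝ × ℝ) := Set.Icc (0 : ℝ) 1 ×ˢ Set.Icc (0 : ℝ) 1 ×ˢ Set.Icc (0 : ℝ) 1 with hK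
  have hKc : IsCompact K := isCompact_Icc.prod (isCompact_Icc.prod isCompact_Icc)
  have hcov : ∃ V, IsOpen V ∧ y ∈ V ∧ ∃ M : ℕ, ∀ᶠ n : ℕ in atTop,
      ballPair p n {z | ballStat p (k n) z ∈ K ∧
        normalizedNorm p z.1 * headRatio (k n) (WithLp.ofLp z.2) ∈ V} ≤
        M * ENNReal.ofReal (Real.exp (-(n * a'))) := by
    refine hKc.induction_on (p := fun s ↦ ∃ V, IsOpen V ∧ y ∈ V ∧ ∃ M : ℕ, ∀ᶠ n : ℕ in atTop,
      ballPair p n {z | ballStat p (k n) z ∈ s ∧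
        normalizedNorm p z.1 * headRatio (k n) (WithLp.ofLp z.2) ∈ V} ≤
        M * ENNReal.ofReal (Real.exp (-(n * a'))))
      ⟨Set.univ, isOpen_univ, trivial, 0, by simp⟩ ?_ ?_ ?_
    · rintro s t hst ⟨V, hV, hy, M, hM⟩
      exact ⟨V, hV, hy, M, hM.mono fun n hn ↦
        le_trans (measure_mono (Set.inter_subset_inter_left _ (Set.preimage_mono hst))) hn⟩
    · rintro s t ⟨V, hV, hy, M, hM⟩ ⟨V', hV', hy', M', hM'⟩
      refine ⟨V ∩ V', hV.inter hV', ⟨hy, hy'⟩, M + M', ?_⟩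
      filter_upwards [hM, hM'] with n h1 h2
      rw [Nat.cast_add, add_mul]
      refine le_trans (measure_mono ?_) ((measure_union_le _ _).trans (add_le_add h1 h2))
      rintro z ⟨hz | hz, hzV, hzV'⟩
      · exact Or.inl ⟨hz, hzV⟩
      · exact Or.inr ⟨hz, hzV'⟩
    · rintro ⟨ρ, q, r⟩ ⟨⟨hρ0, hρ1⟩, ⟨hq0, -⟩, hr0, hr1⟩
      by_cases hy : q * r = y
      · subst hy
        obtain ⟨W, hW, hWn⟩ := ballPair_eventually_le hp hk hlam hlam1 hρ0 hρ1 hq0 hr0 hr1 ha'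
        refine ⟨W, mem_nhdsWithin_of_mem_nhds hW, Set.univ, isOpen_univ, trivial, 1, ?_⟩
        filter_upwards [hWn] with n hn
        simpa using hn
      -- A point with q r ≠ y does not contribute: near it the product stays away from a
      -- neighbourhood of y.
      · obtain ⟨U, V, hU, hV, hqU, hyV, hUV⟩ := t2_separation hy
        have hc : Continuous fun w : ℝ × ℝ × ℝ ↦ w.2.1 * w.2.2 := by fun_prop
        refine ⟨(fun w : ℝ × ℝ × ℝ ↦ w.2.1 * w.2.2) ⁻¹' U,
          mem_nhdsWithin_of_mem_nhds ((hU.preimage hc).mem_nhds hqU), V, hV, hyV, 0,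
          .of_forall fun n ↦ ?_⟩
        have he : {z : EuclideanSpace ℝ (Fin n) × EuclideanSpace ℝ (Fin n) |
            ballStat p (k n) z ∈ (fun w : ℝ × ℝ × ℝ ↦ w.2.1 * w.2.2) ⁻¹' U ∧
            normalizedNorm p z.1 * headRatio (k n) (WithLp.ofLp z.2) ∈ V} = ∅ :=
          Set.eq_empty_of_forall_notMem fun z hz ↦
            Set.disjoint_left.1 hUV hz.1 hz.2
        rw [he, measure_empty]
        exact zero_le
  obtain ⟨V, hV, hy, M, hM⟩ := hcov
  refine ⟨V, hV, hy, ?_⟩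
  filter_upwards [hM, eventually_const_mul_exp_le M haa', eventually_gt_atTop 0] with n h1 h2 hn
  refine le_trans ?_ (h1.trans h2)
  have hsub : {z : EuclideanSpace ℝ (Fin n) × EuclideanSpace ℝ (Fin n) |
      normalizedNorm p z.1 * headRatio (k n) (WithLp.ofLp z.2) ∈ V} ⊆
      {z | ballStat p (k n) z ∈ K ∧ normalizedNorm p z.1 * headRatio (k n) (WithLp.ofLp z.2) ∈ V} ∪
      {z | ballStat p (k n) z ∉ K} := by
    intro z hz
    by_cases hzK : ballStat p (k n) z ∈ K
    · exact Or.inl ⟨hzK, hz⟩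
    · exact Or.inr hzK
  refine (measure_mono hsub).trans ((measure_union_le _ _).trans_eq ?_)
  rw [ae_ballStat_mem hp hn, add_zero]

theorem exists_factor_of_projectionRate_lt {p : ℝ≥0∞} (hp : 2 ≤ p) {lam y a : ℝ}
    (h : projectionRate p lam y < a) :
    ∃ q r b c : ℝ, 0 ≤ q ∧ 0 ≤ r ∧ r ≤ 1 ∧ q * r = y ∧ rateJ p q < b ∧ betaRate lam r < c ∧
      b + c < a := by
  unfold projectionRate at h
  split_ifs at h with hy hy0 h0
  · simp only [iInf_lt_iff] at h
    obtain ⟨x, hyx, hx⟩ := h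
    have hx0 : 0 < x := hy.trans_le hyx
    rw [projectionCost_eq_betaRate lam hy hyx] at hx
    obtain ⟨c, b, hc, hb, hcb⟩ := EReal.exists_real_gt_add (betaRate_ne_bot _ _)
      (rateJ_ne_bot hp hx0.le) hx
    exact ⟨x, y / x, b, c, hx0.le, (div_pos hy hx0).le, (div_le_one hx0).2 hyx,
      mul_div_cancel₀ y hx0.ne', hb, hc, by linarith⟩
  · simp only [iInf_lt_iff] at h
    obtain ⟨x, hx0, hx⟩ := h
    obtain ⟨b, hb, hba⟩ := EReal.lt_iff_exists_real_btwn.1 hx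
    rw [EReal.coe_lt_coe_iff] at hba
    -- For y = 0 and λ = 0 the ratio r = 0 is free, so any radial value x is allowed.
    refine ⟨x, 0, b, (a - b) / 2, hx0, le_rfl, zero_le_one, by rw [mul_zero, hy0], hb, ?_,
      by linarith⟩
    have hb : betaRate lam 0 = 0 := by simp [betaRate, h0]
    rw [hb]
    exact_mod_cast (by linarith : 0 < (a - b) / 2)
  · rw [rateJ_zero hp] at h
    simp at h
  · simp at h

/-- By independence, the probability that both factors lie near q and r is the product of the two
lower estimates. -/
theorem ballPair_lower {p : ℝ≥0∞} (hp : 2 ≤ p) {k : ℕ → ℕ}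
    (hk : ∀ n, 2 ≤ n → 1 ≤ k n ∧ k n ≤ n - 1) {lam : ℝ}
    (hlam : Tendsto (fun n : ℕ ↦ (k n : ℝ) / n) atTop (𝓝 lam)) {y a : ℝ}
    (h : projectionRate p lam y < a) {V : Set ℝ} (hV : V ∈ 𝓝 y) :
    ∀ᶠ n : ℕ in atTop, ENNReal.ofReal (Real.exp (-(n * a))) ≤
      ballPair p n {z | normalizedNorm p z.1 * headRatio (k n) (WithLp.ofLp z.2) ∈ V} := by
  obtain ⟨q, r, b, c, hq0, hr0, hr1, rfl, hb, hc, hbc⟩ := exists_factor_of_projectionRate_lt hp h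
  have hmul : ContinuousAt (fun w : ℝ × ℝ ↦ w.1 * w.2) (q, r) := by fun_prop
  obtain ⟨A, hA, B, hB, hAB⟩ := mem_nhds_prod_iff.1 (hmul.preimage_mem_nhds hV)
  filter_upwards [le_lpBallUniform hp hq0 hb hA, le_lpBallUniform_headRatio hk hlam hr0 hr1 hc hB]
    with n h1 h2
  have := isProbabilityMeasure_lpBallUniform hp (n := n)
  have := isProbabilityMeasure_lpBallUniform (p := 2) le_rfl (n := n)
  calc ENNReal.ofReal (Real.exp (-(n * a)))
      ≤ ENNReal.ofReal (Real.exp (-(n * b))) * ENNReal.ofReal (Real.exp (-(n * c))) := by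
        rw [← ENNReal.ofReal_mul (by positivity), ← Real.exp_add]
        refine ENNReal.ofReal_le_ofReal (Real.exp_le_exp.2 ?_)
        nlinarith [mul_le_mul_of_nonneg_left hbc.le (Nat.cast_nonneg (α := ℝ) n)]
    _ ≤ _ := mul_le_mul' h1 h2
    _ = ballPair p n ({x | normalizedNorm p x ∈ A} ×ˢ
        {x | headRatio (k n) (WithLp.ofLp x) ∈ B}) := by rw [ballPair, Measure.prod_prod]
    _ ≤ _ := measure_mono fun z hz ↦ hAB (Set.mk_mem_prod hz.1 hz.2)

theorem measure_projection_eq {Ω : Type*} [MeasurableSpace Ω] {P : Measure Ω}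
    [IsProbabilityMeasure P] {p : ℝ≥0∞} {n k : ℕ} (hn : n ≠ 0) (hk : k ≤ n)
    {X : Ω → EuclideanSpace ℝ (Fin n)} {E : Ω → RealGrassmannian n k}
    (hX : HasLaw X (lpBallUniform p n) P) (hE : HasLaw E (grassmannHaar hk) P)
    (hXE : IndepFun X E P) {V : Set ℝ} (hV : MeasurableSet V) :
    P {ω | (n : ℝ) ^ ((p⁻¹).toReal - 1 / 2) * ‖(E ω).1.starProjection (X ω)‖ ∈ V} =
      ballPair p n {z | normalizedNorm p z.1 * headRatio k (WithLp.ofLp z.2) ∈ V} := by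
  set c := (n : ℝ) ^ ((p⁻¹).toReal - 1 / 2) with hc
  have hV' : MeasurableSet ((fun t : ℝ ↦ c * t) ⁻¹' V) := measurable_const_mul c hV
  have hm : MeasurableSet {z : EuclideanSpace ℝ (Fin n) × RealGrassmannian n k |
      ‖z.2.1.starProjection z.1‖ ∈ (fun t : ℝ ↦ c * t) ⁻¹' V} :=
    (continuous_norm_starProjection n k).measurable hV'
  have hjoint := (indepFun_iff_map_prod_eq_prod_map_map hX.aemeasurable hE.aemeasurable).1 hXE
  rw [hX.map_eq, hE.map_eq] at hjoint
  have h1 : P {ω | c * ‖(E ω).1.starProjection (X ω)‖ ∈ V} =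
      P.map (fun ω ↦ (X ω, E ω)) {z : EuclideanSpace ℝ (Fin n) × RealGrassmannian n k |
        ‖z.2.1.starProjection z.1‖ ∈ (fun t : ℝ ↦ c * t) ⁻¹' V} :=
    (Measure.map_apply_of_aemeasurable (hX.aemeasurable.prodMk hE.aemeasurable) hm).symm
  refine h1.trans ?_
  rw [hjoint]
  refine (prod_grassmannHaar_norm_starProjection hn hk hV').trans ?_
  rw [ballPair]
  congr 1
  ext z
  simp only [normalizedNorm, ← hc, Set.mem_ofPred_eq, Set.mem_preimage, mul_assoc]

theorem satisfiesLDP_projection {Ω : Type*} [MeasurableSpace Ω] (P : Measure Ω)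
    [IsProbabilityMeasure P] (p : ℝ≥0∞) (hp : 2 ≤ p)
    (k : ℕ → ℕ) (hk : ∀ n, 2 ≤ n → 1 ≤ k n ∧ k n ≤ n - 1)
    (lam : ℝ) (hlam : Tendsto (fun n : ℕ ↦ (k n : ℝ) / n) atTop (𝓝 lam))
    (X : ∀ n : ℕ, Ω → EuclideanSpace ℝ (Fin n))
    (E : ∀ n : ℕ, Ω → RealGrassmannian n (k n))
    (hX : ∀ n, 2 ≤ n → HasLaw (X n) (lpBallUniform p n) P)
    (hE : ∀ n, ∀ hn : 2 ≤ n,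
      HasLaw (E n) (grassmannHaar ((hk n hn).2.trans (Nat.sub_le n 1))) P)
    (hXE : ∀ n, 2 ≤ n → IndepFun (X n) (E n) P) :
    SatisfiesLDP P
      (fun n ω ↦ (n : ℝ) ^ ((p⁻¹).toReal - 1 / 2) * ‖(E n ω).1.starProjection (X n ω)‖)
      (fun n ↦ (n : ℝ)) (projectionRate p lam) := by
  have hlam1 : lam ≤ 1 := by
    refine le_of_tendsto hlam ?_
    filter_upwards [eventually_ge_atTop 2] with n hn
    refine div_le_one_of_le₀ ?_ n.cast_nonneg
    exact_mod_cast (hk n hn).2.trans (Nat.sub_le n 1)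
  have hlaw : ∀ n : ℕ, 2 ≤ n → ∀ V : Set ℝ, MeasurableSet V →
      P {ω | (n : ℝ) ^ ((p⁻¹).toReal - 1 / 2) * ‖(E n ω).1.starProjection (X n ω)‖ ∈ V} =
      ballPair p n {z | normalizedNorm p z.1 * headRatio (k n) (WithLp.ofLp z.2) ∈ V} :=
    fun n hn V hV ↦ measure_projection_eq (by omega) _ (hX n hn) (hE n hn) (hXE n hn) hV
  refine satisfiesLDP_of_local P _ _ (isCompact_Icc (a := (0 : ℝ)) (b := 1)) ?_ ?_ ?_
  · filter_upwards [eventually_ge_atTop 2] with n hn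
    refine (hlaw n hn (Set.Icc 0 1)ᶜ measurableSet_Icc.compl).trans ?_
    have hsub : {z : EuclideanSpace ℝ (Fin n) × EuclideanSpace ℝ (Fin n) |
        normalizedNorm p z.1 * headRatio (k n) (WithLp.ofLp z.2) ∈ (Set.Icc (0 : ℝ) 1)ᶜ} ⊆ {z | ballStat p (k n) z ∉
          Set.Icc (0 : ℝ) 1 ×ˢ Set.Icc (0 : ℝ) 1 ×ˢ Set.Icc (0 : ℝ) 1} := fun z hz hzK ↦
      hz ⟨mul_nonneg hzK.2.1.1 hzK.2.2.1, mul_le_one₀ hzK.2.1.2 hzK.2.2.1 hzK.2.2.2⟩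
    exact measure_mono_null hsub (ae_ballStat_mem hp (by omega) (k n))
  · intro y a h
    obtain ⟨V, hV, hy, hVn⟩ := ballPair_upper hp hk hlam hlam1 h
    refine ⟨V, hV.mem_nhds hy, ?_⟩
    filter_upwards [hVn, eventually_ge_atTop 2] with n h1 hn
    exact (hlaw n hn V hV.measurableSet).trans_le h1
  · intro y a h V hV
    filter_upwards [ballPair_lower hp hk hlam h (interior_mem_nhds.2 hV), eventually_ge_atTop 2]
      with n h1 hn
    refine (h1.trans_eq (hlaw n hn _ isOpen_interior.measurableSet).symm).trans ?_
    exact measure_mono (Set.preimage_mono interior_subset)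

/-! ### The explicit rate function for `p = 2` -/

theorem partitionFn_two (t s : ℝ) :
    partitionFn volume (fun x ↦ |x| ^ (2 : ℝ)) t s = √(Real.pi / (s - t)) := by
  rw [partitionFn, ← integral_gaussian]
  refine integral_congr_ae (.of_forall fun x ↦ ?_)
  simp only [Real.rpow_two, sq_abs]
  congr 1; ring

theorem pGaussianConst_two : pGaussianConst 2 = √(2 * Real.pi) := by
  have h : (1 : ℝ) + 1 / 2 = 1 / 2 + 1 := by ring
  rw [pGaussianConst, h, Real.Gamma_add_one (by norm_num), Real.Gamma_one_half_eq,
    ← Real.sqrt_eq_rpow, Real.sqrt_mul (by norm_num)]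
  ring

theorem rateJ_two_one : rateJ 2 1 = 0 := by
  refine le_antisymm ?_ (rateJ_nonneg le_rfl zero_le_one)
  have h1 : rateJ 2 1 ≤ pCumulantDual 2 1 1 := by
    simp only [rateJ, ENNReal.ofNat_ne_top, if_false, ENNReal.toReal_ofNat]
    refine iInf_le_of_le 1 (iInf_le_of_le 1 (iInf_le_of_le one_pos
        (iInf_le_of_le one_pos (iInf_le_of_le ?_ le_rfl))))
    simp
  refine h1.trans ?_
  by_contra! h
  obtain ⟨t, s, hts, hlt⟩ := exists_lt_of_lt_pCumulantDual (a := 0) le_rfl h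
  rw [admissible_abs_rpow_two_iff] at hts
  have hu : 0 < s - t := sub_pos.2 hts
  rw [partitionFn_two, pGaussianConst_two, Real.log_sqrt (by positivity),
    Real.log_sqrt (by positivity), Real.log_div Real.pi_ne_zero hu.ne',
    Real.log_mul two_ne_zero Real.pi_ne_zero] at hlt
  -- With u = s - t the dual at (1, 1) is (1 - 2u + log(2u))/2, which is never positive.
  have h2 := Real.log_le_sub_one_of_pos (mul_pos two_pos hu)
  rw [Real.log_mul two_ne_zero hu.ne'] at h2
  linarith

theorem rateJ_two_of_ne_one {y : ℝ} (hy : y ≠ 1) : rateJ 2 y = ⊤ := by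
  by_contra h
  obtain ⟨a, ha, -⟩ := EReal.lt_iff_exists_real_btwn.1 (lt_top_iff_ne_top.2 h)
  simp only [rateJ, ENNReal.ofNat_ne_top, if_false, ENNReal.toReal_ofNat, iInf_lt_iff] at ha
  obtain ⟨x₁, x₂, hx₁, hx₂, rfl, hdual⟩ := ha
  have hx : x₁ - x₂ ≠ 0 := by
    intro hx
    rw [sub_eq_zero] at hx
    subst hx
    rw [← Real.rpow_add hx₁, add_neg_cancel, Real.rpow_zero] at hy
    exact hy rfl
  -- For p = 2 the two statistics coincide, so the tilt (s - 1, s) is exp(-x²) whatever s is. The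
  -- dual is then affine in s with slope x₁ - x₂ ≠ 0, hence unbounded.
  have key : ∀ s : ℝ, s * (x₁ - x₂) ≤
      a + x₁ - 1 / 2 * x₂ + Real.log √Real.pi - Real.log (pGaussianConst 2) := by
    intro s
    have h1 := le_of_pCumulantDual_lt le_rfl hdual
      (admissible_abs_rpow_two_iff.2 (by linarith : s - 1 < s))
    rw [partitionFn_two, sub_sub_cancel, div_one] at h1
    linarith
  have h2 := key ((a + x₁ - 1 / 2 * x₂ + Real.log √Real.pi - Real.log (pGaussianConst 2) + 1) /
    (x₁ - x₂))
  rw [div_mul_cancel₀ _ hx] at h2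
  linarith

theorem projectionCost_ne_bot (lam x y : ℝ) : projectionCost lam x y ≠ ⊥ := by
  unfold projectionCost
  rw [Ne, EReal.add_eq_bot_iff]
  split_ifs <;> simp [-EReal.coe_mul]

theorem projectionRate_two_of_pos {lam y : ℝ} (hy : 0 < y) :
    projectionRate 2 lam y = if y ≤ 1 then projectionCost lam 1 y else ⊤ := by
  have htop : ∀ x : ℝ, x ≠ 1 → projectionCost lam x y + rateJ 2 x = ⊤ := fun x hx ↦ by
    rw [rateJ_two_of_ne_one hx, EReal.add_top_of_ne_bot (projectionCost_ne_bot _ _ _)]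
  rw [projectionRate, if_pos hy]
  split_ifs with hy1
  · refine le_antisymm ((iInf₂_le 1 hy1).trans_eq ?_) (le_iInf₂ fun x _ ↦ ?_)
    · rw [rateJ_two_one, add_zero]
    · rcases eq_or_ne x 1 with rfl | hx
      · rw [rateJ_two_one, add_zero]
      · rw [htop x hx]
        exact le_top
  · refine eq_top_iff.2 (le_iInf₂ fun x hx ↦ ?_)
    rw [htop x (by rintro rfl; exact hy1 hx)]

theorem projectionRate_two (lam y : ℝ) : projectionRate 2 lam y = euclideanRate lam y := by
  rcases lt_trichotomy y 0 with hy | rfl | hy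
  · have h1 : ¬ 0 < y := hy.not_gt
    have h2 : ¬ 0 ≤ y := hy.not_ge
    simp [projectionRate, euclideanRate, h1, h2, hy.ne]
  · by_cases h0 : lam = 0
    · have h1 : ⨅ (x : ℝ) (_ : 0 ≤ x), rateJ 2 x = 0 :=
        le_antisymm ((iInf₂_le 1 zero_le_one).trans_eq rateJ_two_one)
          (le_iInf₂ fun x hx ↦ rateJ_nonneg le_rfl hx)
      simp [projectionRate, euclideanRate, h0, h1]
    · simp [projectionRate, euclideanRate, h0, rateJ_zero]
  · rw [projectionRate_two_of_pos hy]
    by_cases h0 : lam = 0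
    · subst h0
      rcases lt_trichotomy y 1 with hy1 | rfl | hy1
      · simp only [projectionCost, euclideanRate, hy1.le, hy.le, hy1, hy1.ne', if_true, if_false,
          and_self, zero_add, zero_ne_one, sub_zero, one_pow, div_one, one_div, Real.log_inv]
        congr 1; ring
      · simp [projectionCost, euclideanRate]
      · simp [euclideanRate, hy1.not_ge, hy1.not_gt]
    by_cases h1 : lam = 1
    · subst h1
      by_cases hy1 : y ≤ 1
      · simp only [projectionCost, euclideanRate, hy1, hy, if_true, if_false, and_self, add_zero,
          one_ne_zero, one_pow, mul_one, one_div, Real.log_inv]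
        congr 1; ring
      · simp [euclideanRate, hy1]
    rcases lt_trichotomy y 1 with hy1 | rfl | hy1
    · simp only [projectionCost, euclideanRate, hy1.le, hy, hy1, hy1.ne', h0, h1, if_true, if_false,
        and_self, one_pow, mul_one, div_one, EReal.coe_add]
    · simp [projectionCost, euclideanRate, h0, h1, -EReal.coe_mul]
    · simp [euclideanRate, hy1.not_ge, hy1.not_gt, h0, h1]

theorem theorem1p1
    {Ω : Type*} [MeasurableSpace Ω] (P : Measure Ω) [IsProbabilityMeasure P]
    (p : ℝ≥0∞) (hp : 2 ≤ p)
    (k : ℕ → ℕ) (hk : ∀ n, 2 ≤ n → 1 ≤ k n ∧ k n ≤ n - 1)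
    (lam : ℝ) (hlam : Tendsto (fun n : ℕ ↦ (k n : ℝ) / n) atTop (𝓝 lam))
    (X : ∀ n : ℕ, Ω → EuclideanSpace ℝ (Fin n))
    (E : ∀ n : ℕ, Ω → RealGrassmannian n (k n))
    (hX : ∀ n, 2 ≤ n → HasLaw (X n) (lpBallUniform p n) P)
    (hE : ∀ n, ∀ hn : 2 ≤ n,
      HasLaw (E n) (grassmannHaar ((hk n hn).2.trans (Nat.sub_le n 1))) P)
    (hXE : ∀ n, 2 ≤ n → IndepFun (X n) (E n) P) :
    SatisfiesLDP P
      (fun n ω ↦ (n : ℝ) ^ ((p⁻¹).toReal - 1 / 2) * ‖(E n ω).1.starProjection (X n ω)‖)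
      (fun n ↦ (n : ℝ)) (projectionRate p lam) ∧
    (p = 2 → ∀ y : ℝ, projectionRate p lam y = euclideanRate lam y) := by
  exact ⟨satisfiesLDP_projection P p hp k hk lam hlam X E hX hE hXE,
    fun hp2 y ↦ hp2 ▸ projectionRate_two lam y⟩
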